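/- Let $L>0$ and let $f:\mathbb R\to\mathbb R$ be of class $C^2$ with $f(0)=0$. Consider the controlled equation $$y_t=y_{xx}+f(y)\ \text{ on }(0,L),\qquad y(t,0)=0,\quad y(t,L)=u(t),$$ with solutions $y\in Y_T=L^2(0,T;H^2(0,L))\cap H^1(0,T;L^2(0,L))$, and set $z(t,x)=y(t,x)-\frac xL u(t)$. Let $A=\partial_{xx}+f'(0)\,\mathrm{id}$ with domain $H^2(0,L)\cap H^1_0(0,L)$, and for $j\ge 1$ let $e_j(x)=\sqrt{2/L}\,\sin(j\pi x/L)$, $\lambda_j=f'(0)-(j\pi/L)^2$, $z_j=\int_0^L z\,e_j\,dx$, $a_j=\frac{f'(0)}L\int_0^L x\,e_j(x)\,dx$, $b_j=-\frac1L\int_0^L x\,e_j(x)\,dx$. For $n\ge1$ let $X_n=(u,z_1,\dots,z_n)^\top$, $B_n=(1,b_1,\dots,b_n)^\top$, and let $A_n$ be the $(n+1)\times(n+1)$ matrix whose first row is zero, whose first column is $(0,a_1,\dots,a_n)^\top$, and whose remaining $n\times n$ block is $\mathrm{diag}(\lambda_1,\dots,\lambda_n)$. Then: 1. $(e_j)_{j\ge1}$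 is a Hilbert basis of $L^2(0,L)$ consisting of $C^2$ eigenfunctions of $A$ vanishing at $0$ and $L$, with eigenvalues $\lambda_1>\lambda_2>\cdots\to-\infty$. For $z\in H^1_0(0,L)$ the series $\sum_j\lambda_jz_j^2$ converges, and its sum is $\langle z,Az\rangle_{L^2(0,L)}$ if $z\in H^2(0,L)\cap H^1_0(0,L)$. 2. For every $n\ge 1$ there is a row vector $K_n=(k_0,\dots,k_n)$ such that $A_n+B_nK_n$ has $-1$ as an eigenvalue of algebraic multiplicity $n+1$; and for every such $K_n$ there is a symmetric positive definite matrix $P_n$ with $P_n(A_n+B_nK_n)+(A_n+B_nK_n)^\top P_n=-I_{n+1}$. 3. Let $n\ge1$ be such that $\lambda_{n+1}<0$ (which holds for all large $n$), and let $K_n$ be as in 2. Then the feedback $u'=K_n(u,z_1,\dots,z_n)^\top$ makes $0$ locally asymptotically stable for the closed-loop system, with state $(u,z)\in\mathbb R\times H^1_0(0,L)$ and norm $(u^2+\|z_x\|_{L^2(0,L)}^2)^{1/2}$. That is: small initial data $(u(0),z(0,\cdot))\in\mathbb R\times H^1_0(0,L)$ generate a solution on $[0,\infty)$ (with $y\in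 Y_T$ for all $T>0$); solutions on $[0,T]$ are determined by their initial data; for every $\varepsilon>0$ there is $\delta>0$ such that every solution on some $[0,T]$ with initial norm less than $\delta$ stays in $\mathbb R\times H^1_0(0,L)$ with norm less than $\varepsilon$; and every solution on $[0,\infty)$ with sufficiently small initial norm tends to $0$ in $\mathbb R\times H^1_0(0,L)$ as $t\to+\infty$. 4. With $n,K_n$ as in 3 and any $P_n$ as in 2, there is $\gamma_0>0$ such that for every $\gamma\ge\gamma_0$ the function $$V(u,z)=\gamma\,X_n^\top P_nX_n-\frac12\sum_{j\ge1}\lambda_jz_j^2$$ (that is, $\gamma X_n^\top P_nX_n-\frac12\langle z,Az\rangle_{L^2(0,L)}$ for $z\in H^2(0,L)\cap H^1_0(0,L)$) is a Lyapunov function for the closed-loop system, in the following sense. There are $C_1,C_2>0$ with $C_1(u^2+\|z_x\|_{L^2}^2)\le V(u,z)\le C_2(u^2+\|z_x\|_{L^2}^2)$ for all $(u,z)\in\mathbb R\times H^1_0(0,L)$. For every $B>0$ there are $C,C'>0$ such that along every closed-loop solution on any interval $[0,T]$ satisfying $|u(t)|\le B$ and $|z(t,x)|\le B$ for all $(t,x)\in[0,T]\times[0,L]$,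 one has $z(t,\cdot)\in H^1_0(0,L)$ for all $t\in[0,T]$, the function $t\mapsto V(u(t),z(t,\cdot))$ is absolutely continuous on $[0,T]$, and $\frac{d}{dt}V\le -C\,V+C'\,V^{3/2}$ for almost every $t\in[0,T]$. -/

import Mathlib

open MeasureTheory Set Filter Topology Matrix

noncomputable section

namespace HeatStab

/-! ### Sobolev spaces in one variable

In one variable, `H¹(a,b)` consists of the absolutely continuous functions on `[a,b]` whose
derivative is in `L²(a,b)`.  Functions are given by their continuous representative on the closed
interval; values outside of it play no role. -/

/-- `w ∈ H¹(a,b)` with derivative `g ∈ L²(a,b)`. -/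
def HasL2Deriv (a b : ℝ) (w g : ℝ → ℝ) : Prop :=
  MemLp g 2 (volume.restrict (Ioc a b)) ∧ ∀ x ∈ Icc a b, w x = w a + ∫ s in a..x, g s

/-- `w ∈ H¹₀(0,L)`. -/
def MemH10 (L : ℝ) (w : ℝ → ℝ) : Prop :=
  w 0 = 0 ∧ w L = 0 ∧ ∃ g, HasL2Deriv 0 L w g

/-- The norm `(∫₀ᴸ |w'|²)^(1/2)` of `H¹₀(0,L)`. The almost everywhere derivative of an absolutely
continuous function is its weak derivative. -/
def h10Norm (L : ℝ) (w : ℝ → ℝ) : ℝ :=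
  Real.sqrt (∫ x in (0 : ℝ)..L, (deriv w x) ^ 2)

/-- The norm of `(u, z)` in `ℝ × H¹₀(0,L)`. -/
def stateNorm (L : ℝ) (u : ℝ) (z : ℝ → ℝ) : ℝ :=
  Real.sqrt (u ^ 2 + h10Norm L z ^ 2)

/-- `y ∈ Y_T = L²(0,T; H²(0,L)) ∩ H¹(0,T; L²(0,L))`, with `y_t = yt`, `y_x = yx`, `y_xx = yxx`.
The space `Y_T` embeds into the continuous functions on `[0,T] × [0,L]`, and `y` is the
continuous representative, so that boundary and initial values are plain values of `y`. -/
structure MemYT (L T : ℝ) (y yt yx yxx : ℝ → ℝ → ℝ) : Prop where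
  continuousOn : ContinuousOn (fun p : ℝ × ℝ => y p.1 p.2) (Icc 0 T ×ˢ Icc 0 L)
  memLp_t : MemLp (fun p : ℝ × ℝ => yt p.1 p.2) 2 (volume.restrict (Ioc 0 T ×ˢ Ioc 0 L))
  memLp_x : MemLp (fun p : ℝ × ℝ => yx p.1 p.2) 2 (volume.restrict (Ioc 0 T ×ˢ Ioc 0 L))
  memLp_xx : MemLp (fun p : ℝ × ℝ => yxx p.1 p.2) 2 (volume.restrict (Ioc 0 T ×ˢ Ioc 0 L))
  deriv_t : ∀ᵐ x ∂(volume.restrict (Ioc 0 L)),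
    HasL2Deriv 0 T (fun t => y t x) (fun t => yt t x)
  deriv_x : ∀ᵐ t ∂(volume.restrict (Ioc 0 T)),
    HasL2Deriv 0 L (y t) (yx t) ∧ HasL2Deriv 0 L (yx t) (yxx t)

/-! ### The operator `A = ∂ₓₓ + c` on `H² ∩ H¹₀(0,L)` and its spectral decomposition

In all that follows `c` stands for `f'(0)`, and modes are numbered from `1`. -/

/-- The eigenfunction `e_j(x) = √(2/L) sin (jπx/L)`. -/
def mode (L : ℝ) (j : ℕ) (x : ℝ) : ℝ :=
  Real.sqrt (2 / L) * Real.sin (j * Real.pi * x / L)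

/-- The eigenvalue `λ_j = c - (jπ/L)²`. -/
def eigenvalue (L c : ℝ) (j : ℕ) : ℝ :=
  c - (j * Real.pi / L) ^ 2

/-- The coefficient `⟨w, e_j⟩` in `L²(0,L)`. -/
def coeff (L : ℝ) (j : ℕ) (w : ℝ → ℝ) : ℝ :=
  ∫ x in (0 : ℝ)..L, w x * mode L j x

/-- `(e_j)` is a Hilbert basis of `L²(0,L)` of Dirichlet eigenfunctions of `∂ₓₓ + c` of class `C²`,
with eigenvalues `lam_j` strictly decreasing to `-∞`. -/
structure IsDirichletEigenbasis (L c : ℝ) (e : ℕ → ℝ → ℝ) (lam : ℕ → ℝ) : Prop where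
  contDiff : ∀ j, ContDiff ℝ 2 (e j)
  boundary : ∀ j, e j 0 = 0 ∧ e j L = 0
  eigen : ∀ j, ∀ x ∈ Icc 0 L, deriv (deriv (e j)) x + c * e j x = lam j * e j x
  orthonormal : ∀ i j, ∫ x in (0 : ℝ)..L, e i x * e j x = if i = j then 1 else 0
  complete : ∀ g : ℝ → ℝ, MemLp g 2 (volume.restrict (Ioc 0 L)) →
    (∀ j, ∫ x in (0 : ℝ)..L, g x * e j x = 0) → g =ᵐ[volume.restrict (Ioc 0 L)] 0
  strictAnti : StrictAnti lam
  tendsto : Tendsto lam atTop atBot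

/-- The coefficient `a_j` of `a(x) = (x/L) c`. -/
def aCoeff (L c : ℝ) (j : ℕ) : ℝ := coeff L j (fun x => x / L * c)

/-- The coefficient `b_j` of `b(x) = -x/L`. -/
def bCoeff (L : ℝ) (j : ℕ) : ℝ := coeff L j (fun x => -(x / L))

/-! ### The finite-dimensional part -/

/-- `X_n = (u, z_1, …, z_n)`. -/
def stateVec (L : ℝ) (n : ℕ) (u : ℝ) (z : ℝ → ℝ) : Fin (n + 1) → ℝ :=
  Fin.cons u (fun i : Fin n => coeff L ((i : ℕ) + 1) z)

/-- The matrix `A_n`: first row zero, first column `(0, a_1, …, a_n)`, and the remaining block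
diagonal with entries `λ_1, …, λ_n`. -/
def matA (L c : ℝ) (n : ℕ) : Matrix (Fin (n + 1)) (Fin (n + 1)) ℝ :=
  Matrix.of (Fin.cons (fun _ => 0) (fun i : Fin n =>
    Fin.cons (aCoeff L c ((i : ℕ) + 1)) (fun j : Fin n => if i = j then eigenvalue L c ((i : ℕ) + 1) else 0)))

/-- The vector `B_n = (1, b_1, …, b_n)`. -/
def vecB (L : ℝ) (n : ℕ) : Fin (n + 1) → ℝ :=
  Fin.cons 1 (fun i : Fin n => bCoeff L ((i : ℕ) + 1))

/-- The matrix `A_n + B_n K`, for a row vector `K = (k_0, …, k_n)`. -/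
def closedLoopMat (L c : ℝ) (n : ℕ) (K : Fin (n + 1) → ℝ) : Matrix (Fin (n + 1)) (Fin (n + 1)) ℝ :=
  matA L c n + Matrix.vecMulVec (vecB L n) K

/-- `A_n + B_n K` has `-1` as an eigenvalue of (algebraic) multiplicity `n + 1`. -/
def PlacesPoles (L c : ℝ) (n : ℕ) (K : Fin (n + 1) → ℝ) : Prop :=
  (closedLoopMat L c n K).charpoly = (Polynomial.X + Polynomial.C 1) ^ (n + 1)

/-- `P` is symmetric positive definite and `P M + Mᵀ P = -I` for `M = A_n + B_n K`. -/
def SolvesLyapunov (L c : ℝ) (n : ℕ) (K : Fin (n + 1) → ℝ)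
    (P : Matrix (Fin (n + 1)) (Fin (n + 1)) ℝ) : Prop :=
  P.PosDef ∧ P * closedLoopMat L c n K + (closedLoopMat L c n K)ᵀ * P = -1

/-- `V(u,z) = γ X_nᵀ P X_n - ½ ∑_{j ≥ 1} λ_j z_j²`. -/
def lyapV (L c : ℝ) (n : ℕ) (P : Matrix (Fin (n + 1)) (Fin (n + 1)) ℝ) (γ u : ℝ) (z : ℝ → ℝ) : ℝ :=
  γ * (stateVec L n u z ⬝ᵥ P *ᵥ stateVec L n u z)
    - 1 / 2 * ∑' j : ℕ, eigenvalue L c (j + 1) * coeff L (j + 1) z ^ 2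

/-! ### The closed-loop system -/

/-- `z(t,·) = y(t,·) - (x/L) u(t)`. -/
def shifted (L : ℝ) (u : ℝ → ℝ) (y : ℝ → ℝ → ℝ) (t : ℝ) : ℝ → ℝ :=
  fun x => y t x - x / L * u t

/-- `(u, y)` is a solution on `[0,T]`, with `y ∈ Y_T`, of `y_t = y_xx + f(y)`, `y(t,0) = 0`,
`y(t,L) = u(t)`, `u' = K (u, z_1, …, z_n)`, where `z = y - (x/L) u`. -/
structure IsSolution (L : ℝ) (f : ℝ → ℝ) (n : ℕ) (K : Fin (n + 1) → ℝ) (T : ℝ)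
    (u : ℝ → ℝ) (y : ℝ → ℝ → ℝ) : Prop where
  equation : ∃ yt yx yxx : ℝ → ℝ → ℝ, MemYT L T y yt yx yxx ∧
    ∀ᵐ p : ℝ × ℝ ∂(volume.restrict (Ioc 0 T ×ˢ Ioc 0 L)),
      yt p.1 p.2 = yxx p.1 p.2 + f (y p.1 p.2)
  boundary_zero : ∀ t ∈ Icc 0 T, y t 0 = 0
  boundary_L : ∀ t ∈ Icc 0 T, y t L = u t
  feedback : ∀ t ∈ Icc 0 T,
    HasDerivWithinAt u (K ⬝ᵥ stateVec L n (u t) (shifted L u y t)) (Icc 0 T) t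

/-- Local asymptotic stability of the equilibrium `0` of the closed-loop system, with state
`(u, z)` in `ℝ × H¹₀(0,L)`. -/
structure IsLocallyAsymptoticallyStable (L : ℝ) (f : ℝ → ℝ) (n : ℕ) (K : Fin (n + 1) → ℝ) :
    Prop where
  /-- Small initial data generate a solution that is defined for all times. -/
  exists_global : ∃ δ > 0, ∀ (u₀ : ℝ) (z₀ : ℝ → ℝ), MemH10 L z₀ → stateNorm L u₀ z₀ < δ →
    ∃ (u : ℝ → ℝ) (y : ℝ → ℝ → ℝ), (∀ T > 0, IsSolution L f n K T u y) ∧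
      u 0 = u₀ ∧ ∀ x ∈ Icc 0 L, y 0 x = z₀ x + x / L * u₀
  /-- Solutions are determined by their initial data. -/
  unique : ∀ T > 0, ∀ (u₁ u₂ : ℝ → ℝ) (y₁ y₂ : ℝ → ℝ → ℝ),
    IsSolution L f n K T u₁ y₁ → IsSolution L f n K T u₂ y₂ →
    u₁ 0 = u₂ 0 → (∀ x ∈ Icc 0 L, y₁ 0 x = y₂ 0 x) →
    ∀ t ∈ Icc 0 T, u₁ t = u₂ t ∧ ∀ x ∈ Icc 0 L, y₁ t x = y₂ t x
  /-- Lyapunov stability. -/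
  stable : ∀ ε > 0, ∃ δ > 0, ∀ T > 0, ∀ (u : ℝ → ℝ) (y : ℝ → ℝ → ℝ), IsSolution L f n K T u y →
    MemH10 L (shifted L u y 0) → stateNorm L (u 0) (shifted L u y 0) < δ →
    ∀ t ∈ Icc 0 T, MemH10 L (shifted L u y t) ∧ stateNorm L (u t) (shifted L u y t) < ε
  /-- Local attractivity. -/
  attractive : ∃ δ > 0, ∀ (u : ℝ → ℝ) (y : ℝ → ℝ → ℝ), (∀ T > 0, IsSolution L f n K T u y) →
    MemH10 L (shifted L u y 0) → stateNorm L (u 0) (shifted L u y 0) < δ →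
    (∀ t ≥ 0, MemH10 L (shifted L u y t)) ∧
      Tendsto (fun t => stateNorm L (u t) (shifted L u y t)) atTop (𝓝 0)

/-- `V` is a Lyapunov function of the closed-loop system: it is equivalent to the squared norm of
`ℝ × H¹₀(0,L)`, and along every solution with `|u| ≤ B` and `|z| ≤ B` it is absolutely continuous
and satisfies `dV/dt ≤ -C V + C' V^(3/2)` almost everywhere. -/
structure IsLyapunovFunction (L : ℝ) (f : ℝ → ℝ) (n : ℕ) (K : Fin (n + 1) → ℝ)
    (V : ℝ → (ℝ → ℝ) → ℝ) : Prop where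
  equiv_norm : ∃ C₁ > 0, ∃ C₂ > 0, ∀ (u : ℝ) (z : ℝ → ℝ), MemH10 L z →
    C₁ * stateNorm L u z ^ 2 ≤ V u z ∧ V u z ≤ C₂ * stateNorm L u z ^ 2
  decay : ∀ B > 0, ∃ C > 0, ∃ C' > 0, ∀ T > 0, ∀ (u : ℝ → ℝ) (y : ℝ → ℝ → ℝ),
    IsSolution L f n K T u y →
    (∀ t ∈ Icc 0 T, |u t| ≤ B ∧ ∀ x ∈ Icc 0 L, |shifted L u y t x| ≤ B) →
    (∀ t ∈ Icc 0 T, MemH10 L (shifted L u y t)) ∧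
    ∃ V' : ℝ → ℝ, IntervalIntegrable V' volume 0 T ∧
      (∀ t ∈ Icc 0 T, V (u t) (shifted L u y t) =
        V (u 0) (shifted L u y 0) + ∫ s in (0 : ℝ)..t, V' s) ∧
      ∀ᵐ t ∂(volume.restrict (Ioc 0 T)),
        V' t ≤ -C * V (u t) (shifted L u y t) + C' * V (u t) (shifted L u y t) ^ (3 / 2 : ℝ)

end HeatStab

end

/-!
Everything takes place in sine coefficients. The sine modes are complete in `L²(0,L)`
(`isCompleteFamily_mode`): if `g` is orthogonal to all sines, its primitive is, up to a constant,
orthogonal to all cosines, hence to all polynomials in `cos (πx/L)`, which are dense by the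
Weierstrass theorem. Differentiation turns sine coefficients into cosine coefficients, so that `H¹₀`
is the space of continuous functions vanishing at the end points with `∑ (jπ/L)² w_j² < ∞`
(`hasSum_h10Norm_sq`, `memH10_of_summable`), and `∂ₓₓ` acts on `H² ∩ H¹₀` as the multiplication by
`-(jπ/L)²` (`coeff_second_deriv`).

The pair `(A_n, B_n)` satisfies the Kalman condition mode by mode, since `x/L` has no vanishing sine
coefficient; together with an explicit formula for the characteristic polynomial of `A_n + B_n K`,
pole placement becomes a partial fraction decomposition (`exists_placesPoles`). When all poles are at
`-1`, the matrix `A_n + B_n K + 1` is nilpotent, the Cayley transform of `A_n + B_n K` is nilpotent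
too, and the Lyapunov equation becomes a Stein equation that is solved by a finite sum
(`exists_lyapunov_solution`).

Along a solution, `z_j' = -(jπ/L)² z_j + F_j`, where `F_j` is the sine coefficient of
`f(y) - (x/L) u'` (`IsSolution.coeff_eq_integral`). As `∑ ((jπ/L)² z_j)²` and `∑ (z_j')²` are
integrable in time, the series in `V` may be differentiated term by term, and `V` is absolutely
continuous (`IsSolution.lyapV_eq_integral`). Its derivative consists of `-γ |X_n|²`, from the
Lyapunov equation, of `-∑ (λ_j z_j)²`, of the influence of `u` and `u'` on all modes, and of terms
containing the remainder `f(y) - f'(0) y`. The influence of `u` and `u'` is at most a multiple of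
`|X_n|²` plus a part of `∑ (λ_j z_j)²`, and is absorbed for large `γ`; the remainder contributes
terms that are cubic in the norm of the state. This gives `dV/dt ≤ -C V + C' V^(3/2)`
(`exists_lyapRate_le`, `exists_isLyapunovFunction`). Small sublevel sets of `V` are then invariant
(`IsLyapunovFunction.exists_invariant`), which yields stability and, by Grönwall's inequality,
exponential decay of `V` (`IsLyapunovFunction.stable`, `IsLyapunovFunction.attractive`). Uniqueness
is an energy estimate in `ℝ × L²` (`IsSolution.unique`).

For existence, `f` is truncated to a globally Lipschitz function. The variation of constants formula
for the modes then has a fixed point among the continuous functions of at most exponential growth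
(`exists_mild_solution`). The energy estimate for each mode makes the coefficients of `z_xx` square
summable in space and time; the Riesz–Fischer theorem on the rectangle provides `y_xx` as a jointly
measurable function (`exists_coeff_slice_eq`), and `y_x`, `y_t` are recovered from it
(`exists_isSolution_of_lipschitz`). The stability theorem, applied to the truncated problem, keeps
small solutions in the region where the truncation has no effect (`isLocallyAsymptoticallyStable`).
-/

noncomputable section

namespace HeatStab

/-! ### Orthonormal families of functions in `L²` -/

section L2

variable {α ι : Type*} [MeasurableSpace α] {μ : Measure α}

lemma inner_toLp {g h : α → ℝ} (hg : MemLp g 2 μ) (hh : MemLp h 2 μ) :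
    inner ℝ (hg.toLp g) (hh.toLp h) = ∫ x, g x * h x ∂μ := by
  rw [L2.inner_def]
  apply integral_congr_ae
  filter_upwards [hg.coeFn_toLp, hh.coeFn_toLp] with x h1 h2
  rw [h1, h2]
  simp [mul_comm]

lemma integrable_mul_of_memLp {g h : α → ℝ} (hg : MemLp g 2 μ) (hh : MemLp h 2 μ) :
    Integrable (fun x => g x * h x) μ :=
  hg.integrable_mul hh

/-- A family of `L²` functions that is orthonormal, with the inner product written out as an
integral. -/
structure IsOrthonormalFamily (μ : Measure α) (e : ι → α → ℝ) : Prop where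
  memLp : ∀ i, MemLp (e i) 2 μ
  integral_self : ∀ i, ∫ x, e i x * e i x ∂μ = 1
  integral_ne : ∀ i j, i ≠ j → ∫ x, e i x * e j x ∂μ = 0

/-- Completeness of a family of functions in `L²`: only `0` is orthogonal to all of them. -/
def IsCompleteFamily (μ : Measure α) (e : ι → α → ℝ) : Prop :=
  ∀ g : α → ℝ, MemLp g 2 μ → (∀ i, ∫ x, g x * e i x ∂μ = 0) → g =ᵐ[μ] 0

lemma IsOrthonormalFamily.orthonormal {e : ι → α → ℝ} (he : IsOrthonormalFamily μ e) :
    Orthonormal ℝ (fun i => (he.memLp i).toLp (e i)) := by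
  refine ⟨fun i => ?_, fun i j hij => ?_⟩
  · have h := inner_toLp (he.memLp i) (he.memLp i)
    rw [he.integral_self, real_inner_self_eq_norm_sq] at h
    have h0 := norm_nonneg ((he.memLp i).toLp (e i))
    nlinarith
  · exact (inner_toLp (he.memLp i) (he.memLp j)).trans (he.integral_ne i j hij)

/-- The Riesz–Fischer theorem: a square summable family is the family of coefficients of an `L²`
function. -/
theorem IsOrthonormalFamily.exists_coeff_eq {e : ι → α → ℝ} (he : IsOrthonormalFamily μ e)
    {a : ι → ℝ} (ha : Summable fun i => a i ^ 2) :
    ∃ g : α → ℝ, StronglyMeasurable g ∧ MemLp g 2 μ ∧ ∀ i, ∫ x, g x * e i x ∂μ = a i := by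
  classical
  set v := fun i => (he.memLp i).toLp (e i) with hv
  have hs : Summable fun i => a i • v i := by
    have h := (he.orthonormal.orthogonalFamily.summable_iff_norm_sq_summable a).2 (by simpa using ha)
    simpa [LinearIsometry.toSpanSingleton_apply] using h
  obtain ⟨w, hw⟩ := hs
  refine ⟨w, Lp.stronglyMeasurable w, Lp.memLp w, fun i => ?_⟩
  have h1 := hw.mapL (innerSL ℝ (v i))
  have h2 : HasSum (fun j => (innerSL ℝ (v i)) (a j • v j)) (a i) := by
    convert hasSum_ite_eq i (a i) using 2 with j
    rw [innerSL_apply_apply, inner_smul_right, orthonormal_iff_ite.1 he.orthonormal i j]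
    by_cases h : i = j
    · subst h; simp
    · simp [h, Ne.symm h]
  have h3 := h1.unique h2
  rw [innerSL_apply_apply, real_inner_comm] at h3
  rw [← h3, hv]
  have h4 := inner_toLp (Lp.memLp w) (he.memLp i)
  rw [Lp.toLp_coeFn] at h4
  exact h4.symm

/-- Parseval's identity. -/
theorem IsOrthonormalFamily.hasSum_coeff_mul {e : ι → α → ℝ} (he : IsOrthonormalFamily μ e)
    (hc : IsCompleteFamily μ e) {g h : α → ℝ} (hg : MemLp g 2 μ) (hh : MemLp h 2 μ) :
    HasSum (fun i => (∫ x, g x * e i x ∂μ) * ∫ x, h x * e i x ∂μ) (∫ x, g x * h x ∂μ) := by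
  have hbot : (Submodule.span ℝ (Set.range fun i => (he.memLp i).toLp (e i)))ᗮ = ⊥ := by
    rw [eq_bot_iff]
    intro w hw
    rw [Submodule.mem_orthogonal'] at hw
    have := hc w (Lp.memLp w) (fun i => by
      have h1 := hw _ (Submodule.subset_span ⟨i, rfl⟩)
      have h4 := inner_toLp (Lp.memLp w) (he.memLp i)
      rw [Lp.toLp_coeFn] at h4
      rw [← h4]; exact h1)
    rw [Submodule.mem_bot]
    exact (Lp.eq_zero_iff_ae_eq_zero).2 this
  have hb := (HilbertBasis.mkOfOrthogonalEqBot he.orthonormal hbot).hasSum_inner_mul_inner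
    (hg.toLp g) (hh.toLp h)
  simp only [HilbertBasis.coe_mkOfOrthogonalEqBot, inner_toLp] at hb
  simpa only [mul_comm (h _)] using hb

theorem IsOrthonormalFamily.hasSum_coeff_sq {e : ι → α → ℝ} (he : IsOrthonormalFamily μ e)
    (hc : IsCompleteFamily μ e) {g : α → ℝ} (hg : MemLp g 2 μ) :
    HasSum (fun i => (∫ x, g x * e i x ∂μ) ^ 2) (∫ x, g x ^ 2 ∂μ) := by
  simpa [sq] using he.hasSum_coeff_mul hc hg hg

end L2

/-! ### Functions on an interval and their primitives -/

lemma intervalIntegrable_of_memLp {a b : ℝ} (hab : a ≤ b) {g : ℝ → ℝ}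
    (hg : MemLp g 2 (volume.restrict (Ioc a b))) : IntervalIntegrable g volume a b := by
  rw [intervalIntegrable_iff_integrableOn_Ioc_of_le hab]
  exact hg.integrable one_le_two

lemma memLp_of_continuousOn {a b : ℝ} {g : ℝ → ℝ} (hg : ContinuousOn g (Icc a b)) :
    MemLp g 2 (volume.restrict (Ioc a b)) := by
  obtain ⟨C, hC⟩ := isCompact_Icc.exists_bound_of_continuousOn hg
  refine MemLp.of_bound ((hg.mono Ioc_subset_Icc_self).aestronglyMeasurable measurableSet_Ioc) C ?_
  filter_upwards [ae_restrict_mem measurableSet_Ioc] with x hx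
  exact hC x (Ioc_subset_Icc_self hx)

/-- A function on an interval all of whose integrals from the left end vanish is zero. -/
lemma ae_eq_zero_of_integral_eq_zero {a b : ℝ} (hab : a ≤ b) {g : ℝ → ℝ}
    (hg : IntervalIntegrable g volume a b) (h : ∀ x ∈ Icc a b, ∫ s in a..x, g s = 0) :
    g =ᵐ[volume.restrict (Ioc a b)] 0 := by
  rw [Filter.EventuallyEq, ae_restrict_iff' measurableSet_Ioc]
  have h2 : ∀ᵐ x : ℝ, x ≠ b := by simp [ae_iff, measure_singleton]
  filter_upwards [hg.ae_hasDerivAt_integral, h2] with x hx hxb hmem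
  have hx' : x ∈ Ioo a b := ⟨hmem.1, lt_of_le_of_ne hmem.2 hxb⟩
  have h1 := hx (by rw [uIcc_of_le hab]; exact Ioo_subset_Icc_self hx') a left_mem_uIcc
  have h3 : HasDerivAt (fun x => ∫ t in a..x, g t) 0 x := by
    refine (hasDerivAt_const x (0 : ℝ)).congr_of_eventuallyEq ?_
    filter_upwards [Ioo_mem_nhds hx'.1 hx'.2] with y hy
    exact h y (Ioo_subset_Icc_self hy)
  exact h1.unique h3

lemma HasL2Deriv.intervalIntegrable {a b : ℝ} (hab : a ≤ b) {w g : ℝ → ℝ}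
    (h : HasL2Deriv a b w g) : IntervalIntegrable g volume a b :=
  intervalIntegrable_of_memLp hab h.1

lemma continuousOn_of_eq_integral {a b : ℝ} (hab : a ≤ b) {w g : ℝ → ℝ}
    (hg : IntervalIntegrable g volume a b)
    (h : ∀ x ∈ Icc a b, w x = w a + ∫ s in a..x, g s) : ContinuousOn w (Icc a b) := by
  have h1 := intervalIntegral.continuousOn_primitive_interval' hg left_mem_uIcc
  rw [uIcc_of_le hab] at h1
  exact (continuousOn_const.add h1).congr h

lemma HasL2Deriv.continuousOn {a b : ℝ} (hab : a ≤ b) {w g : ℝ → ℝ}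
    (h : HasL2Deriv a b w g) : ContinuousOn w (Icc a b) :=
  continuousOn_of_eq_integral hab (h.intervalIntegrable hab) h.2

lemma absolutelyContinuousOnInterval_of_eq_integral {a b : ℝ} (hab : a ≤ b) {w g : ℝ → ℝ}
    (hg : IntervalIntegrable g volume a b)
    (h : ∀ x ∈ Icc a b, w x = w a + ∫ s in a..x, g s) :
    AbsolutelyContinuousOnInterval w a b := by
  have h1 := hg.absolutelyContinuousOnInterval_intervalIntegral (c := a) (by simp)
  have h2 : AbsolutelyContinuousOnInterval (fun _ : ℝ => w a) a b :=
    (contDiff_const (n := 1)).contDiffOn.absolutelyContinuousOnInterval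
  have h3 := h2.add h1
  rw [absolutelyContinuousOnInterval_iff] at h3 ⊢
  intro ε hε
  obtain ⟨δ, hδ, H⟩ := h3 ε hε
  refine ⟨δ, hδ, fun E hE hlt => ?_⟩
  refine lt_of_eq_of_lt (Finset.sum_congr rfl fun i hi => ?_) (H E hE hlt)
  have hm := hE.1 i hi
  rw [uIcc_of_le hab] at hm
  simp only [Pi.add_apply]
  rw [h _ hm.1, h _ hm.2]

lemma ae_hasDerivAt_of_eq_integral {a b : ℝ} (hab : a ≤ b) {w g : ℝ → ℝ}
    (hg : IntervalIntegrable g volume a b)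
    (h : ∀ x ∈ Icc a b, w x = w a + ∫ s in a..x, g s) :
    ∀ᵐ x ∂(volume.restrict (Ioc a b)), HasDerivAt w (g x) x := by
  rw [ae_restrict_iff' measurableSet_Ioc]
  have h2 : ∀ᵐ x : ℝ, x ≠ b := by simp [ae_iff, measure_singleton]
  filter_upwards [hg.ae_hasDerivAt_integral, h2] with x hx hxb hmem
  have hx' : x ∈ Ioo a b := ⟨hmem.1, lt_of_le_of_ne hmem.2 hxb⟩
  have h1 := hx (by rw [uIcc_of_le hab]; exact Ioo_subset_Icc_self hx') a left_mem_uIcc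
  refine (h1.const_add (w a)).congr_of_eventuallyEq ?_
  filter_upwards [Ioo_mem_nhds hx'.1 hx'.2] with y hy
  exact h y (Ioo_subset_Icc_self hy)

/-- Integration by parts, and the product rule, for primitives of integrable functions. -/
lemma mul_sub_mul_eq_integral {a b : ℝ} (hab : a ≤ b) {w g v k : ℝ → ℝ}
    (hg : IntervalIntegrable g volume a b) (hk : IntervalIntegrable k volume a b)
    (hw : ∀ x ∈ Icc a b, w x = w a + ∫ s in a..x, g s)
    (hv : ∀ x ∈ Icc a b, v x = v a + ∫ s in a..x, k s) :
    ∫ x in a..b, (g x * v x + w x * k x) = w b * v b - w a * v a := by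
  rw [← (absolutelyContinuousOnInterval_of_eq_integral hab hg hw).integral_deriv_mul_eq_sub
    (absolutelyContinuousOnInterval_of_eq_integral hab hk hv)]
  rw [intervalIntegral.integral_of_le hab, intervalIntegral.integral_of_le hab]
  apply integral_congr_ae
  filter_upwards [ae_hasDerivAt_of_eq_integral hab hg hw,
    ae_hasDerivAt_of_eq_integral hab hk hv] with x h1 h2
  rw [h1.deriv, h2.deriv]

lemma eq_integral_of_hasDerivAt {w g : ℝ → ℝ} (hw : ∀ x, HasDerivAt w (g x) x)
    (hg : Continuous g) (a x : ℝ) : w x = w a + ∫ s in a..x, g s := by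
  rw [intervalIntegral.integral_eq_sub_of_hasDerivAt (fun y _ => hw y)
    (hg.intervalIntegrable _ _)]
  ring

/-- Integration by parts against a smooth function. -/
lemma integral_mul_eq_of_hasDerivAt {a b : ℝ} (hab : a ≤ b) {w g φ ψ : ℝ → ℝ}
    (hg : IntervalIntegrable g volume a b)
    (hw : ∀ x ∈ Icc a b, w x = w a + ∫ s in a..x, g s)
    (hφ : ∀ x, HasDerivAt φ (ψ x) x) (hψ : Continuous ψ) :
    ∫ x in a..b, g x * φ x = w b * φ b - w a * φ a - ∫ x in a..b, w x * ψ x := by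
  have hφc : Continuous φ := continuous_iff_continuousAt.2 fun x => (hφ x).continuousAt
  rw [← mul_sub_mul_eq_integral hab hg (hψ.intervalIntegrable a b) hw
    (fun x _ => eq_integral_of_hasDerivAt hφ hψ a x), intervalIntegral.integral_add]
  · ring
  · exact hg.mul_continuousOn hφc.continuousOn
  · have := continuousOn_of_eq_integral hab hg hw
    apply ContinuousOn.intervalIntegrable
    rw [uIcc_of_le hab]
    exact this.mul hψ.continuousOn

/-! ### Sine and cosine modes -/

/-- The frequency `jπ/L` of the `j`-th mode. -/
def freq (L : ℝ) (j : ℕ) : ℝ := j * Real.pi / L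

lemma eigenvalue_eq (L c : ℝ) (j : ℕ) : eigenvalue L c j = c - freq L j ^ 2 := rfl

lemma freq_pos {L : ℝ} (hL : 0 < L) (j : ℕ) : 0 < freq L (j + 1) := by
  unfold freq; positivity

lemma freq_nonneg {L : ℝ} (hL : 0 < L) (j : ℕ) : 0 ≤ freq L j := by
  unfold freq; positivity

lemma freq_strictMono {L : ℝ} (hL : 0 < L) : StrictMono (freq L) := by
  intro i j hij
  unfold freq
  have : (i : ℝ) < j := by exact_mod_cast hij
  gcongr

lemma mode_eq (L : ℝ) (j : ℕ) (x : ℝ) :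
    mode L j x = Real.sqrt (2 / L) * Real.sin (freq L j * x) := by
  unfold mode freq; congr 2; ring

/-- The orthonormal cosine modes `√(1/L), √(2/L) cos (jπx/L)`. -/
def cosMode (L : ℝ) (j : ℕ) (x : ℝ) : ℝ :=
  (if j = 0 then Real.sqrt (1 / L) else Real.sqrt (2 / L)) * Real.cos (freq L j * x)

lemma hasDerivAt_mode (L : ℝ) (j : ℕ) (x : ℝ) :
    HasDerivAt (mode L (j + 1)) (freq L (j + 1) * cosMode L (j + 1) x) x := by
  have h := ((((hasDerivAt_id x).const_mul (freq L (j + 1))).sin).const_mul (Real.sqrt (2 / L)))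
  have h2 : mode L (j + 1) =
      fun y => Real.sqrt (2 / L) * Real.sin (freq L (j + 1) * id y) := by
    ext y; exact mode_eq L _ y
  rw [h2]
  refine h.congr_deriv ?_
  simp [cosMode]; ring

lemma hasDerivAt_cosMode (L : ℝ) (j : ℕ) (x : ℝ) :
    HasDerivAt (cosMode L (j + 1)) (-(freq L (j + 1) * mode L (j + 1) x)) x := by
  have h := ((((hasDerivAt_id x).const_mul (freq L (j + 1))).cos).const_mul (Real.sqrt (2 / L)))
  have h2 : cosMode L (j + 1) =
      fun y => Real.sqrt (2 / L) * Real.cos (freq L (j + 1) * id y) := by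
    ext y; simp [cosMode]
  rw [h2]
  refine h.congr_deriv ?_
  rw [mode_eq]; simp; ring

@[fun_prop]
lemma continuous_mode (L : ℝ) (j : ℕ) : Continuous (mode L j) := by
  unfold mode; fun_prop

@[fun_prop]
lemma continuous_cosMode (L : ℝ) (j : ℕ) : Continuous (cosMode L j) := by
  unfold cosMode; fun_prop

@[simp] lemma mode_zero_right (L : ℝ) (j : ℕ) : mode L j 0 = 0 := by simp [mode]

lemma freq_mul_self {L : ℝ} (hL : 0 < L) (j : ℕ) : freq L j * L = j * Real.pi := by
  unfold freq; field_simp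

lemma mode_right {L : ℝ} (hL : 0 < L) (j : ℕ) : mode L j L = 0 := by
  rw [mode_eq, freq_mul_self hL, Real.sin_nat_mul_pi, mul_zero]

lemma abs_mode_le {L : ℝ} (j : ℕ) (x : ℝ) : |mode L j x| ≤ Real.sqrt (2 / L) := by
  rw [mode_eq, abs_mul, abs_of_nonneg (Real.sqrt_nonneg _)]
  exact mul_le_of_le_one_right (Real.sqrt_nonneg _) (Real.abs_sin_le_one _)

lemma integral_cos_int {L : ℝ} (hL : 0 < L) (m : ℤ) :
    ∫ x in (0 : ℝ)..L, Real.cos (m * (Real.pi / L * x)) = if m = 0 then L else 0 := by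
  split_ifs with h
  · simp [h]
  · have hm : (m : ℝ) * (Real.pi / L) ≠ 0 := by
      have : (m : ℝ) ≠ 0 := by exact_mod_cast h
      have := Real.pi_pos
      positivity
    have h1 : ∀ x, Real.cos (m * (Real.pi / L * x)) = Real.cos ((m * (Real.pi / L)) * x) := by
      intro x; ring_nf
    simp_rw [h1]
    rw [intervalIntegral.integral_comp_mul_left (fun x => Real.cos x) hm, integral_cos]
    have h2 : (m : ℝ) * (Real.pi / L) * L = m * Real.pi := by field_simp
    simp [h2, Real.sin_int_mul_pi]

lemma freq_mul (L : ℝ) (j : ℕ) (x : ℝ) : freq L j * x = (j : ℤ) * (Real.pi / L * x) := by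
  unfold freq; push_cast; ring

lemma cos_int_continuous (L : ℝ) (m : ℤ) :
    Continuous fun x => Real.cos (m * (Real.pi / L * x)) := by fun_prop

lemma integral_sin_mul_sin {L : ℝ} (hL : 0 < L) (i j : ℕ) :
    ∫ x in (0 : ℝ)..L, Real.sin (freq L (i + 1) * x) * Real.sin (freq L (j + 1) * x) =
      if i = j then L / 2 else 0 := by
  have h : ∀ x, Real.sin (freq L (i + 1) * x) * Real.sin (freq L (j + 1) * x) =
      1 / 2 * (Real.cos (((i : ℤ) - j : ℤ) * (Real.pi / L * x)) -
        Real.cos (((i : ℤ) + j + 2 : ℤ) * (Real.pi / L * x))) := by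
    intro x
    rw [freq_mul, freq_mul]
    have e1 : (((i : ℤ) - j : ℤ) : ℝ) * (Real.pi / L * x) =
      ((i + 1 : ℕ) : ℤ) * (Real.pi / L * x) - ((j + 1 : ℕ) : ℤ) * (Real.pi / L * x) := by
      push_cast; ring
    have e2 : (((i : ℤ) + j + 2 : ℤ) : ℝ) * (Real.pi / L * x) =
      ((i + 1 : ℕ) : ℤ) * (Real.pi / L * x) + ((j + 1 : ℕ) : ℤ) * (Real.pi / L * x) := by
      push_cast; ring
    rw [e1, e2, Real.cos_sub, Real.cos_add]; ring
  simp_rw [h]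
  rw [intervalIntegral.integral_const_mul, intervalIntegral.integral_sub
    ((cos_int_continuous L _).intervalIntegrable _ _)
    ((cos_int_continuous L _).intervalIntegrable _ _), integral_cos_int hL, integral_cos_int hL]
  have h2 : ¬ ((i : ℤ) + j + 2 = 0) := by omega
  have h3 : ((i : ℤ) - j = 0) ↔ i = j := by omega
  simp only [h2, h3, if_false]
  split_ifs <;> ring

lemma integral_cos_mul_cos {L : ℝ} (hL : 0 < L) (i j : ℕ) :
    ∫ x in (0 : ℝ)..L, Real.cos (freq L i * x) * Real.cos (freq L j * x) =
      if i = j then (if i = 0 then L else L / 2) else 0 := by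
  have h : ∀ x, Real.cos (freq L i * x) * Real.cos (freq L j * x) =
      1 / 2 * (Real.cos (((i : ℤ) - j : ℤ) * (Real.pi / L * x)) +
        Real.cos (((i : ℤ) + j : ℤ) * (Real.pi / L * x))) := by
    intro x
    rw [freq_mul, freq_mul]
    have e1 : (((i : ℤ) - j : ℤ) : ℝ) * (Real.pi / L * x) =
      ((i : ℕ) : ℤ) * (Real.pi / L * x) - ((j : ℕ) : ℤ) * (Real.pi / L * x) := by
      push_cast; ring
    have e2 : (((i : ℤ) + j : ℤ) : ℝ) * (Real.pi / L * x) =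
      ((i : ℕ) : ℤ) * (Real.pi / L * x) + ((j : ℕ) : ℤ) * (Real.pi / L * x) := by
      push_cast; ring
    rw [e1, e2, Real.cos_sub, Real.cos_add]; ring
  simp_rw [h]
  rw [intervalIntegral.integral_const_mul, intervalIntegral.integral_add
    ((cos_int_continuous L _).intervalIntegrable _ _)
    ((cos_int_continuous L _).intervalIntegrable _ _), integral_cos_int hL, integral_cos_int hL]
  have h2 : ((i : ℤ) + j = 0) ↔ i = 0 ∧ j = 0 := by omega
  have h3 : ((i : ℤ) - j = 0) ↔ i = j := by omega
  simp only [h2, h3]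
  split_ifs <;> first | omega | ring

lemma integral_mode_mul_mode {L : ℝ} (hL : 0 < L) (i j : ℕ) :
    ∫ x in (0 : ℝ)..L, mode L (i + 1) x * mode L (j + 1) x = if i = j then 1 else 0 := by
  simp_rw [mode_eq]
  have h : ∀ x, Real.sqrt (2 / L) * Real.sin (freq L (i + 1) * x) *
      (Real.sqrt (2 / L) * Real.sin (freq L (j + 1) * x)) =
      (2 / L) * (Real.sin (freq L (i + 1) * x) * Real.sin (freq L (j + 1) * x)) := by
    intro x
    have := Real.mul_self_sqrt (show 0 ≤ 2 / L by positivity)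
    linear_combination (Real.sin (freq L (i + 1) * x) * Real.sin (freq L (j + 1) * x)) * this
  simp_rw [h]
  rw [intervalIntegral.integral_const_mul, integral_sin_mul_sin hL]
  split_ifs
  · field_simp
  · simp

lemma integral_cosMode_mul_cosMode {L : ℝ} (hL : 0 < L) (i j : ℕ) :
    ∫ x in (0 : ℝ)..L, cosMode L i x * cosMode L j x = if i = j then 1 else 0 := by
  unfold cosMode
  set a := (if i = 0 then Real.sqrt (1 / L) else Real.sqrt (2 / L)) with ha
  set b := (if j = 0 then Real.sqrt (1 / L) else Real.sqrt (2 / L)) with hb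
  have h : ∀ x, a * Real.cos (freq L i * x) * (b * Real.cos (freq L j * x)) =
      (a * b) * (Real.cos (freq L i * x) * Real.cos (freq L j * x)) := by
    intro x; ring
  simp_rw [h]
  rw [intervalIntegral.integral_const_mul, integral_cos_mul_cos hL]
  split_ifs with h1 h2
  · subst h1
    rw [ha, hb, if_pos h2, Real.mul_self_sqrt (by positivity)]; field_simp
  · subst h1
    rw [ha, hb, if_neg h2, Real.mul_self_sqrt (by positivity)]; field_simp
  · simp

/-- Lebesgue measure on `(0, L]`. -/
abbrev intervalMeasure (L : ℝ) : Measure ℝ := volume.restrict (Ioc 0 L)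

lemma isOrthonormalFamily_mode {L : ℝ} (hL : 0 < L) :
    IsOrthonormalFamily (intervalMeasure L) (fun j => mode L (j + 1)) where
  memLp i := memLp_of_continuousOn (continuous_mode L _).continuousOn
  integral_self i := by
    rw [← intervalIntegral.integral_of_le hL.le, integral_mode_mul_mode hL, if_pos rfl]
  integral_ne i j h := by
    rw [← intervalIntegral.integral_of_le hL.le, integral_mode_mul_mode hL, if_neg h]

lemma isOrthonormalFamily_cosMode {L : ℝ} (hL : 0 < L) :
    IsOrthonormalFamily (intervalMeasure L) (cosMode L) where
  memLp i := memLp_of_continuousOn (continuous_cosMode L _).continuousOn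
  integral_self i := by
    rw [← intervalIntegral.integral_of_le hL.le, integral_cosMode_mul_cosMode hL, if_pos rfl]
  integral_ne i j h := by
    rw [← intervalIntegral.integral_of_le hL.le, integral_cosMode_mul_cosMode hL, if_neg h]

/-! ### Completeness of the sine and cosine modes -/

/-- The span of the functions `cos (jπx/L)` is an algebra, as
`2 cos θ cos (jθ) = cos ((j+1)θ) + cos ((j-1)θ)`; so a function orthogonal to all of them is
orthogonal to all polynomials in `cos (πx/L)`. -/
lemma integral_mul_cos_pow_eq_zero {L : ℝ} (hL : 0 < L) {G : ℝ → ℝ}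
    (hG : ContinuousOn G (Icc 0 L))
    (h : ∀ j : ℤ, ∫ x in (0 : ℝ)..L, G x * Real.cos (j * (Real.pi / L * x)) = 0) (k : ℕ) :
    ∀ j : ℤ, ∫ x in (0 : ℝ)..L,
      G x * (Real.cos (Real.pi / L * x) ^ k * Real.cos (j * (Real.pi / L * x))) = 0 := by
  have hG' : ContinuousOn G (uIcc 0 L) := by rwa [uIcc_of_le hL.le]
  induction k with
  | zero => simpa using h
  | succ k ih =>
    intro j
    have e : ∀ x, G x * (Real.cos (Real.pi / L * x) ^ (k + 1) *
        Real.cos (j * (Real.pi / L * x))) =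
        1 / 2 * (G x * (Real.cos (Real.pi / L * x) ^ k *
            Real.cos ((j + 1 : ℤ) * (Real.pi / L * x))) +
          G x * (Real.cos (Real.pi / L * x) ^ k *
            Real.cos ((j - 1 : ℤ) * (Real.pi / L * x)))) := by
      intro x
      have e1 : ((j + 1 : ℤ) : ℝ) * (Real.pi / L * x) =
        j * (Real.pi / L * x) + Real.pi / L * x := by push_cast; ring
      have e2 : ((j - 1 : ℤ) : ℝ) * (Real.pi / L * x) =
        j * (Real.pi / L * x) - Real.pi / L * x := by push_cast; ring
      rw [e1, e2, Real.cos_add, Real.cos_sub]; ring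
    simp_rw [e]
    rw [intervalIntegral.integral_const_mul, intervalIntegral.integral_add, ih, ih]
    · simp
    all_goals
      apply ContinuousOn.intervalIntegrable
      exact hG'.mul (by fun_prop)

/-- Completeness of the cosines among continuous functions. By the Weierstrass theorem, applied to
`s ↦ G (L/π · arccos s)`, the function `G` is a uniform limit of polynomials in `cos (πx/L)`, and it
is orthogonal to all of these; hence `∫ G² = 0`. -/
lemma eqOn_zero_of_integral_mul_cos_eq_zero {L : ℝ} (hL : 0 < L) {G : ℝ → ℝ}
    (hG : ContinuousOn G (Icc 0 L))
    (h : ∀ j : ℤ, ∫ x in (0 : ℝ)..L, G x * Real.cos (j * (Real.pi / L * x)) = 0) :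
    ∀ x ∈ Icc 0 L, G x = 0 := by
  have hG' : ContinuousOn G (uIcc 0 L) := by rwa [uIcc_of_le hL.le]
  have hpi := Real.pi_pos
  have hpoly : ∀ p : Polynomial ℝ,
      ∫ x in (0 : ℝ)..L, G x * p.eval (Real.cos (Real.pi / L * x)) = 0 := by
    intro p
    induction p using Polynomial.induction_on' with
    | add p q hp hq =>
      simp_rw [Polynomial.eval_add, mul_add]
      rw [intervalIntegral.integral_add, hp, hq, add_zero]
      all_goals
        apply ContinuousOn.intervalIntegrable
        exact hG'.mul (by fun_prop)
    | monomial k a =>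
      have := integral_mul_cos_pow_eq_zero hL hG h k 0
      simp only [Int.cast_zero, zero_mul, Real.cos_zero, mul_one] at this
      simp_rw [Polynomial.eval_monomial]
      have e : ∀ x, G x * (a * Real.cos (Real.pi / L * x) ^ k) =
        a * (G x * Real.cos (Real.pi / L * x) ^ k) := fun x => by ring
      simp_rw [e]
      rw [intervalIntegral.integral_const_mul, this, mul_zero]
  -- the substitution `s = cos (πx/L)`
  have hψ : ContinuousOn (fun s => G (L / Real.pi * Real.arccos s)) (Icc (-1) 1) := by
    refine hG.comp (by fun_prop) ?_
    intro s hs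
    refine ⟨mul_nonneg (by positivity) (Real.arccos_nonneg s), ?_⟩
    calc L / Real.pi * Real.arccos s ≤ L / Real.pi * Real.pi := by
          gcongr; exact Real.arccos_le_pi s
      _ = L := by field_simp
  have happ : ∀ ε > 0, ∃ p : Polynomial ℝ, ∀ x ∈ Icc 0 L,
      |p.eval (Real.cos (Real.pi / L * x)) - G x| < ε := by
    intro ε hε
    obtain ⟨p, hp⟩ := exists_polynomial_near_of_continuousOn (-1) 1 _ hψ ε hε
    refine ⟨p, fun x hx => ?_⟩
    have h1 := hp (Real.cos (Real.pi / L * x)) ⟨Real.neg_one_le_cos _, Real.cos_le_one _⟩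
    have h2 : Real.arccos (Real.cos (Real.pi / L * x)) = Real.pi / L * x := by
      apply Real.arccos_cos
      · have := hx.1; positivity
      · calc Real.pi / L * x ≤ Real.pi / L * L := by gcongr; exact hx.2
          _ = Real.pi := by field_simp
    rw [h2] at h1
    have h3 : L / Real.pi * (Real.pi / L * x) = x := by field_simp
    rwa [h3] at h1
  have hint : IntervalIntegrable (fun x => |G x|) volume 0 L := hG'.abs.intervalIntegrable
  have hsq : ∀ ε > 0, ∫ x in (0 : ℝ)..L, G x * G x ≤ ε * ∫ x in (0 : ℝ)..L, |G x| := by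
    intro ε hε
    obtain ⟨p, hp⟩ := happ ε hε
    have hpc : ContinuousOn (fun x => G x * p.eval (Real.cos (Real.pi / L * x))) (uIcc 0 L) :=
      hG'.mul (by fun_prop)
    have e : ∫ x in (0 : ℝ)..L, G x * G x =
        ∫ x in (0 : ℝ)..L, (G x * G x - G x * p.eval (Real.cos (Real.pi / L * x))) := by
      have hGG : IntervalIntegrable (fun x => G x * G x) volume 0 L :=
        (hG'.mul hG').intervalIntegrable
      rw [intervalIntegral.integral_sub hGG hpc.intervalIntegrable, hpoly, sub_zero]
    rw [e, ← intervalIntegral.integral_const_mul]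
    apply intervalIntegral.integral_mono_on hL.le
    · exact ((hG'.mul hG').sub hpc).intervalIntegrable
    · exact hint.const_mul ε
    · intro x hx
      have h1 := (hp x hx).le
      rw [abs_sub_comm] at h1
      calc G x * G x - G x * p.eval (Real.cos (Real.pi / L * x))
          = G x * (G x - p.eval (Real.cos (Real.pi / L * x))) := by ring
        _ ≤ |G x * (G x - p.eval (Real.cos (Real.pi / L * x)))| := le_abs_self _
        _ = |G x - p.eval (Real.cos (Real.pi / L * x))| * |G x| := by rw [abs_mul, mul_comm]
        _ ≤ ε * |G x| := by gcongr
  have hle : ∫ x in (0 : ℝ)..L, G x * G x ≤ 0 := by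
    have ht : Tendsto (fun ε : ℝ => ε * ∫ x in (0 : ℝ)..L, |G x|) (𝓝[>] 0) (𝓝 0) := by
      have : Tendsto (fun ε : ℝ => ε * ∫ x in (0 : ℝ)..L, |G x|) (𝓝 0)
          (𝓝 (0 * ∫ x in (0 : ℝ)..L, |G x|)) := tendsto_id.mul_const _
      rw [zero_mul] at this
      exact this.mono_left nhdsWithin_le_nhds
    refine ge_of_tendsto ht ?_
    filter_upwards [self_mem_nhdsWithin] with ε hε
    exact hsq ε hε
  intro x hx
  by_contra hne
  have := intervalIntegral.integral_pos hL (hG.mul hG) (fun y _ => mul_self_nonneg (G y))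
    ⟨x, hx, mul_self_pos.2 hne⟩
  exact absurd this (not_lt.2 hle)

/-- If `g` is orthogonal to all sines, an integration by parts shows that its primitive, minus the
mean of the primitive, is orthogonal to all cosines; so the primitive is constant and `g` is zero. -/
theorem isCompleteFamily_mode {L : ℝ} (hL : 0 < L) :
    IsCompleteFamily (intervalMeasure L) (fun j => mode L (j + 1)) := by
  intro g hg h
  have hgi := intervalIntegrable_of_memLp hL.le hg
  set G : ℝ → ℝ := fun x => ∫ s in (0 : ℝ)..x, g s with hGdef
  have hG : ∀ x ∈ Icc 0 L, G x = G 0 + ∫ s in (0 : ℝ)..x, g s := by simp [hGdef]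
  have hGc := continuousOn_of_eq_integral hL.le hgi hG
  have hGc' : ContinuousOn G (uIcc 0 L) := by rwa [uIcc_of_le hL.le]
  have hcos : ∀ j : ℕ, ∫ x in (0 : ℝ)..L, G x * Real.cos (freq L (j + 1) * x) = 0 := by
    intro j
    have h1 := integral_mul_eq_of_hasDerivAt hL.le hgi hG (hasDerivAt_mode L j) (by fun_prop)
    rw [mode_right hL, mode_zero_right, intervalIntegral.integral_of_le hL.le, h j] at h1
    have h2 : ∀ x, G x * (freq L (j + 1) * cosMode L (j + 1) x) =
        (freq L (j + 1) * Real.sqrt (2 / L)) * (G x * Real.cos (freq L (j + 1) * x)) := by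
      intro x; simp [cosMode]; ring
    simp_rw [h2] at h1
    rw [intervalIntegral.integral_const_mul] at h1
    have h3 : freq L (j + 1) * Real.sqrt (2 / L) ≠ 0 := by
      have := freq_pos hL j
      positivity
    have h4 : freq L (j + 1) * Real.sqrt (2 / L) *
      ∫ x in (0 : ℝ)..L, G x * Real.cos (freq L (j + 1) * x) = 0 := by linarith
    exact (mul_eq_zero.1 h4).resolve_left h3
  set m := (∫ x in (0 : ℝ)..L, G x) / L with hm
  have hcos' : ∀ j : ℕ,
      ∫ x in (0 : ℝ)..L, (G x - m) * Real.cos ((j : ℤ) * (Real.pi / L * x)) = 0 := by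
    intro j
    have hc := cos_int_continuous L j
    simp_rw [sub_mul]
    rw [intervalIntegral.integral_sub, intervalIntegral.integral_const_mul, integral_cos_int hL]
    · rcases j with _ | j
      · simp [hm]; field_simp; simp
      · have := hcos j
        simp_rw [freq_mul] at this
        rw [this, if_neg (by omega)]; simp
    · exact (hGc'.mul hc.continuousOn).intervalIntegrable
    · exact (continuous_const.mul hc).intervalIntegrable _ _
  have hz : ∀ x ∈ Icc 0 L, G x - m = 0 := eqOn_zero_of_integral_mul_cos_eq_zero hL
    (hGc.sub continuousOn_const) (fun j => by
      obtain ⟨n, rfl | rfl⟩ := j.eq_nat_or_neg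
      · exact hcos' n
      · have := hcos' n
        simpa [neg_mul, Real.cos_neg] using this)
  have hm0 : m = 0 := by
    have := hz 0 (left_mem_Icc.2 hL.le)
    have h0 : G 0 = 0 := by simp [hGdef]
    linarith
  refine ae_eq_zero_of_integral_eq_zero hL.le hgi (fun x hx => ?_)
  have := hz x hx
  rw [hm0, sub_zero] at this
  exact this

lemma eqOn_of_ae_eq {L : ℝ} (hL : 0 < L) {v w : ℝ → ℝ} (hv : ContinuousOn v (Icc 0 L))
    (hw : ContinuousOn w (Icc 0 L)) (h : v =ᵐ[intervalMeasure L] w) : EqOn v w (Icc 0 L) := by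
  refine Measure.eqOn_Icc_of_ae_eq volume hL.ne ?_ hv hw
  rwa [Measure.restrict_congr_set (Ioc_ae_eq_Icc (a := (0 : ℝ)) (b := L)).symm]

/-- If `g` is orthogonal to all cosines, including the constants, its primitive vanishes at both end
points and is orthogonal to all sines. -/
theorem isCompleteFamily_cosMode {L : ℝ} (hL : 0 < L) :
    IsCompleteFamily (intervalMeasure L) (cosMode L) := by
  intro g hg h
  have hgi := intervalIntegrable_of_memLp hL.le hg
  set G : ℝ → ℝ := fun x => ∫ s in (0 : ℝ)..x, g s with hGdef
  have hG : ∀ x ∈ Icc 0 L, G x = G 0 + ∫ s in (0 : ℝ)..x, g s := by simp [hGdef]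
  have hGc := continuousOn_of_eq_integral hL.le hgi hG
  have hG0 : G 0 = 0 := by simp [hGdef]
  have hGL : G L = 0 := by
    have h0 := h 0
    rw [← intervalIntegral.integral_of_le hL.le] at h0
    simp only [cosMode, freq, if_true, Nat.cast_zero, zero_mul, zero_div, Real.cos_zero,
      mul_one] at h0
    rw [intervalIntegral.integral_mul_const] at h0
    have : Real.sqrt (1 / L) ≠ 0 := by positivity
    exact (mul_eq_zero.1 h0).resolve_right this
  have hz := isCompleteFamily_mode hL G (memLp_of_continuousOn hGc) (fun j => by
    have h1 := integral_mul_eq_of_hasDerivAt hL.le hgi hG (hasDerivAt_cosMode L j) (by fun_prop)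
    rw [hG0, hGL, intervalIntegral.integral_of_le hL.le, h (j + 1)] at h1
    have h2 : ∀ x, G x * -(freq L (j + 1) * mode L (j + 1) x) =
      -freq L (j + 1) * (G x * mode L (j + 1) x) := fun x => by ring
    simp_rw [h2] at h1
    rw [intervalIntegral.integral_const_mul] at h1
    rw [← intervalIntegral.integral_of_le hL.le]
    have h3 := (freq_pos hL j).ne'
    have h4 : freq L (j + 1) * ∫ x in (0 : ℝ)..L, G x * mode L (j + 1) x = 0 := by linarith
    exact (mul_eq_zero.1 h4).resolve_left h3)
  have hE := eqOn_of_ae_eq hL hGc continuousOn_const hz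
  exact ae_eq_zero_of_integral_eq_zero hL.le hgi (fun x hx => hE hx)

/-! ### Sine coefficients -/

lemma coeff_eq {L : ℝ} (hL : 0 < L) (j : ℕ) (w : ℝ → ℝ) :
    coeff L j w = ∫ x, w x * mode L j x ∂(intervalMeasure L) :=
  intervalIntegral.integral_of_le hL.le

lemma hasSum_coeff_mul {L : ℝ} (hL : 0 < L) {v w : ℝ → ℝ} (hv : MemLp v 2 (intervalMeasure L))
    (hw : MemLp w 2 (intervalMeasure L)) :
    HasSum (fun j => coeff L (j + 1) v * coeff L (j + 1) w) (∫ x in (0 : ℝ)..L, v x * w x) := by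
  simp_rw [coeff_eq hL]
  rw [intervalIntegral.integral_of_le hL.le]
  exact (isOrthonormalFamily_mode hL).hasSum_coeff_mul (isCompleteFamily_mode hL) hv hw

lemma hasSum_coeff_sq {L : ℝ} (hL : 0 < L) {w : ℝ → ℝ} (hw : MemLp w 2 (intervalMeasure L)) :
    HasSum (fun j => coeff L (j + 1) w ^ 2) (∫ x in (0 : ℝ)..L, w x ^ 2) := by
  simpa [sq] using hasSum_coeff_mul hL hw hw

lemma coeff_congr {L : ℝ} (hL : 0 < L) {v w : ℝ → ℝ} (h : EqOn v w (Icc 0 L)) (j : ℕ) :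
    coeff L j v = coeff L j w := by
  apply intervalIntegral.integral_congr
  intro x hx
  rw [uIcc_of_le hL.le] at hx
  simp only [h hx]

lemma intervalIntegrable_mul_mode {L : ℝ} (hL : 0 < L) {v : ℝ → ℝ}
    (hv : MemLp v 2 (intervalMeasure L)) (j : ℕ) :
    IntervalIntegrable (fun x => v x * mode L j x) volume 0 L :=
  (intervalIntegrable_of_memLp hL.le hv).mul_continuousOn (continuous_mode L j).continuousOn

lemma coeff_add {L : ℝ} (hL : 0 < L) {v w : ℝ → ℝ} (hv : MemLp v 2 (intervalMeasure L))
    (hw : MemLp w 2 (intervalMeasure L)) (j : ℕ) :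
    coeff L j (fun x => v x + w x) = coeff L j v + coeff L j w := by
  unfold coeff
  simp_rw [add_mul]
  exact intervalIntegral.integral_add (intervalIntegrable_mul_mode hL hv j)
    (intervalIntegrable_mul_mode hL hw j)

lemma coeff_const_mul {L : ℝ} (a : ℝ) (v : ℝ → ℝ) (j : ℕ) :
    coeff L j (fun x => a * v x) = a * coeff L j v := by
  unfold coeff
  simp_rw [mul_assoc]
  exact intervalIntegral.integral_const_mul _ _

lemma coeff_sub {L : ℝ} (hL : 0 < L) {v w : ℝ → ℝ} (hv : MemLp v 2 (intervalMeasure L))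
    (hw : MemLp w 2 (intervalMeasure L)) (j : ℕ) :
    coeff L j (fun x => v x - w x) = coeff L j v - coeff L j w := by
  unfold coeff
  simp_rw [sub_mul]
  exact intervalIntegral.integral_sub (intervalIntegrable_mul_mode hL hv j)
    (intervalIntegrable_mul_mode hL hw j)

/-- Continuous functions with the same sine coefficients agree. -/
lemma eqOn_of_coeff_eq {L : ℝ} (hL : 0 < L) {v w : ℝ → ℝ} (hv : ContinuousOn v (Icc 0 L))
    (hw : ContinuousOn w (Icc 0 L)) (h : ∀ j, coeff L (j + 1) v = coeff L (j + 1) w) :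
    EqOn v w (Icc 0 L) := by
  have h1 := isCompleteFamily_mode hL (fun x => v x - w x)
    (memLp_of_continuousOn (hv.sub hw)) (fun j => by
      rw [← coeff_eq hL, coeff_sub hL (memLp_of_continuousOn hv) (memLp_of_continuousOn hw),
        h, sub_self])
  refine eqOn_of_ae_eq hL hv hw ?_
  filter_upwards [h1] with x hx
  simp only [Pi.zero_apply] at hx
  linarith

/-! ### `H¹₀` and `H²` in terms of sine coefficients -/

lemma continuousOn_of_memH10 {L : ℝ} (hL : 0 < L) {w : ℝ → ℝ} (hw : MemH10 L w) :
    ContinuousOn w (Icc 0 L) := by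
  obtain ⟨-, -, g, hg⟩ := hw
  exact hg.continuousOn hL.le

/-- The derivative of a function vanishing at the end points has cosine coefficients `(jπ/L) w_j`. -/
lemma integral_mul_cosMode {L : ℝ} (hL : 0 < L) {w g : ℝ → ℝ} (h0 : w 0 = 0) (h1 : w L = 0)
    (hg : HasL2Deriv 0 L w g) (j : ℕ) :
    ∫ x in (0 : ℝ)..L, g x * cosMode L (j + 1) x = freq L (j + 1) * coeff L (j + 1) w := by
  have h2 := integral_mul_eq_of_hasDerivAt hL.le (hg.intervalIntegrable hL.le) hg.2
    (hasDerivAt_cosMode L j) (by fun_prop)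
  rw [h2, h0, h1, coeff, ← intervalIntegral.integral_const_mul]
  simp only [zero_mul, sub_zero, zero_sub, ← intervalIntegral.integral_neg]
  congr 1; ext x; ring

/-- The derivative of a function vanishing at the end points has mean zero. -/
lemma integral_mul_cosMode_zero {L : ℝ} (hL : 0 < L) {w g : ℝ → ℝ} (h0 : w 0 = 0) (h1 : w L = 0)
    (hg : HasL2Deriv 0 L w g) :
    ∫ x in (0 : ℝ)..L, g x * cosMode L 0 x = 0 := by
  have h2 := hg.2 L (right_mem_Icc.2 hL.le)
  rw [h0, h1, zero_add] at h2
  simp only [cosMode, freq, if_true, Nat.cast_zero, zero_mul, zero_div, Real.cos_zero, mul_one]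
  rw [intervalIntegral.integral_mul_const, ← h2, zero_mul]

/-- Parseval's identity for the derivative in the basis of cosines. -/
lemma hasSum_freq_sq_mul_coeff_sq_of_hasL2Deriv {L : ℝ} (hL : 0 < L) {w g : ℝ → ℝ} (h0 : w 0 = 0)
    (h1 : w L = 0) (hg : HasL2Deriv 0 L w g) :
    HasSum (fun j => freq L (j + 1) ^ 2 * coeff L (j + 1) w ^ 2) (∫ x in (0 : ℝ)..L, g x ^ 2) := by
  have h := (isOrthonormalFamily_cosMode hL).hasSum_coeff_sq (isCompleteFamily_cosMode hL) hg.1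
  simp_rw [← intervalIntegral.integral_of_le hL.le] at h
  rw [← hasSum_nat_add_iff' 1] at h
  simp only [Finset.range_one, Finset.sum_singleton, integral_mul_cosMode_zero hL h0 h1 hg] at h
  simp only [integral_mul_cosMode hL h0 h1 hg, mul_pow] at h
  simpa using h

/-- The norm of `H¹₀` is defined by the pointwise derivative, which agrees with the weak one almost
everywhere. -/
lemma h10Norm_sq_eq {L : ℝ} (hL : 0 < L) {w g : ℝ → ℝ} (hg : HasL2Deriv 0 L w g) :
    h10Norm L w ^ 2 = ∫ x in (0 : ℝ)..L, g x ^ 2 := by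
  unfold h10Norm
  rw [Real.sq_sqrt (intervalIntegral.integral_nonneg hL.le fun x _ => sq_nonneg _),
    intervalIntegral.integral_of_le hL.le, intervalIntegral.integral_of_le hL.le]
  apply integral_congr_ae
  filter_upwards [ae_hasDerivAt_of_eq_integral hL.le (hg.intervalIntegrable hL.le) hg.2] with x hx
  rw [hx.deriv]

/-- The norm of `H¹₀` in terms of sine coefficients. -/
theorem hasSum_h10Norm_sq {L : ℝ} (hL : 0 < L) {w : ℝ → ℝ} (hw : MemH10 L w) :
    HasSum (fun j => freq L (j + 1) ^ 2 * coeff L (j + 1) w ^ 2) (h10Norm L w ^ 2) := by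
  obtain ⟨h0, h1, g, hg⟩ := hw
  rw [h10Norm_sq_eq hL hg]
  exact hasSum_freq_sq_mul_coeff_sq_of_hasL2Deriv hL h0 h1 hg

/-- A continuous function vanishing at the end points belongs to `H¹₀` as soon as
`∑ (jπ/L)² w_j²` is finite. -/
theorem memH10_of_summable {L : ℝ} (hL : 0 < L) {w : ℝ → ℝ} (h0 : w 0 = 0) (h1 : w L = 0)
    (hw : ContinuousOn w (Icc 0 L))
    (hs : Summable fun j => freq L (j + 1) ^ 2 * coeff L (j + 1) w ^ 2) : MemH10 L w := by
  set a : ℕ → ℝ := fun j => freq L j * coeff L j w with ha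
  have has : Summable fun j => a j ^ 2 := by
    rw [← summable_nat_add_iff 1]
    simpa [ha, mul_pow] using hs
  obtain ⟨g, -, hg, hga⟩ := (isOrthonormalFamily_cosMode hL).exists_coeff_eq has
  simp_rw [← intervalIntegral.integral_of_le hL.le] at hga
  have hgi := intervalIntegrable_of_memLp hL.le hg
  set W : ℝ → ℝ := fun x => ∫ s in (0 : ℝ)..x, g s with hWdef
  have hW0 : W 0 = 0 := by simp [hWdef]
  have hWd : HasL2Deriv 0 L W g := ⟨hg, by simp [hWdef]⟩
  have hWL : W L = 0 := by
    have h0 := hga 0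
    simp only [cosMode, freq, if_true, Nat.cast_zero, zero_mul, zero_div, Real.cos_zero,
      mul_one, ha] at h0
    rw [intervalIntegral.integral_mul_const] at h0
    have : Real.sqrt (1 / L) ≠ 0 := by positivity
    exact (mul_eq_zero.1 h0).resolve_right this
  have hE : EqOn w W (Icc 0 L) := eqOn_of_coeff_eq hL hw (hWd.continuousOn hL.le) (fun j => by
    have h2 := integral_mul_cosMode hL hW0 hWL hWd j
    rw [hga] at h2
    exact mul_left_cancel₀ (freq_pos hL j).ne' h2)
  refine ⟨h0, h1, g, hg, fun x hx => ?_⟩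
  rw [hE hx, hE (left_mem_Icc.2 hL.le)]
  exact hWd.2 x hx

/-- Two integrations by parts: the coefficients of `w''` are `-(jπ/L)² w_j`. -/
theorem coeff_second_deriv {L : ℝ} (hL : 0 < L) {w g h : ℝ → ℝ} (h0 : w 0 = 0) (h1 : w L = 0)
    (hg : HasL2Deriv 0 L w g) (hh : HasL2Deriv 0 L g h) (j : ℕ) :
    coeff L (j + 1) h = -(freq L (j + 1) ^ 2 * coeff L (j + 1) w) := by
  have h2 := integral_mul_eq_of_hasDerivAt hL.le (hh.intervalIntegrable hL.le) hh.2
    (hasDerivAt_mode L j) (by fun_prop)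
  rw [mode_right hL, mode_zero_right] at h2
  have h3 := integral_mul_cosMode hL h0 h1 hg j
  have h4 : ∀ x, g x * (freq L (j + 1) * cosMode L (j + 1) x) =
    freq L (j + 1) * (g x * cosMode L (j + 1) x) := fun x => by ring
  simp_rw [h4] at h2
  rw [intervalIntegral.integral_const_mul, h3] at h2
  rw [coeff, h2]; ring

lemma one_le_freq_ratio {L : ℝ} (hL : 0 < L) (j : ℕ) : freq L 1 ^ 2 ≤ freq L (j + 1) ^ 2 := by
  have := (freq_strictMono hL).monotone (show 1 ≤ j + 1 by omega)
  have h2 := freq_nonneg hL 1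
  gcongr

lemma summable_eigenvalue_mul_coeff_sq {L : ℝ} (hL : 0 < L) (c : ℝ) {w : ℝ → ℝ}
    (hw : MemH10 L w) : Summable fun j => eigenvalue L c (j + 1) * coeff L (j + 1) w ^ 2 := by
  have h1 := (hasSum_h10Norm_sq hL hw).summable
  have h2 := (hasSum_coeff_sq hL (memLp_of_continuousOn (continuousOn_of_memH10 hL hw))).summable
  simp_rw [eigenvalue_eq, sub_mul]
  exact (h2.mul_left c).sub h1

lemma tsum_eigenvalue_mul_coeff_sq {L : ℝ} (hL : 0 < L) (c : ℝ) {w g h : ℝ → ℝ} (hw : MemH10 L w)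
    (hg : HasL2Deriv 0 L w g) (hh : HasL2Deriv 0 L g h) :
    ∑' j, eigenvalue L c (j + 1) * coeff L (j + 1) w ^ 2 =
      ∫ x in (0 : ℝ)..L, w x * (h x + c * w x) := by
  have hwm : MemLp w 2 (intervalMeasure L) :=
    memLp_of_continuousOn (continuousOn_of_memH10 hL hw)
  have hcm : MemLp (fun x => c * w x) 2 (intervalMeasure L) := hwm.const_mul c
  have h1 : HasSum (fun j => coeff L (j + 1) w * coeff L (j + 1) (h + fun x => c * w x))
      (∫ x in (0 : ℝ)..L, w x * (h x + c * w x)) := hasSum_coeff_mul hL hwm (hh.1.add hcm)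
  rw [← h1.tsum_eq]
  congr 1; ext j
  have h2 : coeff L (j + 1) (h + fun x => c * w x) =
      coeff L (j + 1) h + c * coeff L (j + 1) w := by
    rw [← coeff_const_mul]; exact coeff_add hL hh.1 hcm (j + 1)
  rw [h2, coeff_second_deriv hL hw.1 hw.2.1 hg hh, eigenvalue_eq]
  ring

theorem isDirichletEigenbasis_mode {L : ℝ} (hL : 0 < L) (c : ℝ) :
    IsDirichletEigenbasis L c (fun j => mode L (j + 1)) (fun j => eigenvalue L c (j + 1)) where
  contDiff j := by unfold mode; fun_prop
  boundary j := ⟨mode_zero_right L _, mode_right hL _⟩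
  eigen j x _ := by
    have h1 : deriv (mode L (j + 1)) = fun x => freq L (j + 1) * cosMode L (j + 1) x := by
      ext y; exact (hasDerivAt_mode L j y).deriv
    rw [h1, ((hasDerivAt_cosMode L j x).const_mul _).deriv, eigenvalue_eq]; ring
  orthonormal := integral_mode_mul_mode hL
  complete g hg h := isCompleteFamily_mode hL g hg (fun j => by
    rw [← intervalIntegral.integral_of_le hL.le]; exact h j)
  strictAnti := by
    intro i j hij
    simp only [eigenvalue_eq]
    have := freq_strictMono hL (show i + 1 < j + 1 by omega)
    have h2 := freq_nonneg hL (i + 1)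
    have := pow_lt_pow_left₀ this h2 two_ne_zero
    linarith
  tendsto := by
    simp only [eigenvalue_eq, sub_eq_add_neg]
    apply tendsto_atBot_add_const_left
    apply tendsto_neg_atTop_atBot.comp
    apply (tendsto_pow_atTop two_ne_zero).comp
    have : (fun j : ℕ => freq L (j + 1)) = fun j : ℕ => ((j + 1 : ℕ) : ℝ) * (Real.pi / L) := by
      ext j; unfold freq; ring
    rw [this]
    exact (tendsto_natCast_atTop_atTop.comp (tendsto_add_atTop_nat 1)).atTop_mul_const
      (by positivity)

/-! ### Pole placement -/

/-- The function `x/L` sees every mode; its coefficient is `±√(2/L) / (jπ/L)`. -/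
lemma coeff_div_ne_zero {L : ℝ} (hL : 0 < L) (j : ℕ) :
    coeff L (j + 1) (fun x => x / L) ≠ 0 := by
  have hw : ∀ x ∈ Icc 0 L, (fun x : ℝ => x / L) x = (fun x : ℝ => x / L) 0 +
      ∫ _ in (0 : ℝ)..x, (1 / L) := by
    intro x _; simp; ring
  have h := integral_mul_eq_of_hasDerivAt hL.le (g := fun _ => 1 / L) (by simp) hw
    (hasDerivAt_cosMode L j) (by fun_prop)
  have h1 : ∫ x in (0 : ℝ)..L, 1 / L * cosMode L (j + 1) x = 0 := by
    simp only [cosMode, Nat.add_eq_zero_iff, one_ne_zero, and_false, if_false]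
    simp_rw [freq_mul]
    rw [intervalIntegral.integral_const_mul, intervalIntegral.integral_const_mul,
      integral_cos_int hL, if_neg (by omega)]
    simp
  have h2 : ∀ x : ℝ, x / L * -(freq L (j + 1) * mode L (j + 1) x) =
    -freq L (j + 1) * (x / L * mode L (j + 1) x) := fun x => by ring
  simp_rw [h2] at h
  rw [h1, intervalIntegral.integral_const_mul] at h
  intro h0
  rw [coeff] at h0
  rw [h0] at h
  have h3 : cosMode L (j + 1) L = 0 := by
    rw [div_self hL.ne'] at h
    simpa using h.symm
  simp only [cosMode, Nat.add_eq_zero_iff, one_ne_zero, and_false, if_false,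
    freq_mul_self hL, Real.cos_nat_mul_pi] at h3
  have h4 : Real.sqrt (2 / L) ≠ 0 := by positivity
  exact (mul_ne_zero h4 (pow_ne_zero _ (by norm_num))) h3

lemma aCoeff_eq {L : ℝ} (c : ℝ) (j : ℕ) : aCoeff L c j = c * coeff L j (fun x => x / L) := by
  unfold aCoeff
  rw [← coeff_const_mul]
  congr 1; ext x; ring

lemma bCoeff_eq {L : ℝ} (j : ℕ) : bCoeff L j = -coeff L j (fun x => x / L) := by
  unfold bCoeff
  rw [← neg_one_mul, ← coeff_const_mul]
  congr 1; ext x; ring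

/-- The Kalman condition, mode by mode. -/
lemma bCoeff_mul_eigenvalue_add_aCoeff_ne_zero {L : ℝ} (hL : 0 < L) (c : ℝ) (j : ℕ) :
    bCoeff L (j + 1) * eigenvalue L c (j + 1) + aCoeff L c (j + 1) ≠ 0 := by
  have h : bCoeff L (j + 1) * eigenvalue L c (j + 1) + aCoeff L c (j + 1) =
      freq L (j + 1) ^ 2 * coeff L (j + 1) (fun x => x / L) := by
    rw [aCoeff_eq, bCoeff_eq, eigenvalue_eq]; ring
  rw [h]
  exact mul_ne_zero (pow_ne_zero 2 (freq_pos hL j).ne') (coeff_div_ne_zero hL j)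

lemma eigenvalue_injective {L : ℝ} (hL : 0 < L) (c : ℝ) :
    Function.Injective fun j => eigenvalue L c (j + 1) :=
  (isDirichletEigenbasis_mode hL c).strictAnti.injective

/-- The characteristic polynomial of `A_n + B_n K`, off the eigenvalues of `A_n`. There `s - A_n`
is invertible, `v = (s - A_n)⁻¹ B_n` is explicit, and
`det (s - A_n - B_n K) = det (s - A_n) (1 - K v)`. -/
lemma eval_charpoly_closedLoopMat (L c : ℝ) (n : ℕ) (K : Fin (n + 1) → ℝ) {s : ℝ} (hs0 : s ≠ 0)
    (hs : ∀ i : Fin n, s - eigenvalue L c (i + 1) ≠ 0) :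
    (closedLoopMat L c n K).charpoly.eval s =
      s * (∏ i : Fin n, (s - eigenvalue L c (i + 1))) *
        (1 - (K 0 / s + ∑ i : Fin n, K i.succ *
          ((bCoeff L (i + 1) * s + aCoeff L c (i + 1)) / (s * (s - eigenvalue L c (i + 1)))))) := by
  set D : Matrix (Fin (n + 1)) (Fin (n + 1)) ℝ := Matrix.scalar _ s - matA L c n with hD
  set v : Fin (n + 1) → ℝ := Fin.cons (1 / s) (fun i : Fin n =>
    (bCoeff L (i + 1) * s + aCoeff L c (i + 1)) / (s * (s - eigenvalue L c (i + 1)))) with hv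
  have hDv : D *ᵥ v = vecB L n := by
    ext i
    refine Fin.cases ?_ (fun i => ?_) i
    · simp [hD, hv, Matrix.mulVec, dotProduct, Fin.sum_univ_succ, matA, vecB, hs0,
        Matrix.scalar_apply, Matrix.diagonal_apply, Fin.ext_iff]
    · have h1 := hs i
      simp only [Matrix.mulVec, dotProduct, hD, Matrix.scalar_apply, matA, hv, Matrix.sub_apply,
        Fin.sum_univ_succ, Fin.cons_zero, vecB, Fin.cons_succ, Matrix.diagonal_apply, of_apply,
        sub_mul, ite_mul, zero_mul,
        Finset.sum_sub_distrib, Finset.sum_ite_eq, Finset.mem_univ, if_true]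
      field_simp
      ring
  have hdetD : D.det = s * ∏ i : Fin n, (s - eigenvalue L c (i + 1)) := by
    rw [Matrix.det_succ_row_zero, Fin.sum_univ_succ, Finset.sum_eq_zero, add_zero]
    · have h00 : D 0 0 = s := by simp [hD, matA]
      have hsub : D.submatrix Fin.succ (Fin.succAbove 0) =
          Matrix.diagonal fun i : Fin n => s - eigenvalue L c (i + 1) := by
        ext i j
        by_cases hij : i = j
        · subst hij; simp [hD, matA]
        · simp [hD, matA, hij]
      rw [h00, hsub, Matrix.det_diagonal]; simp
    · intro j _
      have : D 0 j.succ = 0 := by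
        simp [hD, matA, Fin.ext_iff]
      simp [this]
  have h1 : Matrix.scalar _ s - closedLoopMat L c n K = D * (1 - vecMulVec v K) := by
    rw [mul_sub, mul_one, Matrix.mul_vecMulVec, hDv, closedLoopMat, hD]
    abel
  rw [Matrix.eval_charpoly, h1, Matrix.det_mul, hdetD, Matrix.vecMulVec_eq Unit,
    Matrix.det_one_sub_mul_comm]
  congr 1
  simp [Matrix.det_unique, Matrix.mul_apply, Fin.sum_univ_succ, hv, div_eq_mul_inv]

/-- Partial fractions: if `X ∏ (X - μ_i) - Q` has degree at most `n`, it is a combination of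
`∏ (X - μ_i)` and `(β_i X + α_i) ∏_{j ≠ i} (X - μ_j)`. -/
lemma exists_combination_eq {n : ℕ} (lam α β : Fin n → ℝ) (hinj : Function.Injective lam)
    (hne : ∀ i, β i * lam i + α i ≠ 0) (Q : Polynomial ℝ) (hQ : Q.degree < ((n + 1 : ℕ) : WithBot ℕ)) :
    ∃ (k₀ : ℝ) (k : Fin n → ℝ), ∀ s, Q.eval s = k₀ * ∏ i, (s - lam i) +
      ∑ i, k i * ((β i * s + α i) * ∏ j ∈ Finset.univ.erase i, (s - lam j)) := by
  open Polynomial in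
  let N : Fin n → ℝ[X] := fun i =>
    (C (β i) * X + C (α i)) * ∏ j ∈ Finset.univ.erase i, (X - C (lam j))
  have hNev : ∀ i s, (N i).eval s = (β i * s + α i) * ∏ j ∈ Finset.univ.erase i, (s - lam j) := by
    intro i s; simp [N, eval_prod]
  have hNne : ∀ i, (N i).eval (lam i) ≠ 0 := by
    intro i
    rw [hNev]
    refine mul_ne_zero (hne i) (Finset.prod_ne_zero_iff.2 fun j hj => ?_)
    rw [sub_ne_zero]
    exact fun h => (Finset.ne_of_mem_erase hj) (hinj h).symm
  have hNz : ∀ i j, i ≠ j → (N i).eval (lam j) = 0 := by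
    intro i j hij
    rw [hNev]
    refine mul_eq_zero_of_right _ (Finset.prod_eq_zero (i := j) ?_ (sub_self _))
    simp [hij.symm]
  let k : Fin n → ℝ := fun i => Q.eval (lam i) / (N i).eval (lam i)
  let Pi : ℝ[X] := ∏ i, (X - C (lam i))
  have hPim : Pi.Monic := monic_prod_X_sub_C lam Finset.univ
  have hPideg : Pi.natDegree = n := by simp [Pi, natDegree_prod_of_monic, monic_X_sub_C]
  have hNdeg : ∀ i, (N i).natDegree ≤ n := by
    intro i
    refine natDegree_mul_le.trans ?_
    have h1 : (C (β i) * X + C (α i)).natDegree ≤ 1 := natDegree_linear_le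
    have h2 : (∏ j ∈ Finset.univ.erase i, (X - C (lam j))).natDegree = n - 1 := by
      rw [natDegree_prod_of_monic _ _ (fun j _ => monic_X_sub_C _)]
      simp
    have := i.pos
    omega
  let R : ℝ[X] := Q - ∑ i, C (k i) * N i
  have hRdeg : R.natDegree ≤ n := by
    refine (natDegree_sub_le _ _).trans (max_le ?_ ?_)
    · rw [natDegree_le_iff_degree_le]
      rw [degree_lt_iff_coeff_zero] at hQ
      exact degree_le_iff_coeff_zero _ _ |>.2 fun m hm => hQ m (by exact_mod_cast hm)
    · refine natDegree_sum_le_of_forall_le _ _ fun i _ => ?_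
      exact (natDegree_C_mul_le _ _).trans (hNdeg i)
  have hzero : R - C (R.coeff n) * Pi = 0 := by
    apply Polynomial.eq_zero_of_degree_lt_of_eval_index_eq_zero (s := Finset.univ) (v := lam)
      hinj.injOn
    · rw [Finset.card_univ, Fintype.card_fin, degree_lt_iff_coeff_zero]
      intro m hm
      rcases hm.eq_or_lt with rfl | hm
      · have : Pi.coeff n = 1 := by
          have := hPim.coeff_natDegree; rwa [hPideg] at this
        rw [Polynomial.coeff_sub, coeff_C_mul, this]; simp
      · have h1 : R.coeff m = 0 := coeff_eq_zero_of_natDegree_lt (hRdeg.trans_lt hm)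
        have h2 : Pi.coeff m = 0 := coeff_eq_zero_of_natDegree_lt (by rw [hPideg]; exact hm)
        rw [Polynomial.coeff_sub, coeff_C_mul, h1, h2]
        simp
    · intro j _
      have hP : Pi.eval (lam j) = 0 := by
        simp only [Pi, eval_prod]
        exact Finset.prod_eq_zero (Finset.mem_univ j) (by simp)
      have hS : (∑ i, C (k i) * N i).eval (lam j) = Q.eval (lam j) := by
        rw [eval_finsetSum, Finset.sum_eq_single j]
        · simp only [eval_mul, eval_C, k]
          exact div_mul_cancel₀ _ (hNne j)
        · intro i _ hij
          simp [hNz i j hij]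
        · simp
      simp [R, hP, hS]
  refine ⟨R.coeff n, k, fun s => ?_⟩
  have h := congrArg (Polynomial.eval s) hzero
  simp only [R, eval_sub, eval_finsetSum, eval_mul, eval_C, hNev, eval_zero] at h
  have hP : Pi.eval s = ∏ i, (s - lam i) := by simp [Pi, eval_prod]
  rw [hP] at h
  linarith

/-- Pole placement: by the formula for the characteristic polynomial, its difference from
`X ∏ (X - λ_i)` ranges over all polynomials of degree at most `n` as `K` varies. -/
theorem exists_placesPoles {L : ℝ} (hL : 0 < L) (c : ℝ) (n : ℕ) :
    ∃ K : Fin (n + 1) → ℝ, PlacesPoles L c n K := by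
  open Polynomial in
  let lam : Fin n → ℝ := fun i => eigenvalue L c (i + 1)
  have hinj : Function.Injective lam := fun i j h =>
    Fin.ext (eigenvalue_injective hL c h)
  let Pi : ℝ[X] := ∏ i, (X - C (lam i))
  have hPim : Pi.Monic := monic_prod_X_sub_C lam Finset.univ
  have hPideg : Pi.natDegree = n := by simp [Pi, natDegree_prod_of_monic, monic_X_sub_C]
  have hXm : (X * Pi).Monic := monic_X.mul hPim
  have hXdeg : (X * Pi).natDegree = n + 1 := by
    rw [monic_X.natDegree_mul hPim, natDegree_X, hPideg]; ring
  have hTm : ((X + C (1 : ℝ)) ^ (n + 1)).Monic := (monic_X_add_C 1).pow _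
  have hTdeg : ((X + C (1 : ℝ)) ^ (n + 1)).natDegree = n + 1 := by
    rw [(monic_X_add_C (1 : ℝ)).natDegree_pow, natDegree_X_add_C, mul_one]
  have hdeg : (X * Pi - (X + C (1 : ℝ)) ^ (n + 1)).degree < ((n + 1 : ℕ) : WithBot ℕ) := by
    have h1 : (X * Pi).degree = ((n + 1 : ℕ) : WithBot ℕ) := by
      rw [degree_eq_natDegree hXm.ne_zero, hXdeg]
    rw [← h1]
    refine degree_sub_lt_left ?_ hXm.ne_zero (by rw [hXm.leadingCoeff, hTm.leadingCoeff])
    rw [h1, degree_eq_natDegree hTm.ne_zero, hTdeg]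
  obtain ⟨k₀, k, hk⟩ := exists_combination_eq lam (fun i => aCoeff L c (i + 1))
    (fun i => bCoeff L (i + 1)) hinj
    (fun i => bCoeff_mul_eigenvalue_add_aCoeff_ne_zero hL c i) _ hdeg
  refine ⟨Fin.cons k₀ k, ?_⟩
  unfold PlacesPoles
  -- both sides agree off a finite set
  apply Polynomial.eq_of_infinite_eval_eq
  refine Set.Infinite.mono (s := (insert 0 (Set.range lam))ᶜ) ?_ ?_
  · intro s hs
    simp only [Set.mem_compl_iff, Set.mem_insert_iff, Set.mem_range, not_or, not_exists] at hs
    have hs1 : ∀ i : Fin n, s - lam i ≠ 0 := fun i => sub_ne_zero.2 fun h => hs.2 i h.symm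
    have h1 := hk s
    have h2 : (X * Pi).eval s = s * ∏ i, (s - lam i) := by simp [Pi, eval_prod]
    rw [eval_sub, h2] at h1
    rw [Set.mem_ofPred_eq, eval_charpoly_closedLoopMat L c n _ hs.1 hs1]
    have h3 : ∀ i : Fin n, ∏ j ∈ Finset.univ.erase i, (s - lam j) =
        (∏ j, (s - lam j)) / (s - lam i) := by
      intro i
      rw [eq_div_iff (hs1 i), mul_comm,
        Finset.mul_prod_erase _ (fun j => s - lam j) (Finset.mem_univ i)]
    simp_rw [h3] at h1
    have h4 : ((X + C (1 : ℝ)) ^ (n + 1)).eval s = s * ∏ i, (s - lam i) -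
        (k₀ * ∏ i, (s - lam i) + ∑ i, k i * ((bCoeff L (i + 1) * s + aCoeff L c (i + 1)) *
          ((∏ j, (s - lam j)) / (s - lam i)))) := by linarith
    rw [h4]
    simp only [Fin.cons_zero, Fin.cons_succ]
    rw [mul_sub, mul_add, Finset.mul_sum]
    congr 1
    · ring
    · congr 1
      · have := hs.1; field_simp; exact mul_comm _ _
      · refine Finset.sum_congr rfl fun i _ => ?_
        have := hs.1
        have := hs1 i
        change s * (∏ i, (s - lam i)) * (k i * ((bCoeff L (i + 1) * s + aCoeff L c (i + 1)) /
          (s * (s - lam i)))) = _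
        field_simp
  · exact ((Set.finite_range lam).insert 0).infinite_compl

/-! ### The Lyapunov equation -/

/-- If `N = M + 1` is nilpotent, then so is the Cayley transform `G = (1 + M)(1 - M)⁻¹`, and the
finite sum `P = 2 ∑ (Gᵏ R)ᵀ (Gᵏ R)`, `R = (1 - M)⁻¹`, solves the Stein equation
`P - Gᵀ P G = 2 Rᵀ R`, which is the Lyapunov equation `P M + Mᵀ P = -1` multiplied by `R`
from both sides. -/
theorem exists_lyapunov_solution {m : ℕ} (M : Matrix (Fin m) (Fin m) ℝ) (k : ℕ)
    (hM : (M + 1) ^ (k + 1) = 0) :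
    ∃ P : Matrix (Fin m) (Fin m) ℝ, P.PosDef ∧ P * M + Mᵀ * P = -1 := by
  have hu : IsUnit (1 - M) := by
    have h2 : IsUnit (1 - (2⁻¹ : ℝ) • (M + 1)) := by
      apply IsNilpotent.isUnit_one_sub
      exact ⟨k + 1, by rw [smul_pow, hM, smul_zero]⟩
    have h3 : 1 - M = (2 : ℝ) • (1 - (2⁻¹ : ℝ) • (M + 1)) := by
      rw [smul_sub, smul_smul, mul_inv_cancel₀ two_ne_zero, one_smul, two_smul]
      abel
    rw [h3]
    exact h2.smul (Units.mk0 (2 : ℝ) two_ne_zero)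
  obtain ⟨R, hR1, hR2⟩ : ∃ R, (1 - M) * R = 1 ∧ R * (1 - M) = 1 := by
    obtain ⟨U, hU⟩ := hu
    exact ⟨↑U⁻¹, by rw [← hU]; simp, by rw [← hU]; simp⟩
  have hcomm : Commute R (1 + M) := by
    have h1 : (1 + M) * (1 - M) = (1 - M) * (1 + M) := by noncomm_ring
    calc R * (1 + M) = R * ((1 + M) * (1 - M)) * R := by
          rw [mul_assoc, mul_assoc, hR1, mul_one]
      _ = (1 + M) * R := by rw [h1, ← mul_assoc, hR2, one_mul]
  set G := (1 + M) * R with hG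
  have hGk : G ^ (k + 1) = 0 := by
    rw [hG, hcomm.symm.mul_pow, add_comm, hM, zero_mul]
  set S : ℕ → Matrix (Fin m) (Fin m) ℝ := fun i => (G ^ i * R)ᵀ * (G ^ i * R) with hS
  have hStein : ∑ i ∈ Finset.range (k + 1), S i - Gᵀ * (∑ i ∈ Finset.range (k + 1), S i) * G =
      Rᵀ * R := by
    have hRG : R * G = G * R := by rw [hG, ← mul_assoc, hcomm.eq]
    have hGS : ∀ i, Gᵀ * S i * G = S (i + 1) := by
      intro i
      have : G ^ (i + 1) * R = G ^ i * R * G := by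
        rw [pow_succ, mul_assoc (G ^ i), mul_assoc (G ^ i), hRG]
      simp only [hS]
      rw [this, Matrix.transpose_mul (G ^ i * R) G]
      simp only [mul_assoc]
    have hsucc : S (k + 1) = 0 := by simp [hS, hGk]
    rw [Finset.mul_sum, Finset.sum_mul]
    simp_rw [hGS]
    have h1 := Finset.sum_range_succ S (k + 1)
    rw [Finset.sum_range_succ', hsucc, add_zero] at h1
    rw [← h1]
    simp [hS]
  have hGM : G * (1 - M) = 1 + M := by rw [hG, mul_assoc, hR2, mul_one]
  set Q := ∑ i ∈ Finset.range (k + 1), S i with hQ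
  have hLyap : (1 - M)ᵀ * Q * (1 - M) - (1 + M)ᵀ * Q * (1 + M) = 1 := by
    calc (1 - M)ᵀ * Q * (1 - M) - (1 + M)ᵀ * Q * (1 + M)
        = (1 - M)ᵀ * (Q - Gᵀ * Q * G) * (1 - M) := by
          rw [← hGM, Matrix.transpose_mul]; noncomm_ring
      _ = ((1 - M)ᵀ * Rᵀ) * (R * (1 - M)) := by rw [hStein]; noncomm_ring
      _ = 1 := by rw [← Matrix.transpose_mul, hR2]; simp
  refine ⟨(2 : ℝ) • Q, ?_, ?_⟩
  · have hS0 : (S 0).PosDef := by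
      have : S 0 = Rᴴ * R := by simp [hS]
      rw [this]
      apply Matrix.PosDef.conjTranspose_mul_self
      intro x y hxy
      have := congrArg ((1 - M) *ᵥ ·) hxy
      simpa [Matrix.mulVec_mulVec, hR1] using this
    have hSk : ∀ i, (S i).PosSemidef := fun i => by
      have := Matrix.posSemidef_conjTranspose_mul_self (G ^ i * R)
      simpa [hS] using this
    have : Q.PosDef := by
      rw [hQ, Finset.sum_range_succ', add_comm]
      exact hS0.add_posSemidef (Matrix.posSemidef_sum _ fun i _ => hSk _)
    exact this.smul two_pos
  · have h2 : (1 - M)ᵀ * Q * (1 - M) - (1 + M)ᵀ * Q * (1 + M) =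
        -((2 : ℝ) • Q * M + Mᵀ * ((2 : ℝ) • Q)) := by
      simp only [Matrix.transpose_sub, Matrix.transpose_add, Matrix.transpose_one, two_smul]
      noncomm_ring
    rw [h2] at hLyap
    rw [← hLyap, neg_neg]

/-- By the Cayley–Hamilton theorem `A_n + B_n K + 1` is nilpotent. -/
theorem exists_solvesLyapunov {L c : ℝ} {n : ℕ} {K : Fin (n + 1) → ℝ}
    (hK : PlacesPoles L c n K) : ∃ P, SolvesLyapunov L c n K P := by
  refine exists_lyapunov_solution _ n ?_
  have h := Matrix.aeval_self_charpoly (closedLoopMat L c n K)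
  rw [hK] at h
  simpa using h

/-! ### Quadratic forms -/

section QuadraticForms

variable {m : ℕ}

lemma dotProduct_self_nonneg' (x : Fin m → ℝ) : 0 ≤ x ⬝ᵥ x :=
  Finset.sum_nonneg fun i _ => mul_self_nonneg (x i)

lemma abs_le_sqrt_dotProduct (x : Fin m → ℝ) (i : Fin m) : |x i| ≤ Real.sqrt (x ⬝ᵥ x) := by
  rw [← Real.sqrt_sq_eq_abs]
  apply Real.sqrt_le_sqrt
  rw [sq]
  exact Finset.single_le_sum (f := fun i => x i * x i) (fun i _ => mul_self_nonneg (x i))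
    (Finset.mem_univ i)

lemma exists_abs_dotProduct_mulVec_le (P : Matrix (Fin m) (Fin m) ℝ) :
    ∃ p > 0, ∀ x y : Fin m → ℝ,
      |x ⬝ᵥ P *ᵥ y| ≤ p * (Real.sqrt (x ⬝ᵥ x) * Real.sqrt (y ⬝ᵥ y)) := by
  refine ⟨∑ i, ∑ j, |P i j| + 1, by positivity, fun x y => ?_⟩
  have hx := Real.sqrt_nonneg (x ⬝ᵥ x)
  have hy := Real.sqrt_nonneg (y ⬝ᵥ y)
  have h1 : |x ⬝ᵥ P *ᵥ y| ≤
      (∑ i, ∑ j, |P i j|) * (Real.sqrt (x ⬝ᵥ x) * Real.sqrt (y ⬝ᵥ y)) := by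
    simp only [dotProduct, Matrix.mulVec, Finset.mul_sum, Finset.sum_mul]
    refine (Finset.abs_sum_le_sum_abs _ _).trans (Finset.sum_le_sum fun i _ => ?_)
    refine (Finset.abs_sum_le_sum_abs _ _).trans (Finset.sum_le_sum fun j _ => ?_)
    have hi := abs_le_sqrt_dotProduct x i
    have hj := abs_le_sqrt_dotProduct y j
    simp only [dotProduct] at hi hj
    rw [abs_mul, abs_mul]
    calc |x i| * (|P i j| * |y j|) = |P i j| * (|x i| * |y j|) := by ring
      _ ≤ _ := by gcongr
  nlinarith [mul_nonneg hx hy]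

lemma mulVec_dotProduct_comm {P : Matrix (Fin m) (Fin m) ℝ} (hP : Pᵀ = P) (x y : Fin m → ℝ) :
    x ⬝ᵥ P *ᵥ y = y ⬝ᵥ P *ᵥ x := by
  rw [Matrix.dotProduct_mulVec, ← Matrix.mulVec_transpose, hP, dotProduct_comm]

/-- Expand `(x - s P⁻¹ x)ᵀ P (x - s P⁻¹ x) ≥ 0` with a small `s`. -/
lemma exists_le_dotProduct_mulVec {P : Matrix (Fin m) (Fin m) ℝ} (hP : P.PosDef) :
    ∃ q > 0, ∀ x : Fin m → ℝ, q * (x ⬝ᵥ x) ≤ x ⬝ᵥ P *ᵥ x := by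
  obtain ⟨p, hp, h⟩ := exists_abs_dotProduct_mulVec_le P⁻¹
  refine ⟨1 / p, by positivity, fun x => ?_⟩
  have hPt : Pᵀ = P := by simpa using hP.isHermitian.eq
  have hinv : P * P⁻¹ = 1 := Matrix.mul_nonsing_inv _ (hP.isUnit.map (Matrix.detMonoidHom))
  set y := P⁻¹ *ᵥ x with hy
  have hPy : P *ᵥ y = x := by rw [hy, Matrix.mulVec_mulVec, hinv, Matrix.one_mulVec]
  have h0 := hP.posSemidef.dotProduct_mulVec_nonneg (x - (1 / p) • y)
  simp only [star_trivial, Matrix.mulVec_sub, Matrix.mulVec_smul, hPy, dotProduct_sub,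
    sub_dotProduct, smul_dotProduct, dotProduct_smul, smul_eq_mul] at h0
  have h1 : y ⬝ᵥ P *ᵥ x = x ⬝ᵥ x := by rw [mulVec_dotProduct_comm hPt, hPy]
  have h2 : y ⬝ᵥ x ≤ p * (x ⬝ᵥ x) := by
    have := (le_abs_self _).trans (h x x)
    rw [Real.mul_self_sqrt (dotProduct_self_nonneg' x)] at this
    rwa [dotProduct_comm]
  rw [h1] at h0
  have h3 : 1 / p * (1 / p * (y ⬝ᵥ x)) ≤ 1 / p * (1 / p * (p * (x ⬝ᵥ x))) := by gcongr
  have h4 : 1 / p * (1 / p * (p * (x ⬝ᵥ x))) = 1 / p * (x ⬝ᵥ x) := by field_simp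
  linarith

end QuadraticForms

/-! ### Integrals over time and space -/

lemma restrict_prod_eq (T L : ℝ) :
    (volume : Measure (ℝ × ℝ)).restrict (Ioc 0 T ×ˢ Ioc 0 L) =
      (intervalMeasure T).prod (intervalMeasure L) := by
  rw [Measure.volume_eq_prod, Measure.prod_restrict]

lemma continuousOn_integral_of_continuousOn_prod {T L : ℝ} (hT : 0 ≤ T) (hL : 0 ≤ L)
    {G : ℝ → ℝ → ℝ} (hG : ContinuousOn (fun p : ℝ × ℝ => G p.1 p.2) (Icc 0 T ×ˢ Icc 0 L)) :
    ContinuousOn (fun t => ∫ x in (0 : ℝ)..L, G t x) (Icc 0 T) := by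
  have hc : Continuous (Function.uncurry fun t x : ℝ =>
      G (projIcc 0 T hT t) (projIcc 0 L hL x)) := by
    refine hG.comp_continuous (f := fun p : ℝ × ℝ =>
      (((projIcc 0 T hT p.1 : Icc 0 T) : ℝ), ((projIcc 0 L hL p.2 : Icc 0 L) : ℝ))) ?_ ?_
    · exact ((continuous_subtype_val.comp continuous_projIcc).comp continuous_fst).prodMk
        ((continuous_subtype_val.comp continuous_projIcc).comp continuous_snd)
    · intro p
      exact ⟨Subtype.coe_prop _, Subtype.coe_prop _⟩
  refine (intervalIntegral.continuous_parametric_intervalIntegral_of_continuous' hc 0 L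
    (μ := volume)).continuousOn.congr fun t ht => ?_
  apply intervalIntegral.integral_congr
  intro x hx
  rw [uIcc_of_le hL] at hx
  simp only [projIcc_of_mem hT ht, projIcc_of_mem hL hx]

lemma continuousOn_slice {T L : ℝ} {G : ℝ → ℝ → ℝ}
    (hG : ContinuousOn (fun p : ℝ × ℝ => G p.1 p.2) (Icc 0 T ×ˢ Icc 0 L)) {t : ℝ}
    (ht : t ∈ Icc 0 T) : ContinuousOn (G t) (Icc 0 L) :=
  hG.comp (f := fun x : ℝ => (t, x)) (by fun_prop) fun _ hx => ⟨ht, hx⟩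

/-- A function on the rectangle that is a primitive in time can be tested against a function of
the space variable. -/
lemma integral_mul_eq_add_integral {T L : ℝ} (hT : 0 ≤ T) (hL : 0 ≤ L) {y yt : ℝ → ℝ → ℝ}
    (hyc : ContinuousOn (fun p : ℝ × ℝ => y p.1 p.2) (Icc 0 T ×ˢ Icc 0 L))
    (hyt : Integrable (fun p : ℝ × ℝ => yt p.1 p.2) ((intervalMeasure T).prod (intervalMeasure L)))
    (hd : ∀ᵐ x ∂(intervalMeasure L), ∀ t ∈ Icc 0 T, y t x = y 0 x + ∫ s in (0 : ℝ)..t, yt s x)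
    {φ : ℝ → ℝ} (hφ : Continuous φ) {t : ℝ} (ht : t ∈ Icc 0 T) :
    ∫ x in (0 : ℝ)..L, y t x * φ x = (∫ x in (0 : ℝ)..L, y 0 x * φ x) +
      ∫ s in (0 : ℝ)..t, ∫ x in (0 : ℝ)..L, yt s x * φ x := by
  have hint : Integrable (fun p : ℝ × ℝ => yt p.1 p.2 * φ p.2)
      ((intervalMeasure t).prod (intervalMeasure L)) := by
    obtain ⟨C, hC⟩ := isCompact_Icc.exists_bound_of_continuousOn (hφ.continuousOn (s := Icc 0 L))
    have h1 : Integrable (fun p : ℝ × ℝ => yt p.1 p.2)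
        ((intervalMeasure t).prod (intervalMeasure L)) := by
      refine hyt.mono_measure (Measure.prod_mono ?_ le_rfl)
      exact Measure.restrict_mono (Ioc_subset_Ioc_right ht.2) le_rfl
    refine h1.mul_bdd (c := C) (by fun_prop) ?_
    rw [Measure.prod_restrict]
    filter_upwards [ae_restrict_mem (measurableSet_Ioc.prod measurableSet_Ioc)] with p hp
    exact hC _ (Ioc_subset_Icc_self hp.2)
  have hswap := integral_integral_swap (f := fun s x => yt s x * φ x) hint
  have h0 : (0 : ℝ) ∈ Icc 0 T := left_mem_Icc.2 hT
  have hi : ∀ s ∈ Icc 0 T, IntervalIntegrable (fun x => y s x * φ x) volume 0 L := by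
    intro s hs
    apply ContinuousOn.intervalIntegrable
    rw [uIcc_of_le hL]
    exact (continuousOn_slice hyc hs).mul hφ.continuousOn
  rw [← sub_eq_iff_eq_add', ← intervalIntegral.integral_sub (hi t ht) (hi 0 h0)]
  simp only [intervalIntegral.integral_of_le hL, intervalIntegral.integral_of_le ht.1]
  rw [hswap]
  apply integral_congr_ae
  filter_upwards [hd] with x hx
  rw [hx t ht, intervalIntegral.integral_of_le ht.1, integral_mul_const]
  ring

/-! ### The closed loop in sine coefficients -/

/-- The control law `u' = K (u, z_1, …, z_n)`. -/
def control (L : ℝ) (n : ℕ) (K : Fin (n + 1) → ℝ) (u : ℝ) (w : ℝ → ℝ) : ℝ :=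
  K ⬝ᵥ stateVec L n u w

/-- The lower order part `f(w + (x/L) u) - (x/L) u'` of the equation for `z`. -/
def forcing (L : ℝ) (f : ℝ → ℝ) (n : ℕ) (K : Fin (n + 1) → ℝ) (u : ℝ) (w : ℝ → ℝ) (x : ℝ) : ℝ :=
  f (w x + x / L * u) - x / L * control L n K u w

/-- The time derivative of the sine coefficient `z_{j+1}` of the closed loop at the state
`(u, w)`. -/
def rate (L : ℝ) (f : ℝ → ℝ) (n : ℕ) (K : Fin (n + 1) → ℝ) (u : ℝ) (w : ℝ → ℝ) (j : ℕ) : ℝ :=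
  -(freq L (j + 1) ^ 2 * coeff L (j + 1) w) + coeff L (j + 1) (forcing L f n K u w)

lemma continuousOn_forcing {L : ℝ} {f : ℝ → ℝ} (hf : Continuous f) (n : ℕ)
    (K : Fin (n + 1) → ℝ) (u : ℝ) {w : ℝ → ℝ} (hw : ContinuousOn w (Icc 0 L)) :
    ContinuousOn (forcing L f n K u w) (Icc 0 L) := by
  unfold forcing
  exact (hf.comp_continuousOn (hw.add (by fun_prop))).sub (by fun_prop)

section Solution

variable {L T : ℝ} {f : ℝ → ℝ} {n : ℕ} {K : Fin (n + 1) → ℝ} {u : ℝ → ℝ} {y : ℝ → ℝ → ℝ}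

lemma IsSolution.continuousOn_y (h : IsSolution L f n K T u y) :
    ContinuousOn (fun p : ℝ × ℝ => y p.1 p.2) (Icc 0 T ×ˢ Icc 0 L) := by
  obtain ⟨yt, yx, yxx, hy, -⟩ := h.equation
  exact hy.continuousOn

lemma IsSolution.continuousOn_u (h : IsSolution L f n K T u y) : ContinuousOn u (Icc 0 T) :=
  fun t ht => (h.feedback t ht).continuousWithinAt

lemma IsSolution.continuousOn_shifted (h : IsSolution L f n K T u y) :
    ContinuousOn (fun p : ℝ × ℝ => shifted L u y p.1 p.2) (Icc 0 T ×ˢ Icc 0 L) := by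
  unfold shifted
  refine h.continuousOn_y.sub (ContinuousOn.mul (by fun_prop) ?_)
  exact h.continuousOn_u.comp continuous_fst.continuousOn fun p hp => hp.1

lemma IsSolution.continuousOn_shifted_slice (h : IsSolution L f n K T u y) {t : ℝ}
    (ht : t ∈ Icc 0 T) : ContinuousOn (shifted L u y t) (Icc 0 L) :=
  continuousOn_slice h.continuousOn_shifted ht

lemma IsSolution.continuousOn_coeff (hL : 0 < L) (hT : 0 ≤ T) (h : IsSolution L f n K T u y)
    (j : ℕ) : ContinuousOn (fun t => coeff L j (shifted L u y t)) (Icc 0 T) := by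
  unfold coeff
  apply continuousOn_integral_of_continuousOn_prod hT hL.le
  exact h.continuousOn_shifted.mul (by fun_prop)

lemma IsSolution.continuousOn_stateVec (hL : 0 < L) (hT : 0 ≤ T) (h : IsSolution L f n K T u y) :
    ContinuousOn (fun t => stateVec L n (u t) (shifted L u y t)) (Icc 0 T) := by
  rw [continuousOn_pi]
  intro i
  refine Fin.cases ?_ (fun i => ?_) i
  · simpa [stateVec] using h.continuousOn_u
  · simpa [stateVec] using h.continuousOn_coeff hL hT _

lemma IsSolution.continuousOn_control (hL : 0 < L) (hT : 0 ≤ T) (h : IsSolution L f n K T u y) :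
    ContinuousOn (fun t => control L n K (u t) (shifted L u y t)) (Icc 0 T) := by
  have h1 := h.continuousOn_stateVec hL hT
  rw [continuousOn_pi] at h1
  unfold control dotProduct
  exact continuousOn_finsetSum _ fun i _ => continuousOn_const.mul (h1 i)

lemma IsSolution.continuousOn_forcing_prod (hL : 0 < L) (hT : 0 ≤ T) (hf : Continuous f)
    (h : IsSolution L f n K T u y) :
    ContinuousOn (fun p : ℝ × ℝ => forcing L f n K (u p.1) (shifted L u y p.1) p.2)
      (Icc 0 T ×ˢ Icc 0 L) := by
  unfold forcing
  refine ContinuousOn.sub (hf.comp_continuousOn (h.continuousOn_shifted.add ?_)) ?_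
  · exact ContinuousOn.mul (by fun_prop)
      (h.continuousOn_u.comp continuous_fst.continuousOn fun p hp => hp.1)
  · exact ContinuousOn.mul (by fun_prop)
      ((h.continuousOn_control hL hT).comp continuous_fst.continuousOn fun p hp => hp.1)

lemma IsSolution.continuousOn_rate (hL : 0 < L) (hT : 0 ≤ T) (hf : Continuous f)
    (h : IsSolution L f n K T u y) (j : ℕ) :
    ContinuousOn (fun t => rate L f n K (u t) (shifted L u y t) j) (Icc 0 T) := by
  unfold rate
  refine (continuousOn_const.mul (h.continuousOn_coeff hL hT _)).neg.add ?_
  unfold coeff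
  apply continuousOn_integral_of_continuousOn_prod hT hL.le
  exact (h.continuousOn_forcing_prod hL hT hf).mul (by fun_prop)

lemma IsSolution.u_eq_integral (hL : 0 < L) (h : IsSolution L f n K T u y) :
    ∀ t ∈ Icc 0 T, u t = u 0 + ∫ s in (0 : ℝ)..t, control L n K (u s) (shifted L u y s) := by
  intro t ht
  have hT : 0 ≤ T := ht.1.trans ht.2
  have hc := h.continuousOn_control hL hT
  rw [intervalIntegral.integral_eq_sub_of_hasDeriv_right_of_le ht.1
    (h.continuousOn_u.mono (Icc_subset_Icc_right ht.2))
    (f' := fun s => control L n K (u s) (shifted L u y s))]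
  · ring
  · intro x hx
    have h1 := h.feedback x ⟨hx.1.le, hx.2.le.trans ht.2⟩
    refine (h1.hasDerivAt (Icc_mem_nhds hx.1 (hx.2.trans_le ht.2))).hasDerivWithinAt
  · apply ContinuousOn.intervalIntegrable
    rw [uIcc_of_le ht.1]
    exact hc.mono (Icc_subset_Icc_right ht.2)

lemma shifted_add (L : ℝ) (u : ℝ → ℝ) (y : ℝ → ℝ → ℝ) (t x : ℝ) :
    shifted L u y t x + x / L * u t = y t x := by
  unfold shifted; ring

/-- The function `z(t, ·)` and its derivatives inherit their regularity from `y(t, ·)`. -/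
lemma IsSolution.shifted_hasL2Deriv (hL : 0 < L) (h : IsSolution L f n K T u y) {t : ℝ}
    (ht : t ∈ Icc 0 T) {g k : ℝ → ℝ} (hg : HasL2Deriv 0 L (y t) g) (hk : HasL2Deriv 0 L g k) :
    shifted L u y t 0 = 0 ∧ shifted L u y t L = 0 ∧
      HasL2Deriv 0 L (shifted L u y t) (fun x => g x - u t / L) ∧
      HasL2Deriv 0 L (fun x => g x - u t / L) k := by
  refine ⟨by simp [shifted, h.boundary_zero t ht],
    by simp [shifted, h.boundary_L t ht, div_self hL.ne'],
    ⟨hg.1.sub (memLp_const _), fun x hx => ?_⟩, hk.1, fun x hx => ?_⟩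
  · have hi : IntervalIntegrable g volume 0 x := by
      refine (hg.intervalIntegrable hL.le).mono_set ?_
      rw [uIcc_of_le hx.1, uIcc_of_le hL.le]; exact Icc_subset_Icc_right hx.2
    rw [intervalIntegral.integral_sub hi (by simp)]
    simp only [shifted, intervalIntegral.integral_const]
    rw [hg.2 x hx]; simp; ring
  · simp only
    rw [hk.2 x hx]; ring

/-- At almost every time `z(t, ·)` belongs to `H²`, and the second derivative is square integrable
in time and space. -/
lemma IsSolution.ae_shifted_hasL2Deriv (hL : 0 < L) (h : IsSolution L f n K T u y) :
    ∃ W : ℝ → ℝ, Integrable W (intervalMeasure T) ∧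
      ∀ᵐ t ∂(intervalMeasure T), Summable (fun j =>
        (freq L (j + 1) ^ 2 * coeff L (j + 1) (shifted L u y t)) ^ 2) ∧
        ∑' j, (freq L (j + 1) ^ 2 * coeff L (j + 1) (shifted L u y t)) ^ 2 ≤ W t := by
  obtain ⟨yt, yx, yxx, hy, heq⟩ := h.equation
  have h2 := hy.memLp_xx
  rw [restrict_prod_eq] at h2
  refine ⟨fun t => ∫ x, yxx t x ^ 2 ∂(intervalMeasure L), h2.integrable_sq.integral_prod_left, ?_⟩
  filter_upwards [hy.deriv_x, ae_restrict_mem measurableSet_Ioc] with t ht hmem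
  have htI := Ioc_subset_Icc_self hmem
  obtain ⟨hb0, hbL, hs1, hs2⟩ := h.shifted_hasL2Deriv hL htI ht.1 ht.2
  have hsum := hasSum_coeff_sq hL ht.2.1
  have he : ∀ j, coeff L (j + 1) (yxx t) ^ 2 =
      (freq L (j + 1) ^ 2 * coeff L (j + 1) (shifted L u y t)) ^ 2 := by
    intro j
    rw [coeff_second_deriv hL hb0 hbL hs1 hs2, neg_sq]
  simp_rw [he] at hsum
  refine ⟨hsum.summable, ?_⟩
  rw [hsum.tsum_eq, intervalIntegral.integral_of_le hL.le]

/-- The sine coefficients of `z` satisfy `z_j' = rate_j`, in integrated form. -/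
lemma IsSolution.coeff_eq_integral (hL : 0 < L) (hf : Continuous f)
    (h : IsSolution L f n K T u y) (j : ℕ) : ∀ t ∈ Icc 0 T,
    coeff L (j + 1) (shifted L u y t) = coeff L (j + 1) (shifted L u y 0) +
      ∫ s in (0 : ℝ)..t, rate L f n K (u s) (shifted L u y s) j := by
  intro t ht
  have hT : 0 ≤ T := ht.1.trans ht.2
  have h0 : (0 : ℝ) ∈ Icc 0 T := left_mem_Icc.2 hT
  obtain ⟨yt, yx, yxx, hy, heq⟩ := h.equation
  have hmt := hy.memLp_t
  have hmxx := hy.memLp_xx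
  rw [restrict_prod_eq] at hmt heq hmxx
  have h1 := integral_mul_eq_add_integral hT hL.le hy.continuousOn (hmt.integrable one_le_two)
    (hy.deriv_t.mono fun x hx => hx.2) (continuous_mode L (j + 1)) ht
  -- subtract the contribution of `(x/L) u`
  have hsplit : ∀ s ∈ Icc 0 T, coeff L (j + 1) (shifted L u y s) =
      (∫ x in (0 : ℝ)..L, y s x * mode L (j + 1) x) -
        u s * coeff L (j + 1) (fun x => x / L) := by
    intro s hs
    rw [← coeff_const_mul]
    have h2 := coeff_sub hL (memLp_of_continuousOn (continuousOn_slice hy.continuousOn hs))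
      (memLp_of_continuousOn (g := fun x => u s * (x / L)) (by fun_prop)) (j + 1)
    rw [← coeff, ← h2]
    congr 1
    ext x; simp only [shifted]; ring
  have hrate : ∫ s in (0 : ℝ)..t, rate L f n K (u s) (shifted L u y s) j =
      (∫ s in (0 : ℝ)..t, ∫ x in (0 : ℝ)..L, yt s x * mode L (j + 1) x) -
        (∫ s in (0 : ℝ)..t, control L n K (u s) (shifted L u y s)) *
          coeff L (j + 1) (fun x => x / L) := by
    have hae : ∀ᵐ s ∂(intervalMeasure t), ∫ x in (0 : ℝ)..L, yt s x * mode L (j + 1) x =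
        rate L f n K (u s) (shifted L u y s) j +
          control L n K (u s) (shifted L u y s) * coeff L (j + 1) (fun x => x / L) := by
      have hsub : intervalMeasure t ≤ intervalMeasure T :=
        Measure.restrict_mono (Ioc_subset_Ioc_right ht.2) le_rfl
      have key : ∀ᵐ s ∂(intervalMeasure T), ∫ x in (0 : ℝ)..L, yt s x * mode L (j + 1) x =
        rate L f n K (u s) (shifted L u y s) j +
          control L n K (u s) (shifted L u y s) * coeff L (j + 1) (fun x => x / L) := by
        filter_upwards [hy.deriv_x, ae_restrict_mem measurableSet_Ioc,
          Measure.ae_ae_of_ae_prod heq] with s hs hmem heqs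
        have hsI := Ioc_subset_Icc_self hmem
        obtain ⟨hb0, hbL, hs1, hs2⟩ := h.shifted_hasL2Deriv hL hsI hs.1 hs.2
        have hc := coeff_second_deriv hL hb0 hbL hs1 hs2 j
        have hfm : MemLp (fun x => f (y s x)) 2 (intervalMeasure L) :=
          memLp_of_continuousOn (hf.comp_continuousOn (continuousOn_slice hy.continuousOn hsI))
        have hfc : coeff L (j + 1) (forcing L f n K (u s) (shifted L u y s)) =
            coeff L (j + 1) (fun x => f (y s x)) -
              control L n K (u s) (shifted L u y s) * coeff L (j + 1) (fun x => x / L) := by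
          rw [← coeff_const_mul, ← coeff_sub hL hfm
            (memLp_of_continuousOn (g := fun x => control L n K (u s) (shifted L u y s) * (x / L))
              (by fun_prop))]
          congr 1
          ext x
          simp only [forcing, shifted_add]; ring
        have he : ∫ x in (0 : ℝ)..L, yt s x * mode L (j + 1) x =
            coeff L (j + 1) (fun x => yxx s x + f (y s x)) := by
          unfold coeff
          rw [intervalIntegral.integral_of_le hL.le, intervalIntegral.integral_of_le hL.le]
          apply integral_congr_ae
          filter_upwards [heqs] with x hx
          rw [hx]
        rw [he, coeff_add hL hs.2.1 hfm, hc, rate, hfc]; ring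
      exact ae_mono hsub key
    have hI : ∫ s in (0 : ℝ)..t, ∫ x in (0 : ℝ)..L, yt s x * mode L (j + 1) x =
        ∫ s in (0 : ℝ)..t, (rate L f n K (u s) (shifted L u y s) j +
          control L n K (u s) (shifted L u y s) * coeff L (j + 1) (fun x => x / L)) := by
      rw [intervalIntegral.integral_of_le ht.1, intervalIntegral.integral_of_le ht.1]
      exact integral_congr_ae hae
    have hss : Icc 0 t ⊆ Icc 0 T := Icc_subset_Icc_right ht.2
    rw [hI, intervalIntegral.integral_add, intervalIntegral.integral_mul_const]
    · ring
    · apply ContinuousOn.intervalIntegrable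
      rw [uIcc_of_le ht.1]
      exact (h.continuousOn_rate hL hT hf j).mono hss
    · apply ContinuousOn.intervalIntegrable
      rw [uIcc_of_le ht.1]
      exact ((h.continuousOn_control hL hT).mono hss).mul continuousOn_const
  rw [hsplit t ht, hsplit 0 h0, h1, hrate, h.u_eq_integral hL t ht]
  ring

end Solution

/-! ### Termwise differentiation of weighted sums of squares -/

lemma sq_eq_add_integral {T : ℝ} {z D : ℝ → ℝ} (hD : ContinuousOn D (Icc 0 T))
    (hz : ∀ t ∈ Icc 0 T, z t = z 0 + ∫ s in (0 : ℝ)..t, D s) {t : ℝ} (ht : t ∈ Icc 0 T) :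
    z t ^ 2 = z 0 ^ 2 + ∫ s in (0 : ℝ)..t, 2 * (z s * D s) := by
  have hss : Icc 0 t ⊆ Icc 0 T := Icc_subset_Icc_right ht.2
  have hi : IntervalIntegrable D volume 0 t := by
    apply ContinuousOn.intervalIntegrable
    rw [uIcc_of_le ht.1]; exact hD.mono hss
  have h := mul_sub_mul_eq_integral ht.1 hi hi (fun x hx => hz x (hss hx))
    (fun x hx => hz x (hss hx))
  have h2 : ∀ s, D s * z s + z s * D s = 2 * (z s * D s) := fun s => by ring
  simp_rw [h2] at h
  rw [h]; ring

lemma continuousOn_of_eq_integral_of_continuousOn {T : ℝ} (hT : 0 ≤ T) {z D : ℝ → ℝ}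
    (hD : ContinuousOn D (Icc 0 T))
    (hz : ∀ t ∈ Icc 0 T, z t = z 0 + ∫ s in (0 : ℝ)..t, D s) : ContinuousOn z (Icc 0 T) := by
  refine continuousOn_of_eq_integral hT ?_ hz
  apply ContinuousOn.intervalIntegrable
  rwa [uIcc_of_le hT]

/-- The termwise bound behind the differentiation of `∑ m_j z_j²`: the derivative `2 m_j z_j z_j'` is
dominated by `(ν_j z_j)² + (z_j')²` as soon as `|m_j| ≤ A ν_j`. -/
lemma two_mul_mul_mul_le {ν m A z D : ℝ} (hm : |m| ≤ A * ν) (hA : 0 ≤ A) :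
    |2 * m * (z * D)| ≤ A * ((ν * z) ^ 2 + D ^ 2) := by
  have h1 : |2 * m * (z * D)| = 2 * |m| * (|z| * |D|) := by
    rw [abs_mul, abs_mul, abs_mul, abs_two]
  rw [h1]
  have h2 : 2 * |m| * (|z| * |D|) ≤ 2 * (A * ν) * (|z| * |D|) := by gcongr
  have h3 : 2 * (ν * |z|) * |D| ≤ (ν * |z|) ^ 2 + |D| ^ 2 := two_mul_le_add_sq _ _
  rw [mul_pow, sq_abs, sq_abs, ← mul_pow] at h3
  nlinarith [mul_le_mul_of_nonneg_left h3 hA]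

section Energy

variable {T : ℝ} {z D : ℕ → ℝ → ℝ} {ν : ℕ → ℝ} {W : ℝ → ℝ}

/-- If `∑ (ν_j z_j)²` and `∑ (z_j')²` are integrable, the functions `2 m_j z_j z_j'` are absolutely
summable in `L¹`, for weights `m_j` bounded by `A ν_j`. -/
lemma summable_integral_abs_mul (hT : 0 ≤ T) (hD : ∀ j, ContinuousOn (D j) (Icc 0 T))
    (hz : ∀ j, ∀ t ∈ Icc 0 T, z j t = z j 0 + ∫ s in (0 : ℝ)..t, D j s)
    (hW : Integrable W (intervalMeasure T))
    (hae : ∀ᵐ t ∂(intervalMeasure T), Summable (fun j => (ν j * z j t) ^ 2 + D j t ^ 2) ∧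
      ∑' j, ((ν j * z j t) ^ 2 + D j t ^ 2) ≤ W t)
    {m : ℕ → ℝ} {A : ℝ} (hA : 0 ≤ A) (hm : ∀ j, |m j| ≤ A * ν j) :
    Summable fun j => ∫ s, |2 * m j * (z j s * D j s)| ∂(intervalMeasure T) := by
  have hc : ∀ j, ContinuousOn (fun s => |2 * m j * (z j s * D j s)|) (Icc 0 T) := fun j =>
    (continuousOn_const.mul ((continuousOn_of_eq_integral_of_continuousOn hT (hD j) (hz j)).mul
      (hD j))).abs
  have hi : ∀ j, Integrable (fun s => |2 * m j * (z j s * D j s)|) (intervalMeasure T) := fun j =>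
    (memLp_of_continuousOn (hc j)).integrable one_le_two
  refine summable_of_sum_le (c := ∫ s, A * W s ∂(intervalMeasure T))
    (fun j => integral_nonneg fun s => abs_nonneg _) fun S => ?_
  rw [← integral_finsetSum _ fun j _ => hi j]
  refine integral_mono_ae (integrable_finsetSum _ fun j _ => hi j) (hW.const_mul A) ?_
  filter_upwards [hae] with s hs
  calc ∑ j ∈ S, |2 * m j * (z j s * D j s)|
      ≤ ∑ j ∈ S, A * ((ν j * z j s) ^ 2 + D j s ^ 2) :=
        Finset.sum_le_sum fun j _ => two_mul_mul_mul_le (hm j) hA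
    _ = A * ∑ j ∈ S, ((ν j * z j s) ^ 2 + D j s ^ 2) := by rw [Finset.mul_sum]
    _ ≤ A * W s := by
        gcongr
        exact (hs.1.sum_le_tsum S fun j _ => by positivity).trans hs.2

/-- Finiteness of the weighted sum of squares at all times: it holds at almost every time, and the
oscillation in time is controlled. -/
lemma summable_mul_sq (hT : 0 < T) (hD : ∀ j, ContinuousOn (D j) (Icc 0 T))
    (hz : ∀ j, ∀ t ∈ Icc 0 T, z j t = z j 0 + ∫ s in (0 : ℝ)..t, D j s)
    {ν₁ : ℝ} (hν₁ : 0 < ν₁) (hν : ∀ j, ν₁ ≤ ν j) (hW : Integrable W (intervalMeasure T))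
    (hae : ∀ᵐ t ∂(intervalMeasure T), Summable (fun j => (ν j * z j t) ^ 2 + D j t ^ 2) ∧
      ∑' j, ((ν j * z j t) ^ 2 + D j t ^ 2) ≤ W t) :
    ∀ t ∈ Icc 0 T, Summable fun j => ν j * z j t ^ 2 := by
  have hν0 : ∀ j, 0 ≤ ν j := fun j => hν₁.le.trans (hν j)
  have hsum := summable_integral_abs_mul hT.le hD hz hW hae zero_le_one
    (m := ν) (fun j => by rw [one_mul, abs_of_nonneg (hν0 j)])
  have hne : (ae (intervalMeasure T)).NeBot := by
    rw [ae_neBot, Ne, Measure.restrict_eq_zero]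
    simp [hT]
  obtain ⟨t₀, ht₀, ht₀m⟩ := (hae.and (ae_restrict_mem measurableSet_Ioc)).exists
  have ht₀I : t₀ ∈ Icc 0 T := Ioc_subset_Icc_self ht₀m
  have hs₀ : Summable fun j => ν j * z j t₀ ^ 2 := by
    refine Summable.of_nonneg_of_le (fun j => mul_nonneg (hν0 j) (sq_nonneg _)) (fun j => ?_)
      (ht₀.1.mul_left (1 / ν₁))
    have h1 : ν j * z j t₀ ^ 2 * ν₁ ≤ ν j * z j t₀ ^ 2 * ν j :=
      mul_le_mul_of_nonneg_left (hν j) (mul_nonneg (hν0 j) (sq_nonneg _))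
    rw [one_div, inv_mul_eq_div, le_div_iff₀ hν₁]
    nlinarith [sq_nonneg (D j t₀)]
  have hq : ∀ j, ContinuousOn (fun s => 2 * ν j * (z j s * D j s)) (Icc 0 T) := fun j =>
    continuousOn_const.mul ((continuousOn_of_eq_integral_of_continuousOn hT.le (hD j) (hz j)).mul
      (hD j))
  have hbound : ∀ j, ∀ t ∈ Icc 0 T, |ν j * z j t ^ 2 - ν j * z j 0 ^ 2| ≤
      ∫ s, |2 * ν j * (z j s * D j s)| ∂(intervalMeasure T) := by
    intro j t ht
    rw [← mul_sub, sq_eq_add_integral (hD j) (hz j) ht, add_sub_cancel_left,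
      ← intervalIntegral.integral_const_mul, intervalIntegral.integral_of_le ht.1]
    have h1 : ∀ s, ν j * (2 * (z j s * D j s)) = 2 * ν j * (z j s * D j s) := fun s => by ring
    simp_rw [h1]
    refine (abs_integral_le_integral_abs).trans ?_
    refine setIntegral_mono_set ((memLp_of_continuousOn (hq j).abs).integrable one_le_two)
      (Eventually.of_forall fun s => abs_nonneg _) ?_
    exact (Ioc_subset_Ioc_right ht.2).eventuallyLE
  intro t ht
  refine Summable.of_nonneg_of_le (fun j => mul_nonneg (hν0 j) (sq_nonneg _)) (fun j => ?_)
    (hs₀.add (hsum.mul_left 2))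
  have h1 := abs_le.1 (hbound j t ht)
  have h2 := abs_le.1 (hbound j t₀ ht₀I)
  linarith [h1.2, h2.1]

/-- The fundamental theorem of calculus for `∑ m_j z_j²`. -/
lemma tsum_mul_sq_eq_add_integral (hT : 0 < T) (hD : ∀ j, ContinuousOn (D j) (Icc 0 T))
    (hz : ∀ j, ∀ t ∈ Icc 0 T, z j t = z j 0 + ∫ s in (0 : ℝ)..t, D j s)
    {ν₁ : ℝ} (hν₁ : 0 < ν₁) (hν : ∀ j, ν₁ ≤ ν j) (hW : Integrable W (intervalMeasure T))
    (hae : ∀ᵐ t ∂(intervalMeasure T), Summable (fun j => (ν j * z j t) ^ 2 + D j t ^ 2) ∧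
      ∑' j, ((ν j * z j t) ^ 2 + D j t ^ 2) ≤ W t)
    {m : ℕ → ℝ} {A : ℝ} (hA : 0 ≤ A) (hm : ∀ j, |m j| ≤ A * ν j) :
    IntervalIntegrable (fun s => ∑' j, 2 * m j * (z j s * D j s)) volume 0 T ∧
      ∀ t ∈ Icc 0 T, ∑' j, m j * z j t ^ 2 = (∑' j, m j * z j 0 ^ 2) +
        ∫ s in (0 : ℝ)..t, ∑' j, 2 * m j * (z j s * D j s) := by
  have hsum := summable_integral_abs_mul hT.le hD hz hW hae hA hm
  have hsq := summable_mul_sq hT hD hz hν₁ hν hW hae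
  have hsqm : ∀ t ∈ Icc 0 T, Summable fun j => m j * z j t ^ 2 := by
    intro t ht
    refine Summable.of_norm_bounded ((hsq t ht).mul_left A) fun j => ?_
    rw [Real.norm_eq_abs, abs_mul, abs_of_nonneg (sq_nonneg (z j t)), ← mul_assoc]
    exact mul_le_mul_of_nonneg_right (hm j) (sq_nonneg _)
  have hq : ∀ j, ContinuousOn (fun s => 2 * m j * (z j s * D j s)) (Icc 0 T) := fun j =>
    continuousOn_const.mul ((continuousOn_of_eq_integral_of_continuousOn hT.le (hD j) (hz j)).mul
      (hD j))
  have hqi : ∀ j, Integrable (fun s => 2 * m j * (z j s * D j s)) (intervalMeasure T) := fun j =>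
    (memLp_of_continuousOn (hq j)).integrable one_le_two
  have hqs : ∀ᵐ s ∂(intervalMeasure T), Summable (fun j => 2 * m j * (z j s * D j s)) ∧
      |∑' j, 2 * m j * (z j s * D j s)| ≤ A * W s := by
    filter_upwards [hae] with s hs
    have h1 : Summable fun j => ‖2 * m j * (z j s * D j s)‖ :=
      Summable.of_nonneg_of_le (fun j => norm_nonneg _)
        (fun j => two_mul_mul_mul_le (hm j) hA) (hs.1.mul_left A)
    refine ⟨h1.of_norm, (norm_tsum_le_tsum_norm h1).trans ?_⟩
    refine (h1.tsum_le_tsum (fun j => two_mul_mul_mul_le (hm j) hA)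
      (hs.1.mul_left A)).trans ?_
    rw [tsum_mul_left]
    exact mul_le_mul_of_nonneg_left hs.2 hA
  constructor
  · rw [intervalIntegrable_iff_integrableOn_Ioc_of_le hT.le]
    refine Integrable.mono' (hW.const_mul A) ?_ (hqs.mono fun s hs => hs.2)
    refine aestronglyMeasurable_of_tendsto_ae atTop
      (f := fun N s => ∑ j ∈ Finset.range N, 2 * m j * (z j s * D j s)) (fun N => ?_) ?_
    · exact (integrable_finsetSum _ fun j _ => hqi j).aestronglyMeasurable
    · filter_upwards [hqs] with s hs
      exact hs.1.hasSum.tendsto_sum_nat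
  · intro t ht
    have h0 : (0 : ℝ) ∈ Icc 0 T := left_mem_Icc.2 hT.le
    have hsub : intervalMeasure t ≤ intervalMeasure T :=
      Measure.restrict_mono (Ioc_subset_Ioc_right ht.2) le_rfl
    have h1 : Summable fun j => ∫ s, ‖2 * m j * (z j s * D j s)‖ ∂(intervalMeasure t) := by
      refine Summable.of_nonneg_of_le (fun j => integral_nonneg fun s => norm_nonneg _)
        (fun j => ?_) hsum
      exact setIntegral_mono_set (hqi j).abs (Eventually.of_forall fun s => abs_nonneg _)
        (Ioc_subset_Ioc_right ht.2).eventuallyLE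
    have h2 := hasSum_integral_of_summable_integral_norm
      (fun j => (hqi j).mono_measure hsub) h1
    rw [intervalIntegral.integral_of_le ht.1]
    refine HasSum.tsum_eq ?_
    refine ((hsqm 0 h0).hasSum.add h2).congr_fun fun j => ?_
    rw [← intervalIntegral.integral_of_le ht.1, sq_eq_add_integral (hD j) (hz j) ht, mul_add,
      ← intervalIntegral.integral_const_mul]
    congr 2
    ext s; ring

end Energy

/-! ### Solutions stay in `H¹₀` -/

section Solution

variable {L T : ℝ} {f : ℝ → ℝ} {n : ℕ} {K : Fin (n + 1) → ℝ} {u : ℝ → ℝ} {y : ℝ → ℝ → ℝ}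

lemma summable_sq_add_sq {a b : ℕ → ℝ} (ha : Summable fun j => a j ^ 2)
    (hb : Summable fun j => b j ^ 2) : Summable (fun j => (a j + b j) ^ 2) ∧
      ∑' j, (a j + b j) ^ 2 ≤ 2 * ∑' j, a j ^ 2 + 2 * ∑' j, b j ^ 2 := by
  have hle : ∀ j, (a j + b j) ^ 2 ≤ 2 * a j ^ 2 + 2 * b j ^ 2 := fun j => by
    nlinarith [sq_nonneg (a j - b j)]
  have h2 := (ha.mul_left 2).add (hb.mul_left 2)
  have h1 := Summable.of_nonneg_of_le (fun j => sq_nonneg _) hle h2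
  refine ⟨h1, (h1.tsum_le_tsum hle h2).trans ?_⟩
  rw [(ha.mul_left 2).tsum_add (hb.mul_left 2), tsum_mul_left, tsum_mul_left]

/-- Along a solution `∑ ((jπ/L)² z_j)²` and `∑ (z_j')²` are finite at almost every time, with an
integrable bound: they are the squared `L²` norms of `z_xx` and of `z_t`. -/
lemma IsSolution.exists_integrable_bound (hL : 0 < L) (hT : 0 < T) (hf : Continuous f)
    (h : IsSolution L f n K T u y) :
    ∃ W : ℝ → ℝ, Integrable W (intervalMeasure T) ∧
      ∀ᵐ t ∂(intervalMeasure T), Summable (fun j =>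
        (freq L (j + 1) ^ 2 * coeff L (j + 1) (shifted L u y t)) ^ 2 +
          rate L f n K (u t) (shifted L u y t) j ^ 2) ∧
        ∑' j, ((freq L (j + 1) ^ 2 * coeff L (j + 1) (shifted L u y t)) ^ 2 +
          rate L f n K (u t) (shifted L u y t) j ^ 2) ≤ W t := by
  obtain ⟨W, hW, hae⟩ := h.ae_shifted_hasL2Deriv hL
  have hFc := h.continuousOn_forcing_prod hL hT.le hf
  have hIc : ContinuousOn (fun t => ∫ x in (0 : ℝ)..L,
      forcing L f n K (u t) (shifted L u y t) x ^ 2) (Icc 0 T) :=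
    continuousOn_integral_of_continuousOn_prod hT.le hL.le (hFc.pow 2)
  refine ⟨fun t => W t + (2 * W t + 2 * ∫ x in (0 : ℝ)..L,
      forcing L f n K (u t) (shifted L u y t) x ^ 2),
    hW.add ((hW.const_mul 2).add
      (((memLp_of_continuousOn hIc).integrable one_le_two).const_mul 2)), ?_⟩
  filter_upwards [hae, ae_restrict_mem measurableSet_Ioc] with t ht hmem
  have hF := hasSum_coeff_sq hL
    (memLp_of_continuousOn (continuousOn_slice
      (G := fun t x => forcing L f n K (u t) (shifted L u y t) x) hFc (Ioc_subset_Icc_self hmem)))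
  have h2 := summable_sq_add_sq
    (a := fun j => -(freq L (j + 1) ^ 2 * coeff L (j + 1) (shifted L u y t)))
    (by simpa only [neg_sq] using ht.1) hF.summable
  simp only [neg_sq] at h2
  rw [hF.tsum_eq] at h2
  refine ⟨ht.1.add h2.1, ?_⟩
  have h3 := Summable.tsum_add ht.1 h2.1
  simp only [rate]
  rw [h3]
  have h4 := h2.2
  have h5 := ht.2
  linarith

lemma freq_one_sq_pos {L : ℝ} (hL : 0 < L) : 0 < freq L 1 ^ 2 := pow_pos (freq_pos hL 0) 2

/-- The regularity class `Y_T` embeds into the continuous functions with values in `H¹`. -/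
theorem IsSolution.memH10 (hL : 0 < L) (hT : 0 < T) (hf : Continuous f)
    (h : IsSolution L f n K T u y) : ∀ t ∈ Icc 0 T, MemH10 L (shifted L u y t) := by
  obtain ⟨W, hW, hae⟩ := h.exists_integrable_bound hL hT hf
  intro t ht
  have hs := summable_mul_sq (z := fun j t => coeff L (j + 1) (shifted L u y t)) hT
    (fun j => h.continuousOn_rate hL hT.le hf j) (fun j => h.coeff_eq_integral hL hf j)
    (ν := fun j => freq L (j + 1) ^ 2) (freq_one_sq_pos hL) (one_le_freq_ratio hL) hW hae t ht
  exact memH10_of_summable hL (by simp [shifted, h.boundary_zero t ht])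
    (by simp [shifted, h.boundary_L t ht, div_self hL.ne']) (h.continuousOn_shifted_slice ht) hs

lemma abs_eigenvalue_le {L : ℝ} (hL : 0 < L) (c : ℝ) (j : ℕ) :
    |eigenvalue L c (j + 1)| ≤ (1 + |c| / freq L 1 ^ 2) * freq L (j + 1) ^ 2 := by
  have h1 := freq_one_sq_pos hL
  have h2 := one_le_freq_ratio hL j
  have h3 : |c| ≤ |c| / freq L 1 ^ 2 * freq L (j + 1) ^ 2 := by
    rw [div_mul_eq_mul_div, le_div_iff₀ h1]
    exact mul_le_mul_of_nonneg_left h2 (abs_nonneg c)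
  rw [eigenvalue_eq]
  calc |c - freq L (j + 1) ^ 2| ≤ |c| + |freq L (j + 1) ^ 2| := abs_sub _ _
    _ = |c| + freq L (j + 1) ^ 2 := by rw [abs_of_nonneg (sq_nonneg (freq L (j + 1)))]
    _ ≤ _ := by linarith

/-- The function `∑ λ_j z_j²` is absolutely continuous along solutions. -/
theorem IsSolution.tsum_eigenvalue_eq_integral (hL : 0 < L) (hT : 0 < T) (hf : Continuous f)
    (h : IsSolution L f n K T u y) (c : ℝ) :
    IntervalIntegrable (fun s => ∑' j, 2 * eigenvalue L c (j + 1) *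
        (coeff L (j + 1) (shifted L u y s) * rate L f n K (u s) (shifted L u y s) j)) volume 0 T ∧
      ∀ t ∈ Icc 0 T, ∑' j, eigenvalue L c (j + 1) * coeff L (j + 1) (shifted L u y t) ^ 2 =
        (∑' j, eigenvalue L c (j + 1) * coeff L (j + 1) (shifted L u y 0) ^ 2) +
        ∫ s in (0 : ℝ)..t, ∑' j, 2 * eigenvalue L c (j + 1) *
          (coeff L (j + 1) (shifted L u y s) * rate L f n K (u s) (shifted L u y s) j) := by
  obtain ⟨W, hW, hae⟩ := h.exists_integrable_bound hL hT hf
  exact tsum_mul_sq_eq_add_integral (z := fun j t => coeff L (j + 1) (shifted L u y t)) hT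
    (fun j => h.continuousOn_rate hL hT.le hf j) (fun j => h.coeff_eq_integral hL hf j)
    (ν := fun j => freq L (j + 1) ^ 2) (freq_one_sq_pos hL) (one_le_freq_ratio hL) hW hae
    (A := 1 + |c| / freq L 1 ^ 2) (by positivity) (abs_eigenvalue_le hL c)

end Solution

/-! ### Elementary estimates in the state space -/

/-- `f(y) = c y + O(y²)`, locally uniformly. -/
def HasQuadraticRemainder (f : ℝ → ℝ) (c : ℝ) : Prop :=
  ∀ B > 0, ∃ M ≥ 0, ∀ y, |y| ≤ B → |f y - c * y| ≤ M * y ^ 2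

lemma stateNorm_nonneg (L u : ℝ) (w : ℝ → ℝ) : 0 ≤ stateNorm L u w := Real.sqrt_nonneg _

lemma stateNorm_sq (L u : ℝ) (w : ℝ → ℝ) : stateNorm L u w ^ 2 = u ^ 2 + h10Norm L w ^ 2 :=
  Real.sq_sqrt (by positivity)

lemma abs_le_stateNorm (L u : ℝ) (w : ℝ → ℝ) : |u| ≤ stateNorm L u w := by
  rw [← Real.sqrt_sq_eq_abs]
  exact Real.sqrt_le_sqrt (le_add_of_nonneg_right (sq_nonneg _))

lemma h10Norm_le_stateNorm (L u : ℝ) (w : ℝ → ℝ) : h10Norm L w ≤ stateNorm L u w :=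
  Real.le_sqrt_of_sq_le (le_add_of_nonneg_left (sq_nonneg _))

/-- The embedding of `H¹₀` into the continuous functions. -/
lemma abs_le_sqrt_mul_h10Norm {L : ℝ} (hL : 0 < L) {w : ℝ → ℝ} (hw : MemH10 L w) {x : ℝ}
    (hx : x ∈ Icc 0 L) : |w x| ≤ Real.sqrt L * h10Norm L w := by
  obtain ⟨h0, -, g, hg⟩ := hw
  have hn : 0 ≤ h10Norm L w := Real.sqrt_nonneg _
  rcases hx.1.eq_or_lt with rfl | hx0
  · rw [h0, abs_zero]; positivity
  have hwx := hg.2 x hx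
  rw [h0, zero_add] at hwx
  have hsub : intervalMeasure x ≤ intervalMeasure L :=
    Measure.restrict_mono (Ioc_subset_Ioc_right hx.2) le_rfl
  have hgx : MemLp g 2 (intervalMeasure x) := hg.1.mono_measure hsub
  have hgi := intervalIntegrable_of_memLp hx0.le hgx
  have hg2 : IntervalIntegrable (fun s => g s ^ 2) volume 0 x := by
    rw [intervalIntegrable_iff_integrableOn_Ioc_of_le hx0.le]
    exact hgx.integrable_sq
  -- the variance of `g` over `(0, x)` is nonnegative
  have hvar : 0 ≤ ∫ s in (0 : ℝ)..x, (g s - w x / x) ^ 2 :=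
    intervalIntegral.integral_nonneg hx0.le fun _ _ => sq_nonneg _
  have e : ∀ s, (g s - w x / x) ^ 2 = g s ^ 2 - 2 * (w x / x) * g s + (w x / x) ^ 2 :=
    fun s => by ring
  simp_rw [e] at hvar
  rw [intervalIntegral.integral_add (hg2.sub (hgi.const_mul _)) (by simp),
    intervalIntegral.integral_sub hg2 (hgi.const_mul _), intervalIntegral.integral_const_mul,
    ← hwx, intervalIntegral.integral_const, sub_zero, smul_eq_mul] at hvar
  have hle : ∫ s in (0 : ℝ)..x, g s ^ 2 ≤ h10Norm L w ^ 2 := by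
    rw [h10Norm_sq_eq hL hg, intervalIntegral.integral_of_le hx0.le,
      intervalIntegral.integral_of_le hL.le]
    exact integral_mono_measure hsub (Eventually.of_forall fun s => sq_nonneg _)
      hg.1.integrable_sq
  have h2 : w x ^ 2 ≤ L * h10Norm L w ^ 2 := by
    have e2 : 2 * (w x / x) * w x - x * (w x / x) ^ 2 = w x ^ 2 / x := by field_simp; ring
    have h3 : w x ^ 2 / x ≤ h10Norm L w ^ 2 := by linarith
    rw [div_le_iff₀ hx0] at h3
    have := mul_le_mul_of_nonneg_left hx.2 (sq_nonneg (h10Norm L w))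
    linarith
  rw [← Real.sqrt_sq hn, ← Real.sqrt_mul hL.le]
  exact Real.abs_le_sqrt h2

lemma abs_le_mul_stateNorm {L : ℝ} (hL : 0 < L) (u : ℝ) {w : ℝ → ℝ} (hw : MemH10 L w) {x : ℝ}
    (hx : x ∈ Icc 0 L) : |w x| ≤ Real.sqrt L * stateNorm L u w :=
  (abs_le_sqrt_mul_h10Norm hL hw hx).trans
    (mul_le_mul_of_nonneg_left (h10Norm_le_stateNorm L u w) (Real.sqrt_nonneg _))

lemma abs_div_mul_le {L : ℝ} (hL : 0 < L) (u : ℝ) {x : ℝ} (hx : x ∈ Icc 0 L) :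
    |x / L * u| ≤ |u| := by
  rw [abs_mul, abs_of_nonneg (div_nonneg hx.1 hL.le)]
  exact mul_le_of_le_one_left (abs_nonneg u) ((div_le_one hL).2 hx.2)

lemma abs_add_le_mul_stateNorm {L : ℝ} (hL : 0 < L) (u : ℝ) {w : ℝ → ℝ} (hw : MemH10 L w)
    {x : ℝ} (hx : x ∈ Icc 0 L) : |w x + x / L * u| ≤ (1 + Real.sqrt L) * stateNorm L u w := by
  have h1 := abs_le_mul_stateNorm hL u hw hx
  have h2 := (abs_div_mul_le hL u hx).trans (abs_le_stateNorm L u w)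
  linarith [abs_add_le (w x) (x / L * u)]

lemma tsum_coeff_sq_le {L : ℝ} (hL : 0 < L) {w : ℝ → ℝ} (hw : MemH10 L w) :
    ∑' j, coeff L (j + 1) w ^ 2 ≤ h10Norm L w ^ 2 / freq L 1 ^ 2 := by
  have h1 := hasSum_h10Norm_sq hL hw
  have h2 := (hasSum_coeff_sq hL (memLp_of_continuousOn (continuousOn_of_memH10 hL hw))).summable
  rw [le_div_iff₀ (freq_one_sq_pos hL), ← tsum_mul_right, ← h1.tsum_eq]
  refine Summable.tsum_le_tsum (fun j => ?_) (h2.mul_right _) h1.summable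
  rw [mul_comm]
  exact mul_le_mul_of_nonneg_right (one_le_freq_ratio hL j) (sq_nonneg _)

lemma stateVec_dotProduct_self (L : ℝ) (n : ℕ) (u : ℝ) (w : ℝ → ℝ) :
    stateVec L n u w ⬝ᵥ stateVec L n u w =
      u ^ 2 + ∑ j ∈ Finset.range n, coeff L (j + 1) w ^ 2 := by
  rw [dotProduct, Fin.sum_univ_succ, Finset.sum_range]
  simp [stateVec, sq]

lemma stateVec_dotProduct_self_le {L : ℝ} (n : ℕ) (u : ℝ) {w : ℝ → ℝ}
    (hs : Summable fun j => coeff L (j + 1) w ^ 2) :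
    stateVec L n u w ⬝ᵥ stateVec L n u w ≤ u ^ 2 + ∑' j, coeff L (j + 1) w ^ 2 := by
  rw [stateVec_dotProduct_self]
  have := hs.sum_le_tsum (Finset.range n) fun j _ => sq_nonneg (coeff L (j + 1) w)
  linarith

lemma stateVec_dotProduct_self_le_stateNorm {L : ℝ} (hL : 0 < L) (n : ℕ) (u : ℝ) {w : ℝ → ℝ}
    (hw : MemH10 L w) :
    stateVec L n u w ⬝ᵥ stateVec L n u w ≤ (1 + 1 / freq L 1 ^ 2) * stateNorm L u w ^ 2 := by
  have h1 := stateVec_dotProduct_self_le (L := L) n u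
    (hasSum_coeff_sq hL (memLp_of_continuousOn (continuousOn_of_memH10 hL hw))).summable
  have h2 := tsum_coeff_sq_le hL hw
  have h3 := freq_one_sq_pos hL
  rw [stateNorm_sq]
  have h4 : h10Norm L w ^ 2 / freq L 1 ^ 2 = 1 / freq L 1 ^ 2 * h10Norm L w ^ 2 := by ring
  have h5 : 0 ≤ 1 / freq L 1 ^ 2 * u ^ 2 := by positivity
  nlinarith [sq_nonneg (h10Norm L w)]

/-! ### The Lyapunov function is equivalent to the squared norm -/

lemma tsum_ite_lt (n : ℕ) (a : ℕ → ℝ) :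
    HasSum (fun j => if j < n then a j else 0) (∑ j ∈ Finset.range n, a j) := by
  rw [Finset.sum_congr rfl fun j hj =>
    (if_pos (Finset.mem_range.1 hj) : (if j < n then a j else 0) = a j).symm]
  exact hasSum_sum_of_ne_finset_zero fun j hj => if_neg fun h => hj (Finset.mem_range.2 h)

lemma eigenvalue_antitone {L : ℝ} (hL : 0 < L) (c : ℝ) {i j : ℕ} (h : i ≤ j) :
    eigenvalue L c (j + 1) ≤ eigenvalue L c (i + 1) :=
  (isDirichletEigenbasis_mode hL c).strictAnti.antitone h

/-- Modes beyond `n` are uniformly stable relative to `(jπ/L)²`. -/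
lemma exists_mul_freq_sq_le {L : ℝ} (hL : 0 < L) (c : ℝ) {n : ℕ}
    (hn : eigenvalue L c (n + 1) < 0) :
    ∃ θ > 0, θ ≤ 1 ∧ ∀ j, n ≤ j → θ * freq L (j + 1) ^ 2 ≤ -eigenvalue L c (j + 1) := by
  have hν : 0 < freq L (n + 1) ^ 2 := pow_pos (freq_pos hL n) 2
  have hlam : eigenvalue L c (n + 1) = c - freq L (n + 1) ^ 2 := rfl
  refine ⟨min 1 (-eigenvalue L c (n + 1) / freq L (n + 1) ^ 2), lt_min one_pos (by
    apply div_pos _ hν; linarith), min_le_left _ _, fun j hj => ?_⟩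
  have hmono : freq L (n + 1) ^ 2 ≤ freq L (j + 1) ^ 2 := by
    have := (freq_strictMono hL).monotone (show n + 1 ≤ j + 1 by omega)
    have h2 := freq_nonneg hL (n + 1)
    gcongr
  rw [eigenvalue_eq L c (j + 1)]
  rcases le_total c 0 with hc | hc
  · have := mul_le_mul_of_nonneg_right
      (min_le_left 1 (-eigenvalue L c (n + 1) / freq L (n + 1) ^ 2)) (sq_nonneg (freq L (j + 1)))
    linarith
  · have h1 := mul_le_mul_of_nonneg_right
      (min_le_right 1 (-eigenvalue L c (n + 1) / freq L (n + 1) ^ 2)) (sq_nonneg (freq L (j + 1)))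
    refine h1.trans ?_
    rw [div_mul_eq_mul_div, div_le_iff₀ hν, hlam]
    nlinarith

section Lyapunov

variable {L c : ℝ} {n : ℕ} {P : Matrix (Fin (n + 1)) (Fin (n + 1)) ℝ}

/-- The upper bound for `V`: every `|λ_j|` is at most a multiple of `(jπ/L)²`. -/
lemma lyapV_le (hL : 0 < L) {p γ : ℝ} (hγ : 0 ≤ γ) (hp : ∀ X : Fin (n + 1) → ℝ,
    X ⬝ᵥ P *ᵥ X ≤ p * (X ⬝ᵥ X)) (hp0 : 0 ≤ p) (u : ℝ) {w : ℝ → ℝ} (hw : MemH10 L w) :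
    lyapV L c n P γ u w ≤ (γ * p * (1 + 1 / freq L 1 ^ 2) + (1 + |c| / freq L 1 ^ 2)) *
      stateNorm L u w ^ 2 := by
  have h1 := mul_le_mul_of_nonneg_left ((hp (stateVec L n u w)).trans
    (mul_le_mul_of_nonneg_left (stateVec_dotProduct_self_le_stateNorm hL n u hw) hp0)) hγ
  have hH := hasSum_h10Norm_sq hL hw
  have hB : 0 ≤ 1 + |c| / freq L 1 ^ 2 := by positivity
  have h2 : -∑' j, eigenvalue L c (j + 1) * coeff L (j + 1) w ^ 2 ≤
      (1 + |c| / freq L 1 ^ 2) * h10Norm L w ^ 2 := by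
    rw [← tsum_neg, ← hH.tsum_eq, ← tsum_mul_left]
    refine Summable.tsum_le_tsum (fun j => ?_)
      (summable_eigenvalue_mul_coeff_sq hL c hw).neg (hH.summable.mul_left _)
    rw [← neg_mul, ← mul_assoc]
    exact mul_le_mul_of_nonneg_right ((neg_le_abs _).trans (abs_eigenvalue_le hL c j))
      (sq_nonneg _)
  have h3 : (1 + |c| / freq L 1 ^ 2) * h10Norm L w ^ 2 ≤
      (1 + |c| / freq L 1 ^ 2) * stateNorm L u w ^ 2 := by
    gcongr
    · exact Real.sqrt_nonneg _
    · exact h10Norm_le_stateNorm L u w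
  have h4 : 0 ≤ (1 + |c| / freq L 1 ^ 2) * h10Norm L w ^ 2 := by positivity
  unfold lyapV
  nlinarith

/-- Coercivity of `V`. The finitely many modes `j ≤ n`, for which `λ_j` may be positive, and the
variable `u` are controlled by `γ Xᵀ P X` as soon as `γ q` is at least `(1 + |c|) / 2`. -/
lemma le_lyapV (hL : 0 < L) {q θ γ : ℝ} (hγ : 0 ≤ γ) (hq : ∀ X : Fin (n + 1) → ℝ,
    q * (X ⬝ᵥ X) ≤ X ⬝ᵥ P *ᵥ X) (hθ1 : θ ≤ 1)
    (hθ : ∀ j, n ≤ j → θ * freq L (j + 1) ^ 2 ≤ -eigenvalue L c (j + 1))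
    (hγq : (1 + |c|) / 2 ≤ γ * q) (u : ℝ) {w : ℝ → ℝ} (hw : MemH10 L w) :
    θ / 2 * stateNorm L u w ^ 2 ≤ lyapV L c n P γ u w := by
  have h1 := mul_le_mul_of_nonneg_left (hq (stateVec L n u w)) hγ
  have hH := hasSum_h10Norm_sq hL hw
  have hfin := tsum_ite_lt n fun j => |c| * coeff L (j + 1) w ^ 2
  have h2 : θ * h10Norm L w ^ 2 ≤ -(∑' j, eigenvalue L c (j + 1) * coeff L (j + 1) w ^ 2) +
      |c| * ∑ j ∈ Finset.range n, coeff L (j + 1) w ^ 2 := by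
    rw [Finset.mul_sum, ← hfin.tsum_eq, ← tsum_neg, ← hH.tsum_eq, ← tsum_mul_left,
      ← (summable_eigenvalue_mul_coeff_sq hL c hw).neg.tsum_add hfin.summable]
    refine Summable.tsum_le_tsum (fun j => ?_) (hH.summable.mul_left _)
      ((summable_eigenvalue_mul_coeff_sq hL c hw).neg.add hfin.summable)
    have hsq := sq_nonneg (coeff L (j + 1) w)
    split_ifs with hj
    · have : θ * freq L (j + 1) ^ 2 ≤ -eigenvalue L c (j + 1) + |c| := by
        rw [eigenvalue_eq]
        nlinarith [sq_nonneg (freq L (j + 1)), neg_abs_le c, le_abs_self c]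
      nlinarith
    · have := hθ j (not_lt.1 hj)
      nlinarith
  have hX := stateVec_dotProduct_self L n u w
  have hS : 0 ≤ ∑ j ∈ Finset.range n, coeff L (j + 1) w ^ 2 :=
    Finset.sum_nonneg fun j _ => sq_nonneg _
  have h3 : (1 + |c|) / 2 * (stateVec L n u w ⬝ᵥ stateVec L n u w) ≤
      γ * q * (stateVec L n u w ⬝ᵥ stateVec L n u w) :=
    mul_le_mul_of_nonneg_right hγq (dotProduct_self_nonneg' _)
  rw [stateNorm_sq]
  unfold lyapV
  have h4 : θ * u ^ 2 ≤ u ^ 2 := mul_le_of_le_one_left (sq_nonneg u) hθ1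
  have h5 : 0 ≤ |c| * u ^ 2 := by positivity
  rw [hX] at h1 h3
  nlinarith

/-! ### Decay of the Lyapunov function -/

variable {f : ℝ → ℝ} {K : Fin (n + 1) → ℝ}

/-- The nonlinear remainder `f(y) - c y` at `y = w + (x/L) u`. -/
def remainder (L : ℝ) (f : ℝ → ℝ) (c u : ℝ) (w : ℝ → ℝ) (x : ℝ) : ℝ :=
  f (w x + x / L * u) - c * (w x + x / L * u)

lemma continuousOn_remainder (hf : Continuous f) (c u : ℝ) {w : ℝ → ℝ}
    (hw : ContinuousOn w (Icc 0 L)) : ContinuousOn (remainder L f c u w) (Icc 0 L) := by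
  unfold remainder
  exact (hf.comp_continuousOn (hw.add (by fun_prop))).sub
    (continuousOn_const.mul (hw.add (by fun_prop)))

/-- The rate of change of a mode: diagonal part, effect of the control, and remainder. -/
lemma rate_eq (hL : 0 < L) (hf : Continuous f) (c u : ℝ) {w : ℝ → ℝ}
    (hw : ContinuousOn w (Icc 0 L)) (j : ℕ) :
    rate L f n K u w j = eigenvalue L c (j + 1) * coeff L (j + 1) w +
      coeff L (j + 1) (fun x => remainder L f c u w x + (c * u - control L n K u w) * (x / L)) := by
  have h1 : forcing L f n K u w = fun x => c * w x +
      (remainder L f c u w x + (c * u - control L n K u w) * (x / L)) := by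
    ext x; unfold forcing remainder; ring
  unfold rate
  rw [h1, coeff_add hL (v := fun x => c * w x)
    (w := fun x => remainder L f c u w x + (c * u - control L n K u w) * (x / L))
    (memLp_of_continuousOn (continuousOn_const.mul hw))
    (memLp_of_continuousOn ((continuousOn_remainder hf c u hw).add (by fun_prop))),
    coeff_const_mul, eigenvalue_eq]
  ring

/-- The rate of change of `X_n = (u, z_1, …, z_n)`. -/
def stateRate (L : ℝ) (f : ℝ → ℝ) (n : ℕ) (K : Fin (n + 1) → ℝ) (u : ℝ) (w : ℝ → ℝ) :
    Fin (n + 1) → ℝ :=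
  Fin.cons (control L n K u w) (fun i : Fin n => rate L f n K u w i)

/-- The remainder seen by the finite-dimensional part. -/
def stateRemainder (L : ℝ) (f : ℝ → ℝ) (c : ℝ) (n : ℕ) (u : ℝ) (w : ℝ → ℝ) :
    Fin (n + 1) → ℝ :=
  stateVec L n 0 (remainder L f c u w)

/-- The finite-dimensional part of the closed loop: `X_n' = (A_n + B_n K) X_n` up to the nonlinear
remainder. -/
lemma stateRate_eq (hL : 0 < L) (hf : Continuous f) (c u : ℝ) {w : ℝ → ℝ}
    (hw : ContinuousOn w (Icc 0 L)) :
    stateRate L f n K u w = closedLoopMat L c n K *ᵥ stateVec L n u w +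
      stateRemainder L f c n u w := by
  ext i
  rw [closedLoopMat, Matrix.add_mulVec, Matrix.vecMulVec_mulVec]
  refine Fin.cases ?_ (fun i => ?_) i
  · simp [stateRate, stateRemainder, stateVec, control, matA, vecB, Matrix.mulVec, dotProduct,
      Fin.sum_univ_succ]
  · have h1 : (matA L c n *ᵥ stateVec L n u w) i.succ =
        aCoeff L c (i + 1) * u + eigenvalue L c (i + 1) * coeff L (i + 1) w := by
      simp [matA, stateVec, Matrix.mulVec, dotProduct, Fin.sum_univ_succ]
    have h2 : coeff L (i + 1) (fun x => remainder L f c u w x +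
        (c * u - control L n K u w) * (x / L)) = coeff L (i + 1) (remainder L f c u w) +
          (c * u - control L n K u w) * coeff L (i + 1) (fun x => x / L) := by
      rw [coeff_add hL (memLp_of_continuousOn (continuousOn_remainder hf c u hw))
        (memLp_of_continuousOn (by fun_prop)), coeff_const_mul]
    have h3 : stateRate L f n K u w i.succ = rate L f n K u w i := rfl
    have h4 : stateRemainder L f c n u w i.succ = coeff L (i + 1) (remainder L f c u w) := rfl
    have h5 : vecB L n i.succ = -coeff L (i + 1) (fun x => x / L) := bCoeff_eq _
    have h6 : K ⬝ᵥ stateVec L n u w = control L n K u w := rfl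
    simp only [Pi.add_apply, h1, Pi.smul_apply, h3, h4, h5, rate_eq hL hf c u hw, h2, aCoeff_eq,
      h6, MulOpposite.smul_eq_mul_unop, MulOpposite.unop_op]
    ring

lemma control_sq_le (u : ℝ) (w : ℝ → ℝ) :
    control L n K u w ^ 2 ≤ (K ⬝ᵥ K) * (stateVec L n u w ⬝ᵥ stateVec L n u w) := by
  have := Finset.sum_mul_sq_le_sq_mul_sq Finset.univ K (stateVec L n u w)
  simpa [control, dotProduct, sq] using this

/-- The terms by which the equation of `z` differs from `z_t = A z` are, up to the nonlinear
remainder, controlled by the finite-dimensional state `X_n` alone. This is why a large weight `γ` in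
front of the finite-dimensional part is enough. -/
lemma integral_perturbation_sq_le (hL : 0 < L) (hf : Continuous f) (c u : ℝ) {w : ℝ → ℝ}
    (hw : ContinuousOn w (Icc 0 L)) :
    ∫ x in (0 : ℝ)..L, (remainder L f c u w x + (c * u - control L n K u w) * (x / L)) ^ 2 ≤
      2 * (∫ x in (0 : ℝ)..L, remainder L f c u w x ^ 2) +
        4 * L * (c ^ 2 + K ⬝ᵥ K) * (stateVec L n u w ⬝ᵥ stateVec L n u w) := by
  have hr := continuousOn_remainder hf c u hw
  have hr' : ContinuousOn (remainder L f c u w) (uIcc 0 L) := by rwa [uIcc_of_le hL.le]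
  set k := c * u - control L n K u w with hk
  have h1 : ∫ x in (0 : ℝ)..L, (remainder L f c u w x + k * (x / L)) ^ 2 ≤
      ∫ x in (0 : ℝ)..L, (2 * remainder L f c u w x ^ 2 + 2 * k ^ 2) := by
    apply intervalIntegral.integral_mono_on hL.le
    · exact ((hr'.add (by fun_prop)).pow 2).intervalIntegrable
    · exact ((continuousOn_const.mul (hr'.pow 2)).add continuousOn_const).intervalIntegrable
    · intro x hx
      have h2 : (k * (x / L)) ^ 2 ≤ k ^ 2 := by
        rw [mul_pow]
        refine mul_le_of_le_one_right (sq_nonneg k) ?_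
        exact pow_le_one₀ (div_nonneg hx.1 hL.le) ((div_le_one hL).2 hx.2)
      nlinarith [sq_nonneg (remainder L f c u w x - k * (x / L))]
  have hi : IntervalIntegrable (fun x => 2 * remainder L f c u w x ^ 2) volume 0 L :=
    (continuousOn_const.mul (hr'.pow 2)).intervalIntegrable
  rw [intervalIntegral.integral_add hi (by simp), intervalIntegral.integral_const_mul,
    intervalIntegral.integral_const, sub_zero, smul_eq_mul] at h1
  have hX := stateVec_dotProduct_self L n u w
  have hS : 0 ≤ ∑ j ∈ Finset.range n, coeff L (j + 1) w ^ 2 :=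
    Finset.sum_nonneg fun j _ => sq_nonneg _
  have h3 : k ^ 2 ≤ 2 * (c ^ 2 + K ⬝ᵥ K) * (stateVec L n u w ⬝ᵥ stateVec L n u w) := by
    have h4 := control_sq_le (L := L) (K := K) u w
    have h5 : (c * u) ^ 2 ≤ c ^ 2 * (stateVec L n u w ⬝ᵥ stateVec L n u w) := by
      rw [mul_pow]
      exact mul_le_mul_of_nonneg_left (by linarith) (sq_nonneg c)
    rw [hk]
    nlinarith [sq_nonneg (c * u + control L n K u w)]
  have h6 := mul_le_mul_of_nonneg_left h3 hL.le
  linarith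

/-- The finite-dimensional part of the derivative of `V`. -/
lemma quadratic_rate_eq (hL : 0 < L) (hf : Continuous f) (hP : SolvesLyapunov L c n K P) (u : ℝ)
    {w : ℝ → ℝ} (hw : ContinuousOn w (Icc 0 L)) :
    stateVec L n u w ⬝ᵥ P *ᵥ stateRate L f n K u w +
      stateRate L f n K u w ⬝ᵥ P *ᵥ stateVec L n u w =
    -(stateVec L n u w ⬝ᵥ stateVec L n u w) +
      2 * (stateVec L n u w ⬝ᵥ P *ᵥ stateRemainder L f c n u w) := by
  have hPt : Pᵀ = P := by simpa using hP.1.isHermitian.eq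
  set X := stateVec L n u w
  set M := closedLoopMat L c n K with hM
  rw [mulVec_dotProduct_comm hPt (stateRate L f n K u w) X, stateRate_eq hL hf c u hw,
    Matrix.mulVec_add, dotProduct_add]
  have h1 : X ⬝ᵥ P *ᵥ (M *ᵥ X) + X ⬝ᵥ P *ᵥ (M *ᵥ X) = -(X ⬝ᵥ X) := by
    have h2 : X ⬝ᵥ (Mᵀ * P) *ᵥ X = X ⬝ᵥ P *ᵥ (M *ᵥ X) := by
      rw [← Matrix.mulVec_mulVec, Matrix.dotProduct_mulVec, Matrix.vecMul_transpose,
        mulVec_dotProduct_comm hPt]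
    have h3 : X ⬝ᵥ (P * M + Mᵀ * P) *ᵥ X = -(X ⬝ᵥ X) := by
      rw [hM, hP.2]; simp [Matrix.neg_mulVec]
    rw [Matrix.add_mulVec, dotProduct_add, h2, ← Matrix.mulVec_mulVec] at h3
    exact h3
  linarith

/-- The infinite-dimensional part of the derivative of `V`. -/
lemma neg_tsum_eigenvalue_rate_le (hL : 0 < L) (hf : Continuous f) (c u : ℝ) {w : ℝ → ℝ}
    (hw : ContinuousOn w (Icc 0 L))
    (hs : Summable fun j => (eigenvalue L c (j + 1) * coeff L (j + 1) w) ^ 2) :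
    -(1 / 2 * ∑' j, 2 * eigenvalue L c (j + 1) * (coeff L (j + 1) w * rate L f n K u w j)) ≤
      -(1 / 2 * ∑' j, (eigenvalue L c (j + 1) * coeff L (j + 1) w) ^ 2) +
        1 / 2 * ∫ x in (0 : ℝ)..L,
          (remainder L f c u w x + (c * u - control L n K u w) * (x / L)) ^ 2 := by
  set q : ℕ → ℝ := fun j => coeff L (j + 1)
    (fun x => remainder L f c u w x + (c * u - control L n K u w) * (x / L)) with hq
  set a : ℕ → ℝ := fun j => eigenvalue L c (j + 1) * coeff L (j + 1) w with ha
  have hqs : HasSum (fun j => q j ^ 2) (∫ x in (0 : ℝ)..L,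
      (remainder L f c u w x + (c * u - control L n K u w) * (x / L)) ^ 2) :=
    hasSum_coeff_sq hL (memLp_of_continuousOn ((continuousOn_remainder hf c u hw).add
      (by fun_prop)))
  change Summable fun j => a j ^ 2 at hs
  have hab : Summable fun j => a j * q j := by
    refine Summable.of_norm_bounded (hs.add hqs.summable) fun j => ?_
    rw [Real.norm_eq_abs, abs_le]
    constructor <;> nlinarith [sq_nonneg (a j + q j), sq_nonneg (a j - q j), sq_nonneg (a j),
      sq_nonneg (q j)]
  have e : ∀ j, 2 * eigenvalue L c (j + 1) * (coeff L (j + 1) w * rate L f n K u w j) =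
      2 * (a j ^ 2 + a j * q j) := by
    intro j
    rw [rate_eq hL hf c u hw]; simp only [ha, hq]; ring
  simp_rw [e]
  rw [tsum_mul_left, hs.tsum_add hab, ← hqs.tsum_eq]
  change _ ≤ -(1 / 2 * ∑' j, a j ^ 2) + _
  have h2 : -∑' j, a j * q j ≤ ∑' j, (1 / 2 * a j ^ 2 + 1 / 2 * q j ^ 2) := by
    rw [← tsum_neg]
    refine Summable.tsum_le_tsum (fun j => ?_) hab.neg
      ((hs.mul_left (1 / 2)).add (hqs.summable.mul_left (1 / 2)))
    nlinarith [sq_nonneg (a j + q j)]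
  rw [(hs.mul_left (1 / 2)).tsum_add (hqs.summable.mul_left (1 / 2)), tsum_mul_left,
    tsum_mul_left] at h2
  linarith

/-- The dissipation dominates `V`. -/
lemma exists_mul_lyapV_le (hL : 0 < L) (hn : eigenvalue L c (n + 1) < 0)
    {p γ : ℝ} (hγ : 0 < γ) (hp0 : 0 < p)
    (hp : ∀ X : Fin (n + 1) → ℝ, X ⬝ᵥ P *ᵥ X ≤ p * (X ⬝ᵥ X)) :
    ∃ C > 0, ∀ (u : ℝ) (w : ℝ → ℝ), MemH10 L w →
      Summable (fun j => (eigenvalue L c (j + 1) * coeff L (j + 1) w) ^ 2) →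
      C * lyapV L c n P γ u w ≤ stateVec L n u w ⬝ᵥ stateVec L n u w +
        1 / 2 * ∑' j, (eigenvalue L c (j + 1) * coeff L (j + 1) w) ^ 2 := by
  set Λ := |c| + freq L (n + 1) ^ 2 with hΛ
  set θ := -eigenvalue L c (n + 1) with hθ
  have hΛ0 : 0 ≤ Λ := by positivity
  have hθ0 : 0 < θ := by linarith
  have hA : 0 < γ * p + Λ / 2 := by positivity
  -- for `j ≤ n` use `-λ_j ≤ Λ`, and for `j > n` use `-λ_j ≤ λ_j² / θ`
  refine ⟨min (1 / (γ * p + Λ / 2)) θ, lt_min (by positivity) hθ0, fun u w hw hs => ?_⟩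
  set X := stateVec L n u w with hXdef
  have hXX := dotProduct_self_nonneg' X
  have hfin := tsum_ite_lt n fun j => Λ * coeff L (j + 1) w ^ 2
  have hsum0 : 0 ≤ ∑' j, (eigenvalue L c (j + 1) * coeff L (j + 1) w) ^ 2 :=
    tsum_nonneg fun j => sq_nonneg _
  have h2 : -(∑' j, eigenvalue L c (j + 1) * coeff L (j + 1) w ^ 2) ≤
      Λ * ∑ j ∈ Finset.range n, coeff L (j + 1) w ^ 2 +
        θ⁻¹ * ∑' j, (eigenvalue L c (j + 1) * coeff L (j + 1) w) ^ 2 := by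
    rw [Finset.mul_sum, ← hfin.tsum_eq, ← tsum_neg, ← tsum_mul_left,
      ← hfin.summable.tsum_add (hs.mul_left _)]
    refine Summable.tsum_le_tsum (fun j => ?_) (summable_eigenvalue_mul_coeff_sq hL c hw).neg
      (hfin.summable.add (hs.mul_left _))
    have hsq := sq_nonneg (coeff L (j + 1) w)
    split_ifs with hj
    · have h3 : -eigenvalue L c (j + 1) ≤ Λ := by
        have h4 : freq L (j + 1) ^ 2 ≤ freq L (n + 1) ^ 2 := by
          have := (freq_strictMono hL).monotone (show j + 1 ≤ n + 1 by omega)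
          have h2 := freq_nonneg hL (j + 1)
          gcongr
        rw [eigenvalue_eq]
        linarith [neg_abs_le c]
      have h4 : 0 ≤ θ⁻¹ * (eigenvalue L c (j + 1) * coeff L (j + 1) w) ^ 2 := by positivity
      nlinarith
    · have h3 : θ ≤ -eigenvalue L c (j + 1) := by
        have := eigenvalue_antitone hL c (not_lt.1 hj)
        linarith
      rw [zero_add, inv_mul_eq_div, le_div_iff₀ hθ0, mul_pow]
      have h5 : -eigenvalue L c (j + 1) * θ ≤ eigenvalue L c (j + 1) ^ 2 := by nlinarith
      nlinarith
  have hX := stateVec_dotProduct_self L n u w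
  have h1 := mul_le_mul_of_nonneg_left (hp X) hγ.le
  have hV : lyapV L c n P γ u w ≤ (γ * p + Λ / 2) * (X ⬝ᵥ X) + 1 / 2 * (θ⁻¹ *
      ∑' j, (eigenvalue L c (j + 1) * coeff L (j + 1) w) ^ 2) := by
    unfold lyapV
    rw [← hXdef] at hX ⊢
    have h3 : Λ * ∑ j ∈ Finset.range n, coeff L (j + 1) w ^ 2 ≤ Λ * (X ⬝ᵥ X) := by
      rw [hX]
      exact mul_le_mul_of_nonneg_left (le_add_of_nonneg_left (sq_nonneg u)) hΛ0
    linarith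
  set S := ∑' j, (eigenvalue L c (j + 1) * coeff L (j + 1) w) ^ 2 with hS
  set C := min (1 / (γ * p + Λ / 2)) θ with hC
  have hC0 : 0 ≤ C := le_min (by positivity) hθ0.le
  have h5 : C * ((γ * p + Λ / 2) * (X ⬝ᵥ X)) ≤ X ⬝ᵥ X := by
    calc C * ((γ * p + Λ / 2) * (X ⬝ᵥ X)) ≤
        1 / (γ * p + Λ / 2) * ((γ * p + Λ / 2) * (X ⬝ᵥ X)) := by
          gcongr; exact min_le_left _ _
      _ = X ⬝ᵥ X := by field_simp
  have h6 : C * (θ⁻¹ * S) ≤ S := by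
    calc C * (θ⁻¹ * S) ≤ θ * (θ⁻¹ * S) := by gcongr; exact min_le_right _ _
      _ = S := by field_simp
  calc C * lyapV L c n P γ u w ≤ C * ((γ * p + Λ / 2) * (X ⬝ᵥ X) + 1 / 2 * (θ⁻¹ * S)) := by
        gcongr
    _ ≤ _ := by linarith

/-- The derivative of `V` along the closed loop, at the state `(u, w)`. -/
def lyapRate (L c : ℝ) (f : ℝ → ℝ) (n : ℕ) (K : Fin (n + 1) → ℝ)
    (P : Matrix (Fin (n + 1)) (Fin (n + 1)) ℝ) (γ u : ℝ) (w : ℝ → ℝ) : ℝ :=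
  γ * (stateVec L n u w ⬝ᵥ P *ᵥ stateRate L f n K u w +
      stateRate L f n K u w ⬝ᵥ P *ᵥ stateVec L n u w) -
    1 / 2 * ∑' j, 2 * eigenvalue L c (j + 1) * (coeff L (j + 1) w * rate L f n K u w j)

/-- The remainder is quadratic, and on bounded sets its square is also cubic. -/
lemma integral_remainder_sq_le (hL : 0 < L) (hf : Continuous f) {M B : ℝ} (hM : 0 ≤ M)
    (hB : 0 ≤ B)
    (hMB : ∀ y, |y| ≤ B → |f y - c * y| ≤ M * y ^ 2) (u : ℝ) {w : ℝ → ℝ} (hw : MemH10 L w)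
    (hwB : ∀ x ∈ Icc 0 L, |w x + x / L * u| ≤ B) :
    ∫ x in (0 : ℝ)..L, remainder L f c u w x ^ 2 ≤
        L * (M * ((1 + Real.sqrt L) * stateNorm L u w) ^ 2) ^ 2 ∧
      ∫ x in (0 : ℝ)..L, remainder L f c u w x ^ 2 ≤
        L * (M ^ 2 * B * (1 + Real.sqrt L) ^ 3) * stateNorm L u w ^ 3 := by
  set N := (1 + Real.sqrt L) * stateNorm L u w with hN
  have hN0 : 0 ≤ N := mul_nonneg (by positivity) (stateNorm_nonneg _ _ _)
  have hr := continuousOn_remainder hf c u (continuousOn_of_memH10 hL hw)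
  have hr' : ContinuousOn (remainder L f c u w) (uIcc 0 L) := by rwa [uIcc_of_le hL.le]
  have hpt : ∀ x ∈ Icc 0 L, |remainder L f c u w x| ≤ M * (w x + x / L * u) ^ 2 :=
    fun x hx => hMB _ (hwB x hx)
  have key : ∀ C : ℝ, (∀ x ∈ Icc 0 L, remainder L f c u w x ^ 2 ≤ C) →
      ∫ x in (0 : ℝ)..L, remainder L f c u w x ^ 2 ≤ L * C := by
    intro C hC
    have := intervalIntegral.integral_mono_on hL.le (hr'.pow 2).intervalIntegrable
      (g := fun _ => C) (intervalIntegrable_const (μ := volume)) hC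
    rwa [intervalIntegral.integral_const, sub_zero, smul_eq_mul] at this
  constructor
  · refine key _ fun x hx => ?_
    rw [← sq_abs]
    have h1 := hpt x hx
    have h2 := abs_add_le_mul_stateNorm hL u hw hx
    have h3 : (w x + x / L * u) ^ 2 ≤ N ^ 2 := by
      rw [← sq_abs]; gcongr
    gcongr
    exact h1.trans (by gcongr)
  · rw [mul_assoc]
    refine key _ fun x hx => ?_
    rw [← sq_abs]
    have h1 := hpt x hx
    have h2 := abs_add_le_mul_stateNorm hL u hw hx
    have h3 := hwB x hx
    set a := |w x + x / L * u| with ha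
    have ha0 : 0 ≤ a := abs_nonneg _
    rw [← sq_abs (w x + x / L * u), ← ha] at h1
    calc |remainder L f c u w x| ^ 2 ≤ (M * a ^ 2) ^ 2 := by gcongr
      _ = M ^ 2 * a * a ^ 3 := by ring
      _ ≤ M ^ 2 * B * N ^ 3 := by gcongr
      _ = _ := by rw [hN]; ring

lemma stateRemainder_dotProduct_le (hL : 0 < L) (hf : Continuous f) (c u : ℝ) {w : ℝ → ℝ}
    (hw : ContinuousOn w (Icc 0 L)) :
    stateRemainder L f c n u w ⬝ᵥ stateRemainder L f c n u w ≤
      ∫ x in (0 : ℝ)..L, remainder L f c u w x ^ 2 := by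
  have h := hasSum_coeff_sq hL (memLp_of_continuousOn (continuousOn_remainder hf c u hw))
  have := stateVec_dotProduct_self_le (L := L) n 0 h.summable
  rw [h.tsum_eq] at this
  simpa [stateRemainder] using this

/-- For large `γ` the derivative of `V` is at most `-C V + C' V^(3/2)`. -/
theorem exists_lyapRate_le (hL : 0 < L) (hf : Continuous f) (hfc : HasQuadraticRemainder f c)
    (hn : eigenvalue L c (n + 1) < 0) (hP : SolvesLyapunov L c n K P) {γ C₁ : ℝ} (hγ0 : 0 < γ)
    (hγ : 2 * L * (c ^ 2 + K ⬝ᵥ K) + 1 ≤ γ) (hC₁ : 0 < C₁)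
    (hlow : ∀ (u : ℝ) (w : ℝ → ℝ), MemH10 L w →
      C₁ * stateNorm L u w ^ 2 ≤ lyapV L c n P γ u w) {B : ℝ} (hB : 0 < B) :
    ∃ C > 0, ∃ C' > 0, ∀ (u : ℝ) (w : ℝ → ℝ), MemH10 L w →
      Summable (fun j => (eigenvalue L c (j + 1) * coeff L (j + 1) w) ^ 2) →
      |u| ≤ B → (∀ x ∈ Icc 0 L, |w x| ≤ B) →
      lyapRate L c f n K P γ u w ≤
        -C * lyapV L c n P γ u w + C' * lyapV L c n P γ u w ^ (3 / 2 : ℝ) := by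
  obtain ⟨p, hp0, hp⟩ := exists_abs_dotProduct_mulVec_le P
  have hp' : ∀ X : Fin (n + 1) → ℝ, X ⬝ᵥ P *ᵥ X ≤ p * (X ⬝ᵥ X) := fun X => by
    have := (le_abs_self _).trans (hp X X)
    rwa [Real.mul_self_sqrt (dotProduct_self_nonneg' X)] at this
  obtain ⟨C, hC, hCV⟩ := exists_mul_lyapV_le (c := c) hL hn hγ0 hp0 hp'
  obtain ⟨M, hM, hMB⟩ := hfc (2 * B) (by positivity)
  set σ := 1 + Real.sqrt L with hσ
  have hσ0 : 0 ≤ σ := by positivity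
  set κ := Real.sqrt (1 + 1 / freq L 1 ^ 2) with hκ
  set E := 2 * γ * p * (κ * (Real.sqrt L * (M * σ ^ 2))) + L * (M ^ 2 * (2 * B) * σ ^ 3) with hE
  have hE0 : 0 ≤ E := by positivity
  refine ⟨C, hC, E * C₁⁻¹ ^ (3 / 2 : ℝ) + 1, by positivity, fun u w hw hs hu hwB => ?_⟩
  have hwc := continuousOn_of_memH10 hL hw
  have hyB : ∀ x ∈ Icc 0 L, |w x + x / L * u| ≤ 2 * B := fun x hx => by
    have := (abs_div_mul_le hL u hx).trans hu
    linarith [abs_add_le (w x) (x / L * u), hwB x hx]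
  set N := stateNorm L u w with hN
  have hN0 : 0 ≤ N := stateNorm_nonneg _ _ _
  set X := stateVec L n u w with hX
  set R := stateRemainder L f c n u w with hR
  have hXX := dotProduct_self_nonneg' X
  obtain ⟨hr1, hr2⟩ := integral_remainder_sq_le hL hf hM (by positivity) hMB u hw hyB
  have h1 := quadratic_rate_eq hL hf hP u hwc
  have h2 := neg_tsum_eigenvalue_rate_le (n := n) (K := K) hL hf c u hwc hs
  have h3 := integral_perturbation_sq_le (n := n) (K := K) hL hf c u hwc
  have hRR := stateRemainder_dotProduct_le (n := n) hL hf c u hwc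
  have hXR : X ⬝ᵥ P *ᵥ R ≤ p * (κ * (Real.sqrt L * (M * σ ^ 2))) * N ^ 3 := by
    have hXs : Real.sqrt (X ⬝ᵥ X) ≤ κ * N := by
      rw [hκ, ← Real.sqrt_sq hN0, ← Real.sqrt_mul (by positivity)]
      exact Real.sqrt_le_sqrt (stateVec_dotProduct_self_le_stateNorm hL n u hw)
    have hRs : Real.sqrt (R ⬝ᵥ R) ≤ Real.sqrt L * (M * (σ * N) ^ 2) := by
      rw [← Real.sqrt_sq (show 0 ≤ M * (σ * N) ^ 2 by positivity), ← Real.sqrt_mul hL.le]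
      exact Real.sqrt_le_sqrt (hRR.trans hr1)
    calc X ⬝ᵥ P *ᵥ R ≤ p * (Real.sqrt (X ⬝ᵥ X) * Real.sqrt (R ⬝ᵥ R)) :=
          (le_abs_self _).trans (hp X R)
      _ ≤ p * ((κ * N) * (Real.sqrt L * (M * (σ * N) ^ 2))) := by gcongr
      _ = _ := by ring
  have hV := hlow u w hw
  have hV0 : 0 ≤ lyapV L c n P γ u w := le_trans (by positivity) hV
  have hN3 : N ^ 3 ≤ C₁⁻¹ ^ (3 / 2 : ℝ) * lyapV L c n P γ u w ^ (3 / 2 : ℝ) := by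
    rw [← Real.mul_rpow (by positivity) hV0]
    have h4 : N ^ 3 = (N ^ 2) ^ (3 / 2 : ℝ) := by
      rw [← Real.rpow_natCast N 2, ← Real.rpow_mul hN0, ← Real.rpow_natCast N 3]
      norm_num
    rw [h4]
    refine Real.rpow_le_rpow (by positivity) ?_ (by norm_num)
    rw [inv_mul_eq_div, le_div_iff₀ hC₁]; linarith
  have hCV' := hCV u w hw hs
  have hVp : 0 ≤ lyapV L c n P γ u w ^ (3 / 2 : ℝ) := Real.rpow_nonneg hV0 _
  have h5 : E * N ^ 3 ≤ E * (C₁⁻¹ ^ (3 / 2 : ℝ) * lyapV L c n P γ u w ^ (3 / 2 : ℝ)) := by gcongr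
  have h6 : X ⬝ᵥ X ≤ (γ - 2 * L * (c ^ 2 + K ⬝ᵥ K)) * (X ⬝ᵥ X) :=
    le_mul_of_one_le_left hXX (by linarith)
  have h7 : 2 * γ * (X ⬝ᵥ P *ᵥ R) ≤ 2 * γ * (p * (κ * (Real.sqrt L * (M * σ ^ 2))) * N ^ 3) := by
    gcongr
  unfold lyapRate
  rw [h1]
  have h8 : E * N ^ 3 = 2 * γ * (p * (κ * (Real.sqrt L * (M * σ ^ 2))) * N ^ 3) +
      L * (M ^ 2 * (2 * B) * σ ^ 3) * N ^ 3 := by rw [hE]; ring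
  linarith

end Lyapunov

/-! ### The Lyapunov function along solutions -/

section Solution

variable {L T c : ℝ} {f : ℝ → ℝ} {n : ℕ} {K : Fin (n + 1) → ℝ} {u : ℝ → ℝ} {y : ℝ → ℝ → ℝ}
  {P : Matrix (Fin (n + 1)) (Fin (n + 1)) ℝ}

/-- The fundamental theorem of calculus for `Xᵀ P X`. -/
lemma quadraticForm_eq_add_integral {m : ℕ} {T : ℝ} {X D : ℝ → Fin m → ℝ}
    (P : Matrix (Fin m) (Fin m) ℝ) (hD : ∀ i, ContinuousOn (fun t => D t i) (Icc 0 T))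
    (hX : ∀ i, ∀ t ∈ Icc 0 T, X t i = X 0 i + ∫ s in (0 : ℝ)..t, D s i) {t : ℝ}
    (ht : t ∈ Icc 0 T) :
    X t ⬝ᵥ P *ᵥ X t = X 0 ⬝ᵥ P *ᵥ X 0 +
      ∫ s in (0 : ℝ)..t, (X s ⬝ᵥ P *ᵥ D s + D s ⬝ᵥ P *ᵥ X s) := by
  have hT : 0 ≤ T := ht.1.trans ht.2
  have hss : Icc 0 t ⊆ Icc 0 T := Icc_subset_Icc_right ht.2
  have hXc : ∀ i, ContinuousOn (fun t => X t i) (Icc 0 T) := fun i =>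
    continuousOn_of_eq_integral_of_continuousOn hT (hD i) (hX i)
  have hi : ∀ i, IntervalIntegrable (fun s => D s i) volume 0 t := fun i => by
    apply ContinuousOn.intervalIntegrable
    rw [uIcc_of_le ht.1]; exact (hD i).mono hss
  have hprod : ∀ i j, X t i * X t j = X 0 i * X 0 j +
      ∫ s in (0 : ℝ)..t, (D s i * X s j + X s i * D s j) := by
    intro i j
    rw [mul_sub_mul_eq_integral ht.1 (hi i) (hi j) (fun s hs => hX i s (hss hs))
      (fun s hs => hX j s (hss hs))]
    ring
  have hci : ∀ i j, IntervalIntegrable (fun s => P i j * (D s i * X s j + X s i * D s j))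
      volume 0 t := by
    intro i j
    apply ContinuousOn.intervalIntegrable
    rw [uIcc_of_le ht.1]
    exact (continuousOn_const.mul (((hD i).mul (hXc j)).add ((hXc i).mul (hD j)))).mono hss
  have hexp : ∀ Y Z : Fin m → ℝ, Y ⬝ᵥ P *ᵥ Z = ∑ i, ∑ j, P i j * (Y i * Z j) := by
    intro Y Z
    simp only [dotProduct, Matrix.mulVec, Finset.mul_sum]
    exact Finset.sum_congr rfl fun i _ => Finset.sum_congr rfl fun j _ => by ring
  have hint : ∀ s, X s ⬝ᵥ P *ᵥ D s + D s ⬝ᵥ P *ᵥ X s =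
      ∑ i, ∑ j, P i j * (D s i * X s j + X s i * D s j) := by
    intro s
    rw [hexp, hexp, ← Finset.sum_add_distrib]
    refine Finset.sum_congr rfl fun i _ => ?_
    rw [← Finset.sum_add_distrib]
    exact Finset.sum_congr rfl fun j _ => by ring
  simp_rw [hint]
  rw [intervalIntegral.integral_finsetSum fun i _ => ?_]
  · rw [hexp, hexp, ← Finset.sum_add_distrib]
    refine Finset.sum_congr rfl fun i _ => ?_
    rw [intervalIntegral.integral_finsetSum fun j _ => hci i j, ← Finset.sum_add_distrib]
    refine Finset.sum_congr rfl fun j _ => ?_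
    rw [hprod, intervalIntegral.integral_const_mul]; ring
  · have := IntervalIntegrable.sum Finset.univ fun j _ => hci i j
    simpa only [Finset.sum_fn] using this

lemma IsSolution.continuousOn_stateRate (hL : 0 < L) (hT : 0 ≤ T) (hf : Continuous f)
    (h : IsSolution L f n K T u y) (i : Fin (n + 1)) :
    ContinuousOn (fun t => stateRate L f n K (u t) (shifted L u y t) i) (Icc 0 T) := by
  refine Fin.cases ?_ (fun i => ?_) i
  · simpa [stateRate] using h.continuousOn_control hL hT
  · simpa [stateRate] using h.continuousOn_rate hL hT hf i

lemma IsSolution.stateVec_eq_integral (hL : 0 < L) (hf : Continuous f)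
    (h : IsSolution L f n K T u y) (i : Fin (n + 1)) : ∀ t ∈ Icc 0 T,
    stateVec L n (u t) (shifted L u y t) i = stateVec L n (u 0) (shifted L u y 0) i +
      ∫ s in (0 : ℝ)..t, stateRate L f n K (u s) (shifted L u y s) i := by
  refine Fin.cases ?_ (fun i => ?_) i
  · simpa [stateRate, stateVec] using h.u_eq_integral hL
  · simpa [stateRate, stateVec] using h.coeff_eq_integral hL hf i

/-- `V` is absolutely continuous along solutions, with derivative `lyapRate`. -/
theorem IsSolution.lyapV_eq_integral (hL : 0 < L) (hT : 0 < T) (hf : Continuous f)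
    (h : IsSolution L f n K T u y) (c γ : ℝ) (P : Matrix (Fin (n + 1)) (Fin (n + 1)) ℝ) :
    IntervalIntegrable (fun s => lyapRate L c f n K P γ (u s) (shifted L u y s)) volume 0 T ∧
      ∀ t ∈ Icc 0 T, lyapV L c n P γ (u t) (shifted L u y t) =
        lyapV L c n P γ (u 0) (shifted L u y 0) +
          ∫ s in (0 : ℝ)..t, lyapRate L c f n K P γ (u s) (shifted L u y s) := by
  obtain ⟨hi, heq⟩ := h.tsum_eigenvalue_eq_integral hL hT hf c
  have hXc := h.continuousOn_stateVec hL hT.le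
  have hDc : ContinuousOn (fun t => stateRate L f n K (u t) (shifted L u y t)) (Icc 0 T) :=
    continuousOn_pi.2 fun i => h.continuousOn_stateRate hL hT.le hf i
  have hqc : ContinuousOn (fun s => stateVec L n (u s) (shifted L u y s) ⬝ᵥ
        P *ᵥ stateRate L f n K (u s) (shifted L u y s) +
      stateRate L f n K (u s) (shifted L u y s) ⬝ᵥ
        P *ᵥ stateVec L n (u s) (shifted L u y s)) (Icc 0 T) := by
    have hlin : Continuous fun p : (Fin (n + 1) → ℝ) × (Fin (n + 1) → ℝ) =>
        p.1 ⬝ᵥ P *ᵥ p.2 := by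
      simp only [dotProduct, Matrix.mulVec]; fun_prop
    exact (hlin.comp_continuousOn (hXc.prodMk hDc)).add (hlin.comp_continuousOn (hDc.prodMk hXc))
  have hqi : IntervalIntegrable (fun s => stateVec L n (u s) (shifted L u y s) ⬝ᵥ
        P *ᵥ stateRate L f n K (u s) (shifted L u y s) +
      stateRate L f n K (u s) (shifted L u y s) ⬝ᵥ
        P *ᵥ stateVec L n (u s) (shifted L u y s)) volume 0 T := by
    apply ContinuousOn.intervalIntegrable
    rwa [uIcc_of_le hT.le]
  refine ⟨(hqi.const_mul γ).sub (hi.const_mul (1 / 2)), fun t ht => ?_⟩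
  have hsub : uIcc 0 t ⊆ uIcc 0 T := by
    rw [uIcc_of_le ht.1, uIcc_of_le hT.le]; exact Icc_subset_Icc_right ht.2
  have hq := quadraticForm_eq_add_integral P
    (X := fun t => stateVec L n (u t) (shifted L u y t))
    (D := fun t => stateRate L f n K (u t) (shifted L u y t))
    (fun i => h.continuousOn_stateRate hL hT.le hf i)
    (fun i => h.stateVec_eq_integral hL hf i) ht
  unfold lyapV lyapRate
  rw [hq, heq t ht, intervalIntegral.integral_sub ((hqi.mono_set hsub).const_mul γ)
    ((hi.mono_set hsub).const_mul (1 / 2)), intervalIntegral.integral_const_mul,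
    intervalIntegral.integral_const_mul]
  ring

lemma IsSolution.ae_summable_eigenvalue (hL : 0 < L) (h : IsSolution L f n K T u y) (c : ℝ) :
    ∀ᵐ t ∂(intervalMeasure T), Summable fun j =>
      (eigenvalue L c (j + 1) * coeff L (j + 1) (shifted L u y t)) ^ 2 := by
  obtain ⟨W, -, hae⟩ := h.ae_shifted_hasL2Deriv hL
  filter_upwards [hae] with t ht
  refine Summable.of_nonneg_of_le (fun j => sq_nonneg _) (fun j => ?_)
    (ht.1.mul_left ((1 + |c| / freq L 1 ^ 2) ^ 2))
  have h1 := abs_eigenvalue_le hL c j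
  calc (eigenvalue L c (j + 1) * coeff L (j + 1) (shifted L u y t)) ^ 2
      = |eigenvalue L c (j + 1)| ^ 2 * coeff L (j + 1) (shifted L u y t) ^ 2 := by
        rw [mul_pow, sq_abs]
    _ ≤ ((1 + |c| / freq L 1 ^ 2) * freq L (j + 1) ^ 2) ^ 2 *
          coeff L (j + 1) (shifted L u y t) ^ 2 := by gcongr
    _ = _ := by ring

/-- `V` is a Lyapunov function as soon as `γ` is large. -/
theorem exists_isLyapunovFunction (hL : 0 < L) (hf : Continuous f)
    (hfc : HasQuadraticRemainder f c) (hn : eigenvalue L c (n + 1) < 0)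
    (hP : SolvesLyapunov L c n K P) :
    ∃ γ₀ > 0, ∀ γ ≥ γ₀, IsLyapunovFunction L f n K (lyapV L c n P γ) := by
  obtain ⟨p, hp0, hp⟩ := exists_abs_dotProduct_mulVec_le P
  have hp' : ∀ X : Fin (n + 1) → ℝ, X ⬝ᵥ P *ᵥ X ≤ p * (X ⬝ᵥ X) := fun X => by
    have := (le_abs_self _).trans (hp X X)
    rwa [Real.mul_self_sqrt (dotProduct_self_nonneg' X)] at this
  obtain ⟨q, hq0, hq⟩ := exists_le_dotProduct_mulVec hP.1
  obtain ⟨θ, hθ0, hθ1, hθ⟩ := exists_mul_freq_sq_le hL c hn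
  have hKK := dotProduct_self_nonneg' K
  -- the first bound on `γ` makes `-γ XᵀX` absorb the effect of `u` and of the control on all modes,
  -- the second one gives coercivity
  refine ⟨max (2 * L * (c ^ 2 + K ⬝ᵥ K) + 1) ((1 + |c|) / 2 / q),
    lt_max_of_lt_left (by positivity), fun γ hγ => ?_⟩
  have hγ1 : 2 * L * (c ^ 2 + K ⬝ᵥ K) + 1 ≤ γ := (le_max_left _ _).trans hγ
  have hγ0 : 0 < γ := lt_of_lt_of_le (by positivity) hγ1
  have hγq : (1 + |c|) / 2 ≤ γ * q := by
    rw [← div_le_iff₀ hq0]; exact (le_max_right _ _).trans hγ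
  have hlow : ∀ (u : ℝ) (w : ℝ → ℝ), MemH10 L w →
      θ / 2 * stateNorm L u w ^ 2 ≤ lyapV L c n P γ u w := fun u w hw =>
    le_lyapV hL hγ0.le hq hθ1 hθ hγq u hw
  constructor
  · exact ⟨θ / 2, by positivity, γ * p * (1 + 1 / freq L 1 ^ 2) + (1 + |c| / freq L 1 ^ 2),
      by positivity, fun u w hw => ⟨hlow u w hw, lyapV_le hL hγ0.le hp' hp0.le u hw⟩⟩
  · intro B hB
    obtain ⟨C, hC, C', hC', hrate⟩ :=
      exists_lyapRate_le hL hf hfc hn hP hγ0 hγ1 (show 0 < θ / 2 by positivity) hlow hB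
    refine ⟨C, hC, C', hC', fun T hT u y h hbound => ?_⟩
    have hmem := h.memH10 hL hT hf
    obtain ⟨hi, heq⟩ := h.lyapV_eq_integral hL hT hf c γ P
    refine ⟨hmem, _, hi, heq, ?_⟩
    filter_upwards [h.ae_summable_eigenvalue hL c, ae_restrict_mem measurableSet_Ioc]
      with t hs ht
    have htI := Ioc_subset_Icc_self ht
    exact hrate _ _ (hmem t htI) hs (hbound t htI).1 (hbound t htI).2

end Solution

/-! ### Stability and attractivity from a Lyapunov function -/

lemma HasL2Deriv.mono {a b b' : ℝ} {w g : ℝ → ℝ} (h : HasL2Deriv a b w g) (hb : b' ≤ b) :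
    HasL2Deriv a b' w g :=
  ⟨h.1.mono_measure (Measure.restrict_mono (Ioc_subset_Ioc_right hb) le_rfl),
    fun x hx => h.2 x ⟨hx.1, hx.2.trans hb⟩⟩

lemma MemYT.mono {L T T' : ℝ} {y yt yx yxx : ℝ → ℝ → ℝ} (h : MemYT L T y yt yx yxx)
    (hT : T' ≤ T) : MemYT L T' y yt yx yxx where
  continuousOn := h.continuousOn.mono (prod_mono (Icc_subset_Icc_right hT) le_rfl)
  memLp_t := h.memLp_t.mono_measure
    (Measure.restrict_mono (prod_mono (Ioc_subset_Ioc_right hT) le_rfl) le_rfl)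
  memLp_x := h.memLp_x.mono_measure
    (Measure.restrict_mono (prod_mono (Ioc_subset_Ioc_right hT) le_rfl) le_rfl)
  memLp_xx := h.memLp_xx.mono_measure
    (Measure.restrict_mono (prod_mono (Ioc_subset_Ioc_right hT) le_rfl) le_rfl)
  deriv_t := h.deriv_t.mono fun _ hx => hx.mono hT
  deriv_x := ae_mono (Measure.restrict_mono (Ioc_subset_Ioc_right hT) le_rfl) h.deriv_x

section Stability

variable {L T : ℝ} {f : ℝ → ℝ} {n : ℕ} {K : Fin (n + 1) → ℝ} {u : ℝ → ℝ} {y : ℝ → ℝ → ℝ}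
  {V : ℝ → (ℝ → ℝ) → ℝ}

lemma IsSolution.mono (h : IsSolution L f n K T u y) {T' : ℝ} (hT : T' ≤ T) :
    IsSolution L f n K T' u y where
  equation := by
    obtain ⟨yt, yx, yxx, hy, heq⟩ := h.equation
    exact ⟨yt, yx, yxx, hy.mono hT, ae_mono (Measure.restrict_mono
      (prod_mono (Ioc_subset_Ioc_right hT) le_rfl) le_rfl) heq⟩
  boundary_zero t ht := h.boundary_zero t ⟨ht.1, ht.2.trans hT⟩
  boundary_L t ht := h.boundary_L t ⟨ht.1, ht.2.trans hT⟩
  feedback t ht := (h.feedback t ⟨ht.1, ht.2.trans hT⟩).mono (Icc_subset_Icc_right hT)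

/-- Solutions are bounded, being continuous. -/
lemma IsSolution.exists_bound (h : IsSolution L f n K T u y) :
    ∃ B > 0, ∀ t ∈ Icc 0 T, |u t| ≤ B ∧ ∀ x ∈ Icc 0 L, |shifted L u y t x| ≤ B := by
  obtain ⟨B₁, hB₁⟩ := isCompact_Icc.exists_bound_of_continuousOn h.continuousOn_u
  obtain ⟨B₂, hB₂⟩ := (isCompact_Icc.prod isCompact_Icc).exists_bound_of_continuousOn
    h.continuousOn_shifted
  refine ⟨max 1 (max B₁ B₂), by positivity, fun t ht => ⟨?_, fun x hx => ?_⟩⟩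
  · exact (hB₁ t ht).trans ((le_max_left _ _).trans (le_max_right _ _))
  · exact (hB₂ (t, x) ⟨ht, hx⟩).trans ((le_max_right _ _).trans (le_max_right _ _))

lemma IsLyapunovFunction.continuousOn (hV : IsLyapunovFunction L f n K V) (hT : 0 < T)
    (h : IsSolution L f n K T u y) :
    ContinuousOn (fun t => V (u t) (shifted L u y t)) (Icc 0 T) := by
  obtain ⟨B, hB, hb⟩ := h.exists_bound
  obtain ⟨C, -, C', -, hd⟩ := hV.decay B hB
  obtain ⟨-, V', hi, heq, -⟩ := hd T hT u y h hb
  exact continuousOn_of_eq_integral hT.le hi heq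

/-- Small sublevel sets of a Lyapunov function are invariant, and `dV/dt ≤ -k V` there. -/
theorem IsLyapunovFunction.exists_invariant (hL : 0 < L) (hV : IsLyapunovFunction L f n K V) :
    ∃ ρ₀ > 0, ∃ k > 0, ∀ ρ ≤ ρ₀, ∀ T > 0, ∀ (u : ℝ → ℝ) (y : ℝ → ℝ → ℝ),
      IsSolution L f n K T u y → V (u 0) (shifted L u y 0) < ρ →
      (∀ t ∈ Icc 0 T, MemH10 L (shifted L u y t)) ∧
      (∀ t ∈ Icc 0 T, V (u t) (shifted L u y t) < ρ) ∧
      ∃ V' : ℝ → ℝ, IntervalIntegrable V' volume 0 T ∧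
        (∀ t ∈ Icc 0 T, V (u t) (shifted L u y t) =
          V (u 0) (shifted L u y 0) + ∫ s in (0 : ℝ)..t, V' s) ∧
        ∀ᵐ t ∂(intervalMeasure T), V' t ≤ -k * V (u t) (shifted L u y t) := by
  obtain ⟨C₁, hC₁, C₂, hC₂, hequiv⟩ := hV.equiv_norm
  obtain ⟨C, hC, C', hC', hd⟩ := hV.decay 1 one_pos
  -- below `C₁ min(1, 1/L)` both `u` and `z` are bounded by `1`, through the embedding of `H¹₀` into
  -- the continuous functions; below `(C / (2 C'))²` one has `C' V^(3/2) ≤ (C/2) V`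
  set ρ₀ := min (C₁ * min 1 (1 / L)) ((C / (2 * C')) ^ 2) with hρ₀
  have hρ₀pos : 0 < ρ₀ := by positivity
  -- a solution below the level `ρ₀` is bounded by `1` and decays
  have hloc : ∀ T > 0, ∀ (u : ℝ → ℝ) (y : ℝ → ℝ → ℝ), IsSolution L f n K T u y →
      (∀ t ∈ Icc 0 T, MemH10 L (shifted L u y t)) →
      (∀ t ∈ Icc 0 T, V (u t) (shifted L u y t) ≤ ρ₀) →
      ∃ V' : ℝ → ℝ, IntervalIntegrable V' volume 0 T ∧
        (∀ t ∈ Icc 0 T, V (u t) (shifted L u y t) =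
          V (u 0) (shifted L u y 0) + ∫ s in (0 : ℝ)..t, V' s) ∧
        ∀ᵐ t ∂(intervalMeasure T), V' t ≤ -(C / 2) * V (u t) (shifted L u y t) := by
    intro T hT u y h hmem hle
    have hb : ∀ t ∈ Icc 0 T, |u t| ≤ 1 ∧ ∀ x ∈ Icc 0 L, |shifted L u y t x| ≤ 1 := by
      intro t ht
      have h1 := (hequiv (u t) _ (hmem t ht)).1.trans
        ((hle t ht).trans (min_le_left _ _))
      have h2 := le_of_mul_le_mul_left h1 hC₁
      have hN0 := stateNorm_nonneg L (u t) (shifted L u y t)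
      constructor
      · refine (abs_le_stateNorm L (u t) (shifted L u y t)).trans ?_
        exact (sq_le_one_iff₀ hN0).1 (h2.trans (min_le_left _ _))
      · intro x hx
        refine (abs_le_mul_stateNorm hL (u t) (hmem t ht) hx).trans ?_
        rw [← sq_le_one_iff₀ (by positivity), mul_pow, Real.sq_sqrt hL.le]
        have := h2.trans (min_le_right _ _)
        rwa [le_div_iff₀ hL, mul_comm] at this
    obtain ⟨-, V', hi, heq, hae⟩ := hd T hT u y h hb
    refine ⟨V', hi, heq, ?_⟩
    filter_upwards [hae, ae_restrict_mem measurableSet_Ioc] with t ht hmt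
    have htI := Ioc_subset_Icc_self hmt
    set v := V (u t) (shifted L u y t) with hv
    have hv0 : 0 ≤ v := le_trans (by positivity) (hequiv (u t) _ (hmem t htI)).1
    have hvs : Real.sqrt v ≤ C / (2 * C') := by
      rw [← Real.sqrt_sq (show 0 ≤ C / (2 * C') by positivity)]
      exact Real.sqrt_le_sqrt ((hle t htI).trans (min_le_right _ _))
    have h32 : v ^ (3 / 2 : ℝ) = v * Real.sqrt v := by
      rw [Real.sqrt_eq_rpow, show (3 / 2 : ℝ) = 1 + 1 / 2 by norm_num,
        Real.rpow_add_of_nonneg hv0 zero_le_one (by norm_num), Real.rpow_one]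
    have h3 : C' * v ^ (3 / 2 : ℝ) ≤ C / 2 * v := by
      rw [h32]
      calc C' * (v * Real.sqrt v) ≤ C' * (v * (C / (2 * C'))) := by gcongr
        _ = C / 2 * v := by field_simp
    linarith
  refine ⟨ρ₀, hρ₀pos, C / 2, by positivity, fun ρ hρ T hT u y h h0 => ?_⟩
  have hmem : ∀ t ∈ Icc 0 T, MemH10 L (shifted L u y t) := by
    obtain ⟨B, hB, hb⟩ := h.exists_bound
    obtain ⟨C, -, C', -, hd⟩ := hV.decay B hB
    exact (hd T hT u y h hb).1
  have hcont := hV.continuousOn hT h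
  have hlt : ∀ t ∈ Icc 0 T, V (u t) (shifted L u y t) < ρ := by
    by_contra hcon
    push Not at hcon
    obtain ⟨t₂, ht₂, hge⟩ := hcon
    -- the first time at which the level `ρ` is reached
    set S := Icc 0 T ∩ (fun t => V (u t) (shifted L u y t)) ⁻¹' Ici ρ with hS
    have hSc : IsCompact S := isCompact_Icc.of_isClosed_subset
      (hcont.preimage_isClosed_of_isClosed isClosed_Icc isClosed_Ici) inter_subset_left
    have hSne : S.Nonempty := ⟨t₂, ht₂, hge⟩
    have ht₁ := hSc.sInf_mem hSne
    set t₁ := sInf S with ht₁def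
    have ht₁pos : 0 < t₁ := by
      rcases ht₁.1.1.eq_or_lt with h' | h'
      · exfalso
        have := ht₁.2
        rw [← h'] at this
        exact absurd h0 (not_lt.2 this)
      · exact h'
    have hbelow : ∀ t ∈ Ico 0 t₁, V (u t) (shifted L u y t) < ρ := by
      intro t ht
      by_contra hc
      have : t ∈ S := ⟨⟨ht.1, ht.2.le.trans ht₁.1.2⟩, not_lt.1 hc⟩
      exact absurd (csInf_le hSc.bddBelow this) (not_le.2 ht.2)
    have hle : ∀ t ∈ Icc 0 t₁, V (u t) (shifted L u y t) ≤ ρ := by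
      have hcl : Icc 0 t₁ = closure (Ico 0 t₁) := (closure_Ico ht₁pos.ne).symm
      rw [hcl]
      intro t ht
      have hc1 : ContinuousOn (fun t => V (u t) (shifted L u y t)) (closure (Ico 0 t₁)) := by
        rw [← hcl]; exact hcont.mono (Icc_subset_Icc_right ht₁.1.2)
      exact le_on_closure (fun s hs => (hbelow s hs).le) hc1 continuousOn_const ht
    obtain ⟨V', hi, heq, hae⟩ := hloc t₁ ht₁pos u y (h.mono ht₁.1.2)
      (fun t ht => hmem t ⟨ht.1, ht.2.trans ht₁.1.2⟩) (fun t ht => (hle t ht).trans hρ)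
    have h1 := heq t₁ (right_mem_Icc.2 ht₁pos.le)
    have h2 : ∫ s in (0 : ℝ)..t₁, V' s ≤ 0 := by
      rw [intervalIntegral.integral_of_le ht₁pos.le]
      refine integral_nonpos_of_ae ?_
      filter_upwards [hae, ae_restrict_mem measurableSet_Ioc] with t ht hmt
      have hv0 : 0 ≤ V (u t) (shifted L u y t) :=
        le_trans (by positivity) (hequiv (u t) _ (hmem t ⟨hmt.1.le, hmt.2.trans ht₁.1.2⟩)).1
      refine ht.trans ?_
      have : 0 ≤ C / 2 * V (u t) (shifted L u y t) := by positivity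
      simp only [Pi.zero_apply]; linarith
    have h3 : ρ ≤ V (u t₁) (shifted L u y t₁) := ht₁.2
    linarith
  exact ⟨hmem, hlt, hloc T hT u y h hmem fun t ht => (hlt t ht).le.trans hρ⟩

/-- Lyapunov stability. -/
theorem IsLyapunovFunction.stable (hL : 0 < L) (hV : IsLyapunovFunction L f n K V) :
    ∀ ε > 0, ∃ δ > 0, ∀ T > 0, ∀ (u : ℝ → ℝ) (y : ℝ → ℝ → ℝ), IsSolution L f n K T u y →
      MemH10 L (shifted L u y 0) → stateNorm L (u 0) (shifted L u y 0) < δ →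
      ∀ t ∈ Icc 0 T, MemH10 L (shifted L u y t) ∧
        stateNorm L (u t) (shifted L u y t) < ε := by
  obtain ⟨C₁, hC₁, C₂, hC₂, hequiv⟩ := hV.equiv_norm
  obtain ⟨ρ₀, hρ₀, k, -, hinv⟩ := hV.exists_invariant hL
  intro ε hε
  set ρ := min ρ₀ (C₁ * ε ^ 2) with hρ
  have hρpos : 0 < ρ := by positivity
  refine ⟨Real.sqrt (ρ / C₂), by positivity, fun T hT u y h hmem0 hlt => ?_⟩
  have hV0 : V (u 0) (shifted L u y 0) < ρ := by
    refine (hequiv (u 0) _ hmem0).2.trans_lt ?_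
    have := pow_lt_pow_left₀ hlt (stateNorm_nonneg _ _ _) two_ne_zero
    rw [Real.sq_sqrt (by positivity), lt_div_iff₀ hC₂] at this
    linarith
  obtain ⟨hmem, hlt', -⟩ := hinv ρ (min_le_left _ _) T hT u y h hV0
  intro t ht
  refine ⟨hmem t ht, ?_⟩
  have h1 := (hequiv (u t) _ (hmem t ht)).1.trans_lt
    ((hlt' t ht).trans_le (min_le_right _ _))
  exact lt_of_pow_lt_pow_left₀ 2 hε.le (lt_of_mul_lt_mul_left h1 hC₁.le)

/-- Grönwall's inequality for primitives of integrable functions. -/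
lemma le_mul_exp_of_ae_le {T k : ℝ} (hT : 0 ≤ T) {v v' : ℝ → ℝ}
    (hi : IntervalIntegrable v' volume 0 T)
    (hv : ∀ t ∈ Icc 0 T, v t = v 0 + ∫ s in (0 : ℝ)..t, v' s)
    (hae : ∀ᵐ t ∂(intervalMeasure T), v' t ≤ -k * v t) : v T ≤ v 0 * Real.exp (-k * T) := by
  have hexp : ∀ s : ℝ, HasDerivAt (fun s => Real.exp (k * s)) (k * Real.exp (k * s)) s := by
    intro s
    have := ((hasDerivAt_id s).const_mul k).exp
    simpa [mul_comm] using this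
  have h := mul_sub_mul_eq_integral hT hi
    ((show Continuous fun s => k * Real.exp (k * s) by fun_prop).intervalIntegrable 0 T) hv
    (fun x _ => eq_integral_of_hasDerivAt hexp (by fun_prop) 0 x)
  have h2 : ∫ s in (0 : ℝ)..T, (v' s * Real.exp (k * s) + v s * (k * Real.exp (k * s))) ≤ 0 := by
    rw [intervalIntegral.integral_of_le hT]
    refine integral_nonpos_of_ae ?_
    filter_upwards [hae] with s hs
    have := mul_le_mul_of_nonneg_right hs (Real.exp_pos (k * s)).le
    simp only [Pi.zero_apply]
    linarith
  rw [h] at h2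
  simp only [mul_zero, Real.exp_zero, mul_one] at h2
  have h3 : Real.exp (k * T) * Real.exp (-k * T) = 1 := by
    rw [← Real.exp_add]; simp
  have h4 := mul_le_mul_of_nonneg_right (sub_nonpos.1 h2) (Real.exp_pos (-k * T)).le
  rwa [mul_assoc, h3, mul_one] at h4

/-- Local attractivity. -/
theorem IsLyapunovFunction.attractive (hL : 0 < L) (hV : IsLyapunovFunction L f n K V) :
    ∃ δ > 0, ∀ (u : ℝ → ℝ) (y : ℝ → ℝ → ℝ), (∀ T > 0, IsSolution L f n K T u y) →
      MemH10 L (shifted L u y 0) → stateNorm L (u 0) (shifted L u y 0) < δ →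
      (∀ t ≥ 0, MemH10 L (shifted L u y t)) ∧
        Tendsto (fun t => stateNorm L (u t) (shifted L u y t)) atTop (𝓝 0) := by
  obtain ⟨C₁, hC₁, C₂, hC₂, hequiv⟩ := hV.equiv_norm
  obtain ⟨ρ₀, hρ₀, k, hk, hinv⟩ := hV.exists_invariant hL
  refine ⟨Real.sqrt (ρ₀ / C₂), by positivity, fun u y h hmem0 hlt => ?_⟩
  have hV0 : V (u 0) (shifted L u y 0) < ρ₀ := by
    refine (hequiv (u 0) _ hmem0).2.trans_lt ?_
    have := pow_lt_pow_left₀ hlt (stateNorm_nonneg _ _ _) two_ne_zero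
    rw [Real.sq_sqrt (by positivity), lt_div_iff₀ hC₂] at this
    linarith
  have hmem : ∀ t ≥ 0, MemH10 L (shifted L u y t) := by
    intro t ht
    exact (hinv ρ₀ le_rfl (t + 1) (by linarith) u y (h _ (by linarith)) hV0).1 t
      ⟨ht, by linarith⟩
  refine ⟨hmem, ?_⟩
  set v₀ := V (u 0) (shifted L u y 0) with hv₀
  have hdecay : ∀ t > 0, stateNorm L (u t) (shifted L u y t) ^ 2 ≤
      v₀ / C₁ * Real.exp (-k * t) := by
    intro t ht
    obtain ⟨-, -, V', hi, heq, hae⟩ := hinv ρ₀ le_rfl t ht u y (h t ht) hV0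
    have h1 := le_mul_exp_of_ae_le ht.le (v := fun t => V (u t) (shifted L u y t)) hi heq hae
    have h2 := (hequiv (u t) _ (hmem t ht.le)).1.trans h1
    rw [div_mul_eq_mul_div, le_div_iff₀ hC₁]
    linarith
  have hexp : Tendsto (fun t : ℝ => v₀ / C₁ * Real.exp (-k * t)) atTop (𝓝 0) := by
    have h1 : Tendsto (fun t : ℝ => -k * t) atTop atBot :=
      tendsto_id.const_mul_atTop_of_neg (by linarith)
    simpa using (Real.tendsto_exp_atBot.comp h1).const_mul (v₀ / C₁)
  have hsq : Tendsto (fun t => stateNorm L (u t) (shifted L u y t) ^ 2) atTop (𝓝 0) := by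
    refine tendsto_of_tendsto_of_tendsto_of_le_of_le' tendsto_const_nhds hexp
      (Eventually.of_forall fun t => sq_nonneg _) ?_
    filter_upwards [eventually_gt_atTop 0] with t ht
    exact hdecay t ht
  have := hsq.sqrt
  simpa only [Real.sqrt_sq (stateNorm_nonneg _ _ _), Real.sqrt_zero] using this

end Stability

/-! ### Uniqueness of solutions -/

/-- Lipschitz continuity on bounded sets. -/
def IsLipschitzOnBounded (f : ℝ → ℝ) : Prop :=
  ∀ B : ℝ, ∃ Λ ≥ 0, ∀ a b, |a| ≤ B → |b| ≤ B → |f a - f b| ≤ Λ * |a - b|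

section Uniqueness

variable {L T : ℝ} {f : ℝ → ℝ} {n : ℕ} {K : Fin (n + 1) → ℝ}

lemma stateVec_sub (hL : 0 < L) (u₁ u₂ : ℝ) {w₁ w₂ : ℝ → ℝ} (h₁ : ContinuousOn w₁ (Icc 0 L))
    (h₂ : ContinuousOn w₂ (Icc 0 L)) :
    stateVec L n u₁ w₁ - stateVec L n u₂ w₂ =
      stateVec L n (u₁ - u₂) (fun x => w₁ x - w₂ x) := by
  ext i
  refine Fin.cases ?_ (fun i => ?_) i
  · simp [stateVec]
  · simp [stateVec, coeff_sub hL (memLp_of_continuousOn h₁) (memLp_of_continuousOn h₂)]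

lemma control_sub (hL : 0 < L) (u₁ u₂ : ℝ) {w₁ w₂ : ℝ → ℝ} (h₁ : ContinuousOn w₁ (Icc 0 L))
    (h₂ : ContinuousOn w₂ (Icc 0 L)) :
    control L n K u₁ w₁ - control L n K u₂ w₂ =
      control L n K (u₁ - u₂) (fun x => w₁ x - w₂ x) := by
  unfold control
  rw [← dotProduct_sub, stateVec_sub hL u₁ u₂ h₁ h₂]

/-- The squared `ℝ × L²` distance of two states. -/
def distSq (L u : ℝ) (w : ℝ → ℝ) : ℝ := u ^ 2 + ∫ x in (0 : ℝ)..L, w x ^ 2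

lemma control_sq_le_distSq (hL : 0 < L) (u : ℝ) {w : ℝ → ℝ} (hw : ContinuousOn w (Icc 0 L)) :
    control L n K u w ^ 2 ≤ (K ⬝ᵥ K) * distSq L u w := by
  have h := hasSum_coeff_sq hL (memLp_of_continuousOn hw)
  have h1 := stateVec_dotProduct_self_le (L := L) n u h.summable
  rw [h.tsum_eq] at h1
  exact (control_sq_le u w).trans (mul_le_mul_of_nonneg_left h1 (dotProduct_self_nonneg' K))

/-- On bounded sets the lower order part of the equation is Lipschitz with respect to the `ℝ × L²`
distance. -/
lemma integral_forcing_sub_sq_le (hL : 0 < L) (hf : Continuous f) {Λ B : ℝ}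
    (hΛ : ∀ a b, |a| ≤ B → |b| ≤ B → |f a - f b| ≤ Λ * |a - b|) {u₁ u₂ : ℝ} {w₁ w₂ : ℝ → ℝ}
    (h₁ : ContinuousOn w₁ (Icc 0 L)) (h₂ : ContinuousOn w₂ (Icc 0 L))
    (hB₁ : ∀ x ∈ Icc 0 L, |w₁ x + x / L * u₁| ≤ B)
    (hB₂ : ∀ x ∈ Icc 0 L, |w₂ x + x / L * u₂| ≤ B) :
    ∫ x in (0 : ℝ)..L, (forcing L f n K u₁ w₁ x - forcing L f n K u₂ w₂ x) ^ 2 ≤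
      (4 * Λ ^ 2 * (1 + L) + 2 * L * (K ⬝ᵥ K)) * distSq L (u₁ - u₂) (fun x => w₁ x - w₂ x) := by
  have hw : ContinuousOn (fun x => w₁ x - w₂ x) (Icc 0 L) := h₁.sub h₂
  have hk := control_sub (n := n) (K := K) hL u₁ u₂ h₁ h₂
  have hk2 := control_sq_le_distSq (n := n) (K := K) hL (u₁ - u₂) hw
  set k := control L n K (u₁ - u₂) (fun x => w₁ x - w₂ x) with hkdef
  set U := u₁ - u₂ with hU
  have hwi : IntervalIntegrable (fun x => (w₁ x - w₂ x) ^ 2) volume 0 L := by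
    apply ContinuousOn.intervalIntegrable
    rw [uIcc_of_le hL.le]; exact hw.pow 2
  have hFc : ContinuousOn
      (fun x => (forcing L f n K u₁ w₁ x - forcing L f n K u₂ w₂ x) ^ 2) (Icc 0 L) :=
    ((continuousOn_forcing hf n K u₁ h₁).sub (continuousOn_forcing hf n K u₂ h₂)).pow 2
  have h3 : ∫ x in (0 : ℝ)..L, (forcing L f n K u₁ w₁ x - forcing L f n K u₂ w₂ x) ^ 2 ≤
      ∫ x in (0 : ℝ)..L, (4 * Λ ^ 2 * (w₁ x - w₂ x) ^ 2 + (4 * Λ ^ 2 * U ^ 2 + 2 * k ^ 2)) := by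
    apply intervalIntegral.integral_mono_on hL.le
    · apply ContinuousOn.intervalIntegrable
      rwa [uIcc_of_le hL.le]
    · exact (hwi.const_mul _).add (by simp)
    · intro x hx
      have hx0 : 0 ≤ x / L := div_nonneg hx.1 hL.le
      have hx1 : x / L ≤ 1 := (div_le_one hL).2 hx.2
      have e : forcing L f n K u₁ w₁ x - forcing L f n K u₂ w₂ x =
          (f (w₁ x + x / L * u₁) - f (w₂ x + x / L * u₂)) - x / L * k := by
        rw [← hk]; unfold forcing; ring
      have h4 := hΛ _ _ (hB₁ x hx) (hB₂ x hx)
      have h5 : (f (w₁ x + x / L * u₁) - f (w₂ x + x / L * u₂)) ^ 2 ≤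
          Λ ^ 2 * ((w₁ x - w₂ x) + x / L * U) ^ 2 := by
        rw [← sq_abs, ← mul_pow]
        have h6 : w₁ x + x / L * u₁ - (w₂ x + x / L * u₂) = (w₁ x - w₂ x) + x / L * U := by
          rw [hU]; ring
        rw [h6] at h4
        calc |f (w₁ x + x / L * u₁) - f (w₂ x + x / L * u₂)| ^ 2
            ≤ (Λ * |(w₁ x - w₂ x) + x / L * U|) ^ 2 := by gcongr
          _ = _ := by rw [mul_pow, sq_abs, mul_pow]
      have h7 : ∀ a : ℝ, (x / L * a) ^ 2 ≤ a ^ 2 := fun a => by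
        rw [mul_pow]
        exact mul_le_of_le_one_left (sq_nonneg a) (pow_le_one₀ hx0 hx1)
      have h8 : ((w₁ x - w₂ x) + x / L * U) ^ 2 ≤ 2 * (w₁ x - w₂ x) ^ 2 + 2 * U ^ 2 := by
        nlinarith [sq_nonneg ((w₁ x - w₂ x) - x / L * U), h7 U]
      have h9 := mul_le_mul_of_nonneg_left h8 (sq_nonneg Λ)
      rw [e]
      nlinarith [sq_nonneg ((f (w₁ x + x / L * u₁) - f (w₂ x + x / L * u₂)) + x / L * k), h7 k]
  rw [intervalIntegral.integral_add (hwi.const_mul _) (by simp),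
    intervalIntegral.integral_const_mul, intervalIntegral.integral_const, sub_zero,
    smul_eq_mul] at h3
  refine h3.trans ?_
  have hI : 0 ≤ ∫ x in (0 : ℝ)..L, (w₁ x - w₂ x) ^ 2 :=
    intervalIntegral.integral_nonneg hL.le fun x _ => sq_nonneg _
  have h10 := mul_le_mul_of_nonneg_left hk2 hL.le
  have h11 : 0 ≤ Λ ^ 2 * U ^ 2 := by positivity
  have h12 : 0 ≤ Λ ^ 2 * L * ∫ x in (0 : ℝ)..L, (w₁ x - w₂ x) ^ 2 := by positivity
  unfold distSq at h10 ⊢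
  nlinarith

/-- A nonnegative function bounded by a multiple of its own primitive vanishes. -/
lemma eq_zero_of_le_mul_integral {T C : ℝ} {E : ℝ → ℝ} (hE : ContinuousOn E (Icc 0 T))
    (hE0 : ∀ t ∈ Icc 0 T, 0 ≤ E t)
    (h : ∀ t ∈ Icc 0 T, E t ≤ C * ∫ s in (0 : ℝ)..t, E s) (hC : 0 ≤ C) :
    ∀ t ∈ Icc 0 T, E t = 0 := by
  intro t ht
  have hss : Icc 0 t ⊆ Icc 0 T := Icc_subset_Icc_right ht.2
  have hi : IntervalIntegrable E volume 0 t := by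
    apply ContinuousOn.intervalIntegrable
    rw [uIcc_of_le ht.1]; exact hE.mono hss
  have h1 := le_mul_exp_of_ae_le (k := -C) ht.1 (v := fun t => ∫ s in (0 : ℝ)..t, E s) hi
    (by simp) (by
      filter_upwards [ae_restrict_mem measurableSet_Ioc] with s hs
      simpa using h s (hss (Ioc_subset_Icc_self hs)))
  simp only [intervalIntegral.integral_same, zero_mul] at h1
  refine le_antisymm ((h t ht).trans ?_) (hE0 t ht)
  exact mul_nonpos_of_nonneg_of_nonpos hC h1

/-- Uniqueness, by an energy estimate for the `ℝ × L²` distance `E` of two solutions: since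
`-(jπ/L)²` has the right sign, `E` is bounded by a multiple of its own primitive. -/
theorem IsSolution.unique (hL : 0 < L) (hf : Continuous f) (hfl : IsLipschitzOnBounded f)
    (hT : 0 < T) {u₁ u₂ : ℝ → ℝ} {y₁ y₂ : ℝ → ℝ → ℝ} (h₁ : IsSolution L f n K T u₁ y₁)
    (h₂ : IsSolution L f n K T u₂ y₂) (hu : u₁ 0 = u₂ 0)
    (hy : ∀ x ∈ Icc 0 L, y₁ 0 x = y₂ 0 x) :
    ∀ t ∈ Icc 0 T, u₁ t = u₂ t ∧ ∀ x ∈ Icc 0 L, y₁ t x = y₂ t x := by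
  obtain ⟨B₁, hB₁⟩ := (isCompact_Icc.prod isCompact_Icc).exists_bound_of_continuousOn
    h₁.continuousOn_y
  obtain ⟨B₂, hB₂⟩ := (isCompact_Icc.prod isCompact_Icc).exists_bound_of_continuousOn
    h₂.continuousOn_y
  obtain ⟨Λ, hΛ0, hΛ⟩ := hfl (max B₁ B₂)
  set w₁ := shifted L u₁ y₁ with hw₁
  set w₂ := shifted L u₂ y₂ with hw₂
  set U : ℝ → ℝ := fun t => u₁ t - u₂ t with hUdef
  set E : ℝ → ℝ := fun t => distSq L (U t) (fun x => w₁ t x - w₂ t x) with hEdef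
  have hwc : ContinuousOn (fun p : ℝ × ℝ => w₁ p.1 p.2 - w₂ p.1 p.2) (Icc 0 T ×ˢ Icc 0 L) :=
    h₁.continuousOn_shifted.sub h₂.continuousOn_shifted
  have hUc : ContinuousOn U (Icc 0 T) := h₁.continuousOn_u.sub h₂.continuousOn_u
  have hEc : ContinuousOn E (Icc 0 T) :=
    (hUc.pow 2).add (continuousOn_integral_of_continuousOn_prod hT.le hL.le
      (G := fun t x => (w₁ t x - w₂ t x) ^ 2) (hwc.pow 2))
  have hE0 : ∀ t ∈ Icc 0 T, 0 ≤ E t := fun t _ =>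
    add_nonneg (sq_nonneg _) (intervalIntegral.integral_nonneg hL.le fun x _ => sq_nonneg _)
  have hs₁ : ∀ t ∈ Icc 0 T, ContinuousOn (w₁ t) (Icc 0 L) :=
    fun t ht => h₁.continuousOn_shifted_slice ht
  have hs₂ : ∀ t ∈ Icc 0 T, ContinuousOn (w₂ t) (Icc 0 L) :=
    fun t ht => h₂.continuousOn_shifted_slice ht
  have hKK := dotProduct_self_nonneg' K
  set A := 4 * Λ ^ 2 * (1 + L) + 2 * L * (K ⬝ᵥ K) with hA
  have hA0 : 0 ≤ A := by positivity
  have hforc : ∀ t ∈ Icc 0 T, ∫ x in (0 : ℝ)..L,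
      (forcing L f n K (u₁ t) (w₁ t) x - forcing L f n K (u₂ t) (w₂ t) x) ^ 2 ≤ A * E t := by
    intro t ht
    refine integral_forcing_sub_sq_le hL hf hΛ (hs₁ t ht) (hs₂ t ht) (fun x hx => ?_)
      (fun x hx => ?_)
    · rw [hw₁, shifted_add]; exact (hB₁ (t, x) ⟨ht, hx⟩).trans (le_max_left _ _)
    · rw [hw₂, shifted_add]; exact (hB₂ (t, x) ⟨ht, hx⟩).trans (le_max_right _ _)
  -- the difference of the controls
  have hUbound : ∀ t ∈ Icc 0 T, U t ^ 2 ≤ (1 + K ⬝ᵥ K) * ∫ s in (0 : ℝ)..t, E s := by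
    intro t ht
    have hD : ContinuousOn (fun s => control L n K (u₁ s) (w₁ s) - control L n K (u₂ s) (w₂ s))
        (Icc 0 T) := (h₁.continuousOn_control hL hT.le).sub (h₂.continuousOn_control hL hT.le)
    have hss : Icc 0 t ⊆ Icc 0 T := Icc_subset_Icc_right ht.2
    have hU : ∀ t ∈ Icc 0 T, U t = U 0 + ∫ s in (0 : ℝ)..t,
        (control L n K (u₁ s) (w₁ s) - control L n K (u₂ s) (w₂ s)) := by
      intro t ht
      have hss : Icc 0 t ⊆ Icc 0 T := Icc_subset_Icc_right ht.2
      rw [intervalIntegral.integral_sub]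
      · simp only [hUdef]
        rw [h₁.u_eq_integral hL t ht, h₂.u_eq_integral hL t ht]; ring
      all_goals
        apply ContinuousOn.intervalIntegrable
        rw [uIcc_of_le ht.1]
      · exact (h₁.continuousOn_control hL hT.le).mono hss
      · exact (h₂.continuousOn_control hL hT.le).mono hss
    have hU0 : U 0 = 0 := by simp [hUdef, hu]
    rw [sq_eq_add_integral hD hU ht, hU0, ← intervalIntegral.integral_const_mul]
    simp only [ne_eq, OfNat.ofNat_ne_zero, not_false_eq_true, zero_pow, zero_add]
    apply intervalIntegral.integral_mono_on ht.1
    · apply ContinuousOn.intervalIntegrable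
      rw [uIcc_of_le ht.1]
      exact (continuousOn_const.mul (hUc.mul hD)).mono hss
    · apply ContinuousOn.intervalIntegrable
      rw [uIcc_of_le ht.1]
      exact (continuousOn_const.mul hEc).mono hss
    · intro s hs
      have hk := control_sq_le_distSq (n := n) (K := K) hL (U s)
        ((hs₁ s (hss hs)).sub (hs₂ s (hss hs)))
      rw [control_sub hL (u₁ s) (u₂ s) (hs₁ s (hss hs)) (hs₂ s (hss hs))]
      have h5 : U s ^ 2 ≤ E s :=
        le_add_of_nonneg_right (intervalIntegral.integral_nonneg hL.le fun x _ => sq_nonneg _)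
      set k := control L n K (u₁ s - u₂ s) (fun x => w₁ s x - w₂ s x) with hkdef
      change k ^ 2 ≤ (K ⬝ᵥ K) * E s at hk
      nlinarith [sq_nonneg (U s - k)]
  -- the difference of the profiles, by Parseval and the sign of `-(jπ/L)²`
  have hwbound : ∀ t ∈ Icc 0 T, ∫ x in (0 : ℝ)..L, (w₁ t x - w₂ t x) ^ 2 ≤
      (1 + A) * ∫ s in (0 : ℝ)..t, E s := by
    intro t ht
    have hss : Icc 0 t ⊆ Icc 0 T := Icc_subset_Icc_right ht.2
    have hP : ∀ s ∈ Icc 0 T, HasSum (fun j => coeff L (j + 1) (fun x => w₁ s x - w₂ s x) ^ 2)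
        (∫ x in (0 : ℝ)..L, (w₁ s x - w₂ s x) ^ 2) := fun s hs =>
      hasSum_coeff_sq hL (memLp_of_continuousOn ((hs₁ s hs).sub (hs₂ s hs)))
    have hcs : ∀ s ∈ Icc 0 T, ∀ j, coeff L (j + 1) (fun x => w₁ s x - w₂ s x) =
        coeff L (j + 1) (w₁ s) - coeff L (j + 1) (w₂ s) := fun s hs j =>
      coeff_sub hL (memLp_of_continuousOn (hs₁ s hs)) (memLp_of_continuousOn (hs₂ s hs)) _
    set z : ℕ → ℝ → ℝ := fun j s => coeff L (j + 1) (w₁ s) - coeff L (j + 1) (w₂ s) with hz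
    set D : ℕ → ℝ → ℝ := fun j s => rate L f n K (u₁ s) (w₁ s) j -
      rate L f n K (u₂ s) (w₂ s) j with hDdef
    set F : ℕ → ℝ → ℝ := fun j s => coeff L (j + 1) (fun x =>
      forcing L f n K (u₁ s) (w₁ s) x - forcing L f n K (u₂ s) (w₂ s) x) with hFdef
    have hDF : ∀ s ∈ Icc 0 T, ∀ j, D j s = -(freq L (j + 1) ^ 2 * z j s) + F j s := by
      intro s hs j
      simp only [hDdef, hFdef, hz, rate]
      rw [coeff_sub hL (memLp_of_continuousOn (continuousOn_forcing hf n K _ (hs₁ s hs)))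
        (memLp_of_continuousOn (continuousOn_forcing hf n K _ (hs₂ s hs)))]
      ring
    have hFP : ∀ s ∈ Icc 0 T, HasSum (fun j => F j s ^ 2) (∫ x in (0 : ℝ)..L,
        (forcing L f n K (u₁ s) (w₁ s) x - forcing L f n K (u₂ s) (w₂ s) x) ^ 2) := fun s hs =>
      hasSum_coeff_sq hL (memLp_of_continuousOn
        ((continuousOn_forcing hf n K _ (hs₁ s hs)).sub (continuousOn_forcing hf n K _ (hs₂ s hs))))
    have hDc : ∀ j, ContinuousOn (D j) (Icc 0 T) := fun j =>
      (h₁.continuousOn_rate hL hT.le hf j).sub (h₂.continuousOn_rate hL hT.le hf j)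
    have hzc : ∀ j, ContinuousOn (z j) (Icc 0 T) := fun j =>
      (h₁.continuousOn_coeff hL hT.le _).sub (h₂.continuousOn_coeff hL hT.le _)
    have hzint : ∀ j, ∀ t ∈ Icc 0 T, z j t = z j 0 + ∫ s in (0 : ℝ)..t, D j s := by
      intro j t ht
      have hss : Icc 0 t ⊆ Icc 0 T := Icc_subset_Icc_right ht.2
      simp only [hDdef]
      rw [intervalIntegral.integral_sub]
      · simp only [hz]
        rw [h₁.coeff_eq_integral hL hf j t ht, h₂.coeff_eq_integral hL hf j t ht]; ring
      all_goals
        apply ContinuousOn.intervalIntegrable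
        rw [uIcc_of_le ht.1]
      · exact (h₁.continuousOn_rate hL hT.le hf j).mono hss
      · exact (h₂.continuousOn_rate hL hT.le hf j).mono hss
    have hz0 : ∀ j, z j 0 = 0 := by
      intro j
      rw [hz, sub_eq_zero]
      refine coeff_congr hL (fun x hx => ?_) _
      simp only [hw₁, hw₂, shifted]
      rw [hy x hx, hu]
    have h0t := hP t ht
    simp_rw [hcs t ht] at h0t
    refine h0t.tsum_eq ▸ Real.tsum_le_of_sum_le (fun j => sq_nonneg _) fun S => ?_
    have hsq : ∀ j, (coeff L (j + 1) (w₁ t) - coeff L (j + 1) (w₂ t)) ^ 2 =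
        ∫ s in (0 : ℝ)..t, 2 * (z j s * D j s) := by
      intro j
      have := sq_eq_add_integral (hDc j) (hzint j) ht
      rw [hz0] at this
      simpa using this
    have hzDi : ∀ j, IntervalIntegrable (fun s => 2 * (z j s * D j s)) volume 0 t := by
      intro j
      apply ContinuousOn.intervalIntegrable
      rw [uIcc_of_le ht.1]
      exact (continuousOn_const.mul ((hzc j).mul (hDc j))).mono hss
    simp_rw [hsq]
    rw [← intervalIntegral.integral_finsetSum fun j _ => hzDi j,
      ← intervalIntegral.integral_const_mul]
    apply intervalIntegral.integral_mono_on ht.1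
    · have := IntervalIntegrable.sum S fun j _ => hzDi j
      simpa only [Finset.sum_fn] using this
    · apply ContinuousOn.intervalIntegrable
      rw [uIcc_of_le ht.1]
      exact (continuousOn_const.mul hEc).mono hss
    · intro s hs
      have hsT := hss hs
      have h5 : ∑ j ∈ S, 2 * (z j s * D j s) ≤ ∑ j ∈ S, (z j s ^ 2 + F j s ^ 2) := by
        refine Finset.sum_le_sum fun j _ => ?_
        rw [hDF s hsT j]
        have : 0 ≤ freq L (j + 1) ^ 2 * z j s ^ 2 := by positivity
        nlinarith [sq_nonneg (z j s - F j s)]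
      have hPs := hP s hsT
      simp_rw [hcs s hsT] at hPs
      have h6 := sum_le_hasSum S (fun j _ => sq_nonneg _) hPs
      have h7 := (sum_le_hasSum S (fun j _ => sq_nonneg _) (hFP s hsT)).trans (hforc s hsT)
      have h8 : ∫ x in (0 : ℝ)..L, (w₁ s x - w₂ s x) ^ 2 ≤ E s :=
        le_add_of_nonneg_left (sq_nonneg _)
      rw [Finset.sum_add_distrib] at h5
      linarith
  have hzero := eq_zero_of_le_mul_integral hEc hE0
    (C := (1 + K ⬝ᵥ K) + (1 + A)) (fun t ht => by
      rw [add_mul]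
      exact add_le_add (hUbound t ht) (hwbound t ht)) (by positivity)
  intro t ht
  have hz := hzero t ht
  have hI : 0 ≤ ∫ x in (0 : ℝ)..L, (w₁ t x - w₂ t x) ^ 2 :=
    intervalIntegral.integral_nonneg hL.le fun x _ => sq_nonneg _
  have hsum : U t ^ 2 + ∫ x in (0 : ℝ)..L, (w₁ t x - w₂ t x) ^ 2 = 0 := hz
  have hU2 : U t ^ 2 = 0 := le_antisymm (by linarith) (sq_nonneg _)
  have hI2 : ∫ x in (0 : ℝ)..L, (w₁ t x - w₂ t x) ^ 2 = 0 :=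
    le_antisymm (by linarith [sq_nonneg (U t)]) hI
  have hut : u₁ t = u₂ t := sub_eq_zero.1 (pow_eq_zero_iff two_ne_zero |>.1 hU2)
  refine ⟨hut, fun x hx => ?_⟩
  by_contra hne
  have hne' : w₁ t x - w₂ t x ≠ 0 := by
    simp only [hw₁, hw₂, shifted, hut]
    intro h; exact hne (by linarith)
  have := intervalIntegral.integral_pos hL (((hs₁ t ht).sub (hs₂ t ht)).pow 2)
    (fun y _ => sq_nonneg _) ⟨x, hx, sq_pos_iff.2 hne'⟩
  exact absurd hI2 this.ne'

end Uniqueness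

/-! ### Mild solutions for globally Lipschitz nonlinearities -/

/-- The solution of `z' = -ν z + F`, `z(0) = a`, in the form of the variation of constants. -/
def duhamel (ν a : ℝ) (F : ℝ → ℝ) (t : ℝ) : ℝ :=
  Real.exp (-(ν * t)) * (a + ∫ s in (0 : ℝ)..t, Real.exp (ν * s) * F s)

lemma duhamel_zero_right (ν a : ℝ) (F : ℝ → ℝ) : duhamel ν a F 0 = a := by
  simp [duhamel]

lemma hasDerivAt_duhamel (ν a : ℝ) {F : ℝ → ℝ} (hF : Continuous F) (t : ℝ) :
    HasDerivAt (duhamel ν a F) (-(ν * duhamel ν a F t) + F t) t := by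
  have hc : Continuous fun s => Real.exp (ν * s) * F s := by fun_prop
  have h1 : HasDerivAt (fun t => ∫ s in (0 : ℝ)..t, Real.exp (ν * s) * F s)
      (Real.exp (ν * t) * F t) t :=
    intervalIntegral.integral_hasDerivAt_right (hc.intervalIntegrable _ _)
      (hc.stronglyMeasurableAtFilter _ _) hc.continuousAt
  have h2 : HasDerivAt (fun t => Real.exp (-(ν * t))) (Real.exp (-(ν * t)) * -(ν * 1)) t :=
    (((hasDerivAt_id t).const_mul ν).neg).exp
  refine (h2.mul (h1.const_add a)).congr_deriv ?_
  have h3 : Real.exp (-(ν * t)) * Real.exp (ν * t) = 1 := by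
    rw [← Real.exp_add]; simp
  unfold duhamel
  linear_combination F t * h3

lemma continuous_duhamel (ν a : ℝ) {F : ℝ → ℝ} (hF : Continuous F) : Continuous (duhamel ν a F) :=
  continuous_iff_continuousAt.2 fun t => (hasDerivAt_duhamel ν a hF t).continuousAt

lemma duhamel_sub (ν a b : ℝ) {F G : ℝ → ℝ} (hF : Continuous F) (hG : Continuous G) (t : ℝ) :
    duhamel ν a F t - duhamel ν b G t = duhamel ν (a - b) (fun s => F s - G s) t := by
  have h1 : Continuous fun s => Real.exp (ν * s) * F s := by fun_prop
  have h2 : Continuous fun s => Real.exp (ν * s) * G s := by fun_prop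
  unfold duhamel
  simp_rw [mul_sub]
  rw [intervalIntegral.integral_sub (h1.intervalIntegrable _ _) (h2.intervalIntegrable _ _)]
  ring

/-- The variation of constants in the norm `sup e^{-kt} |·|`: the source gains the factor
`1 / (ν + k)`. -/
lemma abs_duhamel_le {ν k : ℝ} (hν : 0 ≤ ν) (hk : 0 < k) (a : ℝ) {F : ℝ → ℝ}
    {M : ℝ} (hM : ∀ s, 0 ≤ s → |F s| ≤ M * Real.exp (k * s)) {t : ℝ} (ht : 0 ≤ t) :
    Real.exp (-(k * t)) * |duhamel ν a F t| ≤ |a| + M / (ν + k) := by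
  have hM0 : 0 ≤ M := by simpa using (abs_nonneg _).trans (hM 0 le_rfl)
  have hνk : 0 < ν + k := by positivity
  have h1 : |∫ s in (0 : ℝ)..t, Real.exp (ν * s) * F s| ≤
      M / (ν + k) * Real.exp ((ν + k) * t) := by
    have hder : ∀ s ∈ uIcc 0 t, HasDerivAt (fun s => M / (ν + k) * Real.exp ((ν + k) * s))
        (M * Real.exp ((ν + k) * s)) s := fun s _ => by
      refine ((((hasDerivAt_id s).const_mul (ν + k)).exp).const_mul (M / (ν + k))).congr_deriv ?_
      simp only [id]
      field_simp
    have hc : Continuous fun s => M * Real.exp ((ν + k) * s) := by fun_prop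
    have h2 := intervalIntegral.integral_eq_sub_of_hasDerivAt hder (hc.intervalIntegrable _ _)
    have h3 := intervalIntegral.norm_integral_le_of_norm_le ht (μ := volume)
      (f := fun s => Real.exp (ν * s) * F s) (g := fun s => M * Real.exp ((ν + k) * s))
      (Eventually.of_forall fun s hs => by
        rw [Real.norm_eq_abs, abs_mul, Real.abs_exp, add_mul, Real.exp_add]
        calc Real.exp (ν * s) * |F s| ≤ Real.exp (ν * s) * (M * Real.exp (k * s)) := by
              gcongr; exact hM s hs.1.le
          _ = _ := by ring) (hc.intervalIntegrable _ _)
    rw [h2] at h3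
    refine h3.trans ?_
    have : 0 ≤ M / (ν + k) * Real.exp ((ν + k) * 0) := by positivity
    linarith
  unfold duhamel
  rw [abs_mul, Real.abs_exp, ← mul_assoc, ← Real.exp_add]
  have h4 : Real.exp (-(k * t) + -(ν * t)) ≤ 1 := by
    rw [Real.exp_le_one_iff]; nlinarith [mul_nonneg hk.le ht, mul_nonneg hν ht]
  have h5 : Real.exp (-(k * t) + -(ν * t)) * Real.exp ((ν + k) * t) = 1 := by
    rw [← Real.exp_add, Real.exp_eq_one_iff]; ring
  calc Real.exp (-(k * t) + -(ν * t)) * |a + ∫ s in (0 : ℝ)..t, Real.exp (ν * s) * F s|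
      ≤ Real.exp (-(k * t) + -(ν * t)) * (|a| + M / (ν + k) * Real.exp ((ν + k) * t)) := by
        gcongr
        exact (abs_add_le _ _).trans (add_le_add le_rfl h1)
    _ = Real.exp (-(k * t) + -(ν * t)) * |a| +
        M / (ν + k) * (Real.exp (-(k * t) + -(ν * t)) * Real.exp ((ν + k) * t)) := by ring
    _ ≤ |a| + M / (ν + k) := by
        rw [h5, mul_one]
        gcongr
        exact mul_le_of_le_one_left (abs_nonneg a) h4

section Mild

variable {L : ℝ} {f : ℝ → ℝ} {n : ℕ} {K : Fin (n + 1) → ℝ}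

/-- The feedback `K (u, z_1, …, z_n)` as a function of the profile `p = y(t,·)`, with
`u = p(L)` and `z = p - (x/L) u`. -/
def profileControl (L : ℝ) (n : ℕ) (K : Fin (n + 1) → ℝ) (p : ℝ → ℝ) : ℝ :=
  control L n K (p L) (fun x => p x - x / L * p L)

/-- The right-hand side `f(y) - (x/L) u'` of the equation of `z`, as a function of the profile
`p = y(t,·)`. -/
def profileForcing (L : ℝ) (f : ℝ → ℝ) (n : ℕ) (K : Fin (n + 1) → ℝ) (p : ℝ → ℝ) (x : ℝ) : ℝ :=
  f (p x) - x / L * profileControl L n K p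

lemma abs_coeff_le (hL : 0 < L) (j : ℕ) {w : ℝ → ℝ} {δ : ℝ} (hw : ∀ x ∈ Icc 0 L, |w x| ≤ δ) :
    |coeff L j w| ≤ Real.sqrt (2 / L) * L * δ := by
  have h := intervalIntegral.norm_integral_le_of_norm_le_const (a := 0) (b := L)
    (f := fun x => w x * mode L j x) (C := δ * Real.sqrt (2 / L)) fun x hx => by
      rw [uIoc_of_le hL.le] at hx
      rw [Real.norm_eq_abs, abs_mul]
      have h1 := hw x (Ioc_subset_Icc_self hx)
      exact mul_le_mul h1 (abs_mode_le j x) (abs_nonneg _) ((abs_nonneg _).trans h1)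
  rw [sub_zero, abs_of_pos hL] at h
  exact h.trans (le_of_eq (by ring))

lemma abs_profileControl_sub_le (hL : 0 < L) {p q : ℝ → ℝ} (hp : Continuous p) (hq : Continuous q)
    {δ : ℝ} (h : ∀ x ∈ Icc 0 L, |p x - q x| ≤ δ) :
    |profileControl L n K p - profileControl L n K q| ≤
      Real.sqrt ((K ⬝ᵥ K) * (1 + L * 4)) * δ := by
  have hδ : 0 ≤ δ := (abs_nonneg _).trans (h 0 ⟨le_rfl, hL.le⟩)
  have hP : Continuous fun x => p x - x / L * p L := by fun_prop
  have hQ : Continuous fun x => q x - x / L * q L := by fun_prop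
  have hKK := dotProduct_self_nonneg' K
  unfold profileControl
  rw [control_sub hL _ _ hP.continuousOn hQ.continuousOn]
  apply abs_le_of_sq_le_sq _ (by positivity)
  rw [mul_pow, Real.sq_sqrt (by positivity)]
  refine (control_sq_le_distSq hL _ (hP.sub hQ).continuousOn).trans ?_
  rw [mul_assoc (K ⬝ᵥ K)]
  refine mul_le_mul_of_nonneg_left ?_ hKK
  have h1 : (p L - q L) ^ 2 ≤ δ ^ 2 := sq_le_sq.2 (by rw [abs_of_nonneg hδ]; exact h L ⟨hL.le, le_rfl⟩)
  have h2 : ∫ x in (0 : ℝ)..L, (p x - x / L * p L - (q x - x / L * q L)) ^ 2 ≤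
      ∫ x in (0 : ℝ)..L, 4 * δ ^ 2 := by
    apply intervalIntegral.integral_mono_on hL.le
    · exact ((hP.sub hQ).pow 2).intervalIntegrable _ _
    · simp
    · intro x hx
      have h3 : |x / L * (p L - q L)| ≤ δ := (abs_div_mul_le hL _ hx).trans (h L ⟨hL.le, le_rfl⟩)
      have h4 : |p x - x / L * p L - (q x - x / L * q L)| ≤ 2 * δ := by
        have e : p x - x / L * p L - (q x - x / L * q L) =
          (p x - q x) - x / L * (p L - q L) := by ring
        rw [e]
        exact (abs_sub _ _).trans (by linarith [h x hx])
      calc (p x - x / L * p L - (q x - x / L * q L)) ^ 2 ≤ (2 * δ) ^ 2 :=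
            sq_le_sq.2 (by rw [abs_of_nonneg (by positivity : 0 ≤ 2 * δ)]; exact h4)
        _ = 4 * δ ^ 2 := by ring
  rw [intervalIntegral.integral_const, smul_eq_mul, sub_zero] at h2
  change (p L - q L) ^ 2 +
    ∫ x in (0 : ℝ)..L, (p x - x / L * p L - (q x - x / L * q L)) ^ 2 ≤ _
  nlinarith

lemma continuous_profileForcing (hf : Continuous f) {p : ℝ → ℝ} (hp : Continuous p) :
    Continuous (profileForcing L f n K p) := by
  unfold profileForcing; fun_prop

/-- For a Lipschitz nonlinearity the control and all modes of the forcing are Lipschitz functions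
of the profile for the supremum norm, uniformly over the modes. -/
lemma exists_lipschitz_profile (hL : 0 < L) (n : ℕ) (K : Fin (n + 1) → ℝ) (hf : Continuous f)
    {Λ : ℝ} (hΛ0 : 0 ≤ Λ) (hΛ : ∀ a b, |f a - f b| ≤ Λ * |a - b|) :
    ∃ C ≥ 0, ∀ (p q : ℝ → ℝ) (δ : ℝ), Continuous p → Continuous q →
      (∀ x ∈ Icc 0 L, |p x - q x| ≤ δ) →
      |profileControl L n K p - profileControl L n K q| ≤ C * δ ∧
      ∀ j, |coeff L (j + 1) (profileForcing L f n K p) -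
        coeff L (j + 1) (profileForcing L f n K q)| ≤ C * δ := by
  set k := Real.sqrt ((K ⬝ᵥ K) * (1 + L * 4)) with hk
  have hk0 : 0 ≤ k := Real.sqrt_nonneg _
  refine ⟨max k (Real.sqrt (2 / L) * L * (Λ + k)), le_max_of_le_left hk0,
    fun p q δ hp hq h => ?_⟩
  have hδ : 0 ≤ δ := (abs_nonneg _).trans (h 0 ⟨le_rfl, hL.le⟩)
  have h1 := abs_profileControl_sub_le (n := n) (K := K) hL hp hq h
  refine ⟨h1.trans (by gcongr; exact le_max_left _ _), fun j => ?_⟩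
  rw [← coeff_sub hL (memLp_of_continuousOn (continuous_profileForcing hf hp).continuousOn)
    (memLp_of_continuousOn (continuous_profileForcing hf hq).continuousOn)]
  refine (abs_coeff_le hL (j + 1) (δ := (Λ + k) * δ) fun x hx => ?_).trans ?_
  · unfold profileForcing
    have e : f (p x) - x / L * profileControl L n K p - (f (q x) - x / L * profileControl L n K q) =
      (f (p x) - f (q x)) - x / L * (profileControl L n K p - profileControl L n K q) := by ring
    rw [e]
    have h2 := (hΛ (p x) (q x)).trans (mul_le_mul_of_nonneg_left (h x hx) hΛ0)
    have h3 := (abs_div_mul_le hL (profileControl L n K p - profileControl L n K q) hx).trans h1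
    exact (abs_sub _ _).trans (by linarith)
  · rw [← mul_assoc]
    gcongr
    exact le_max_right _ _

lemma continuous_coeff {G : ℝ → ℝ → ℝ} (hG : Continuous fun p : ℝ × ℝ => G p.1 p.2) (j : ℕ) :
    Continuous fun t => coeff L j (G t) := by
  unfold coeff
  apply intervalIntegral.continuous_parametric_intervalIntegral_of_continuous'
  have := continuous_mode L j
  exact hG.mul (this.comp continuous_snd)

lemma continuous_profileControl {y : ℝ → ℝ → ℝ} (hy : Continuous fun p : ℝ × ℝ => y p.1 p.2) :
    Continuous fun t => profileControl L n K (y t) := by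
  have hyL : Continuous fun t => y t L := hy.comp (by fun_prop : Continuous fun t : ℝ => (t, L))
  unfold profileControl control dotProduct
  refine continuous_finsetSum _ fun i _ => continuous_const.mul ?_
  refine Fin.cases ?_ (fun i => ?_) i
  · simpa [stateVec] using hyL
  · simp only [stateVec, Fin.cons_succ]
    exact continuous_coeff (G := fun t x => y t x - x / L * y t L)
      (hy.sub ((continuous_snd.div_const L).mul (hyL.comp continuous_fst))) _

lemma continuous_profileForcing_prod (hf : Continuous f) {y : ℝ → ℝ → ℝ}
    (hy : Continuous fun p : ℝ × ℝ => y p.1 p.2) :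
    Continuous fun p : ℝ × ℝ => profileForcing L f n K (y p.1) p.2 := by
  have h := continuous_profileControl (L := L) (n := n) (K := K) hy
  exact (hf.comp hy).sub ((continuous_snd.div_const L).mul (h.comp continuous_fst))

/-- The mode `z_j` produced by the variation of constants from the forcing along `y`. -/
def mildMode (L : ℝ) (f : ℝ → ℝ) (n : ℕ) (K : Fin (n + 1) → ℝ) (a : ℕ → ℝ) (y : ℝ → ℝ → ℝ)
    (j : ℕ) : ℝ → ℝ :=
  duhamel (freq L (j + 1) ^ 2) (a j) (fun s => coeff L (j + 1) (profileForcing L f n K (y s)))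

/-- The integral `u₀ + ∫₀ᵗ K (u, z_1, …, z_n)` of the feedback along `y`. -/
def mildControl (L : ℝ) (n : ℕ) (K : Fin (n + 1) → ℝ) (u₀ : ℝ) (y : ℝ → ℝ → ℝ) : ℝ → ℝ :=
  duhamel 0 u₀ (fun s => profileControl L n K (y s))

lemma summable_one_div_freq_sq (hL : 0 < L) : Summable fun j => 1 / freq L (j + 1) ^ 2 := by
  have h1 : Summable fun j : ℕ => 1 / ((j + 1 : ℕ) : ℝ) ^ 2 :=
    (summable_nat_add_iff 1).2 (Real.summable_one_div_nat_pow.2 one_lt_two)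
  refine (h1.mul_left ((L / Real.pi) ^ 2)).congr fun j => ?_
  unfold freq
  have := Real.pi_pos
  field_simp

/-- For a large weight `k` the Lipschitz constant of the fixed point map is at most `1/2`, by dominated
convergence in the sum over the modes. -/
lemma exists_small_weight (hL : 0 < L) (A C : ℝ) (hC : 0 ≤ C) :
    ∃ k > 0, (Summable fun j => 1 / (freq L (j + 1) ^ 2 + k)) ∧
      A * (∑' j, C / (freq L (j + 1) ^ 2 + k)) + C / k ≤ 1 / 2 := by
  have hs := (summable_one_div_freq_sq hL).mul_left C
  have hpos : ∀ j, 0 < freq L (j + 1) ^ 2 := fun j => pow_pos (freq_pos hL j) 2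
  have h1 : Tendsto (fun k : ℝ => ∑' j, C / (freq L (j + 1) ^ 2 + k)) atTop
      (𝓝 (∑' _ : ℕ, (0 : ℝ))) := by
    refine tendsto_tsum_of_dominated_convergence hs (fun j => ?_) ?_
    · exact tendsto_const_nhds.div_atTop (tendsto_atTop_add_const_left _ _ tendsto_id)
    · filter_upwards [eventually_gt_atTop 0] with k hk j
      have := hpos j
      rw [Real.norm_eq_abs, abs_of_nonneg (by positivity), mul_one_div]
      gcongr
      linarith
  have h2 : Tendsto (fun k : ℝ => C / k) atTop (𝓝 0) := tendsto_const_nhds.div_atTop tendsto_id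
  have h3 := (h1.const_mul A).add h2
  simp only [tsum_zero, mul_zero, add_zero] at h3
  obtain ⟨k, hk, hk0⟩ := ((h3.eventually (ge_mem_nhds (show (0 : ℝ) < 1 / 2 by norm_num))).and
    (eventually_gt_atTop 0)).exists
  refine ⟨k, hk0, (summable_one_div_freq_sq hL).of_nonneg_of_le (fun j => ?_) fun j => ?_, hk⟩
  · have := hpos j
    positivity
  · have := hpos j
    gcongr
    linarith

open scoped BoundedContinuousFunction in
/-- The mild formulation has a global solution: a fixed point of a contraction of the space of
functions `y` with `e^{-kt} y(t,x)` bounded and continuous, for `k` large. -/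
theorem exists_mild_solution (hL : 0 < L) (n : ℕ) (K : Fin (n + 1) → ℝ) (hf : Continuous f)
    (hf0 : f 0 = 0) {Λ : ℝ} (hΛ0 : 0 ≤ Λ) (hΛ : ∀ a b, |f a - f b| ≤ Λ * |a - b|) (u₀ : ℝ)
    {a : ℕ → ℝ} (ha : Summable fun j => |a j|) :
    ∃ y : ℝ → ℝ → ℝ, Continuous (fun p : ℝ × ℝ => y p.1 p.2) ∧
      (∃ k > 0, ∃ b : ℕ → ℝ, Summable b ∧ ∀ j, ∀ t ≥ 0,
        |mildMode L f n K a y j t| ≤ Real.exp (k * t) * b j) ∧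
      ∀ t ≥ 0, ∀ x ∈ Icc 0 L, y t x = ∑' j, mildMode L f n K a y j t * mode L (j + 1) x +
        x / L * mildControl L n K u₀ y t := by
  obtain ⟨C, hC, hlip⟩ := exists_lipschitz_profile hL n K hf hΛ0 hΛ
  obtain ⟨k, hk, hks, hk2⟩ := exists_small_weight hL (Real.sqrt (2 / L)) C hC
  have hpos : ∀ j, 0 < freq L (j + 1) ^ 2 := fun j => pow_pos (freq_pos hL j) 2
  have hdiv : ∀ c, Summable fun j => c / (freq L (j + 1) ^ 2 + k) := fun c => by
    simpa only [mul_one_div] using hks.mul_left c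
  -- the function with weighted version `v`
  set Y : (ℝ × ℝ →ᵇ ℝ) → ℝ → ℝ → ℝ := fun v t x => Real.exp (k * t) * v (t, x) with hY
  have hYc : ∀ v, Continuous fun p : ℝ × ℝ => Y v p.1 p.2 := fun v => by
    have := v.continuous
    simp only [hY, Prod.mk.eta]
    fun_prop
  have hYs : ∀ v s, Continuous (Y v s) := fun v s =>
    (hYc v).comp (by fun_prop : Continuous fun x : ℝ => (s, x))
  have hYd : ∀ v w s, ∀ x ∈ Icc 0 L, |Y v s x - Y w s x| ≤ dist v w * Real.exp (k * s) := by
    intro v w s x _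
    simp only [hY]
    rw [← mul_sub, abs_mul, Real.abs_exp, mul_comm]
    gcongr
    exact BoundedContinuousFunction.dist_coe_le_dist (f := v) (g := w) (s, x)
  have hcF : ∀ v j, Continuous fun s => coeff L (j + 1) (profileForcing L f n K (Y v s)) :=
    fun v j => continuous_coeff (continuous_profileForcing_prod hf (hYc v)) _
  have hcK : ∀ v, Continuous fun s => profileControl L n K (Y v s) :=
    fun v => continuous_profileControl (hYc v)
  have hY0 : ∀ s, Y 0 s = fun _ => 0 := fun s => by ext x; simp [hY]
  have hK0 : profileControl L n K (fun _ => 0) = 0 := by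
    simp only [profileControl, control, stateVec, dotProduct]
    refine Finset.sum_eq_zero fun i _ => ?_
    refine Fin.cases ?_ (fun i => ?_) i <;> simp [coeff]
  have hF0 : ∀ j, coeff L (j + 1) (profileForcing L f n K (fun _ => 0)) = 0 := fun j => by
    simp [profileForcing, hK0, hf0, coeff]
  have hFd : ∀ v w j s, |coeff L (j + 1) (profileForcing L f n K (Y v s)) -
      coeff L (j + 1) (profileForcing L f n K (Y w s))| ≤ C * dist v w * Real.exp (k * s) := by
    intro v w j s
    rw [mul_assoc]
    exact (hlip _ _ _ (hYs v s) (hYs w s) (hYd v w s)).2 j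
  have hKd : ∀ v w s, |profileControl L n K (Y v s) - profileControl L n K (Y w s)| ≤
      C * dist v w * Real.exp (k * s) := by
    intro v w s
    rw [mul_assoc]
    exact (hlip _ _ _ (hYs v s) (hYs w s) (hYd v w s)).1
  have hFb : ∀ v j s, |coeff L (j + 1) (profileForcing L f n K (Y v s))| ≤
      C * ‖v‖ * Real.exp (k * s) := by
    intro v j s
    have := hFd v 0 j s
    rwa [hY0, hF0, sub_zero, dist_zero_right] at this
  have hKb : ∀ v s, |profileControl L n K (Y v s)| ≤ C * ‖v‖ * Real.exp (k * s) := by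
    intro v s
    have := hKd v 0 s
    rwa [hY0, hK0, sub_zero, dist_zero_right] at this
  -- the weighted modes and the weighted control
  set Z : (ℝ × ℝ →ᵇ ℝ) → ℕ → ℝ → ℝ := fun v j t =>
    Real.exp (-(k * max t 0)) * mildMode L f n K a (Y v) j (max t 0) with hZ
  set U : (ℝ × ℝ →ᵇ ℝ) → ℝ → ℝ := fun v t =>
    Real.exp (-(k * max t 0)) * mildControl L n K u₀ (Y v) (max t 0) with hU
  have hZc : ∀ v j, Continuous (Z v j) := fun v j => by
    have := continuous_duhamel (freq L (j + 1) ^ 2) (a j) (hcF v j)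
    simp only [hZ, mildMode]
    exact (by fun_prop : Continuous fun t : ℝ => Real.exp (-(k * max t 0))).mul
      (this.comp (by fun_prop))
  have hUc : ∀ v, Continuous (U v) := fun v => by
    have := continuous_duhamel 0 u₀ (hcK v)
    simp only [hU, mildControl]
    exact (by fun_prop : Continuous fun t : ℝ => Real.exp (-(k * max t 0))).mul
      (this.comp (by fun_prop))
  have hZb : ∀ v j t, |Z v j t| ≤ |a j| + C * ‖v‖ / (freq L (j + 1) ^ 2 + k) := fun v j t => by
    simp only [hZ]
    rw [abs_mul, Real.abs_exp]
    exact abs_duhamel_le (hpos j).le hk _ (fun s _ => hFb v j s) (le_max_right t 0)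
  have hUb : ∀ v t, |U v t| ≤ |u₀| + C * ‖v‖ / k := fun v t => by
    simp only [hU]
    rw [abs_mul, Real.abs_exp]
    have h := abs_duhamel_le le_rfl hk u₀ (fun s _ => hKb v s) (le_max_right t 0)
    rwa [zero_add] at h
  have hZd : ∀ v w j t, |Z v j t - Z w j t| ≤ C * dist v w / (freq L (j + 1) ^ 2 + k) :=
    fun v w j t => by
      simp only [hZ, mildMode]
      rw [← mul_sub, duhamel_sub _ _ _ (hcF v j) (hcF w j), abs_mul, Real.abs_exp, sub_self]
      have h := abs_duhamel_le (hpos j).le hk 0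
        (fun s _ => hFd v w j s) (le_max_right t 0)
      rwa [abs_zero, zero_add] at h
  have hUd : ∀ v w t, |U v t - U w t| ≤ C * dist v w / k := fun v w t => by
    simp only [hU, mildControl]
    rw [← mul_sub, duhamel_sub _ _ _ (hcK v) (hcK w), abs_mul, Real.abs_exp, sub_self]
    have h := abs_duhamel_le le_rfl hk 0
      (fun s _ => hKd v w s) (le_max_right t 0)
    rwa [abs_zero, zero_add, zero_add] at h
  -- negative times and points outside of `[0,L]` are clamped, to have bounded functions on all of
  -- `ℝ × ℝ`
  set ξ : ℝ → ℝ := fun x => max 0 (min x L) / L with hξ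
  have hξc : Continuous ξ := by simp only [hξ]; fun_prop
  have hξb : ∀ x, |ξ x| ≤ 1 := fun x => by
    simp only [hξ]
    rw [abs_of_nonneg (by positivity), div_le_one hL]
    exact max_le hL.le (min_le_right _ _)
  set b : (ℝ × ℝ →ᵇ ℝ) → ℕ → ℝ := fun v j => |a j| + C * ‖v‖ / (freq L (j + 1) ^ 2 + k) with hb
  have hbs : ∀ v, Summable (b v) := fun v => ha.add (hdiv _)
  have htb : ∀ v j (p : ℝ × ℝ), ‖Z v j p.1 * mode L (j + 1) p.2‖ ≤
      b v j * Real.sqrt (2 / L) := fun v j p => by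
    rw [Real.norm_eq_abs, abs_mul]
    exact mul_le_mul (hZb v j p.1) (abs_mode_le _ _) (abs_nonneg _)
      ((abs_nonneg _).trans (hZb v j p.1))
  have hts : ∀ v (p : ℝ × ℝ), Summable fun j => Z v j p.1 * mode L (j + 1) p.2 := fun v p =>
    Summable.of_norm_bounded ((hbs v).mul_right _) fun j => htb v j p
  set Φ : (ℝ × ℝ →ᵇ ℝ) → (ℝ × ℝ →ᵇ ℝ) := fun v =>
    BoundedContinuousFunction.ofNormedAddCommGroup
      (fun p => ∑' j, Z v j p.1 * mode L (j + 1) p.2 + ξ p.2 * U v p.1)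
      ((continuous_tsum (fun j => ((hZc v j).comp continuous_fst).mul
        ((continuous_mode L _).comp continuous_snd)) ((hbs v).mul_right _) (htb v)).add
        ((hξc.comp continuous_snd).mul ((hUc v).comp continuous_fst)))
      ((∑' j, b v j * Real.sqrt (2 / L)) + (|u₀| + C * ‖v‖ / k))
      (fun p => by
        refine (norm_add_le _ _).trans (add_le_add ?_ ?_)
        · exact tsum_of_norm_bounded ((hbs v).mul_right _).hasSum fun j => htb v j p
        · rw [norm_mul]
          exact (mul_le_of_le_one_left (norm_nonneg _) (hξb _)).trans (hUb v _)) with hΦ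
  have hΦd : ∀ v w, dist (Φ v) (Φ w) ≤ 1 / 2 * dist v w := by
    intro v w
    refine (BoundedContinuousFunction.dist_le (by positivity)).2 fun p => ?_
    have e : Φ v p - Φ w p = ∑' j, (Z v j p.1 - Z w j p.1) * mode L (j + 1) p.2 +
        ξ p.2 * (U v p.1 - U w p.1) := by
      simp only [hΦ, BoundedContinuousFunction.coe_ofNormedAddCommGroup, sub_mul]
      rw [(hts v p).tsum_sub (hts w p)]
      ring
    rw [Real.dist_eq, e]
    have h1 : ‖∑' j, (Z v j p.1 - Z w j p.1) * mode L (j + 1) p.2‖ ≤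
        (∑' j, C / (freq L (j + 1) ^ 2 + k)) * (dist v w * Real.sqrt (2 / L)) := by
      refine tsum_of_norm_bounded ((hdiv C).hasSum.mul_right (dist v w * Real.sqrt (2 / L)))
        fun j => ?_
      rw [norm_mul]
      calc ‖Z v j p.1 - Z w j p.1‖ * ‖mode L (j + 1) p.2‖
          ≤ (C * dist v w / (freq L (j + 1) ^ 2 + k)) * Real.sqrt (2 / L) :=
            mul_le_mul (hZd v w j p.1) (abs_mode_le _ _) (abs_nonneg _)
              ((abs_nonneg _).trans (hZd v w j p.1))
        _ = _ := by ring
    have h2 : ‖ξ p.2 * (U v p.1 - U w p.1)‖ ≤ C / k * dist v w := by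
      rw [norm_mul]
      refine (mul_le_of_le_one_left (norm_nonneg _) (hξb _)).trans ((hUd v w _).trans ?_)
      exact le_of_eq (by ring)
    refine (norm_add_le _ _).trans ((add_le_add h1 h2).trans ?_)
    have := mul_le_mul_of_nonneg_right hk2 (dist_nonneg (x := v) (y := w))
    linarith
  have hcontr : ContractingWith (1 / 2 : NNReal) Φ := by
    refine ⟨by rw [← NNReal.coe_lt_coe]; norm_num, LipschitzWith.of_dist_le_mul fun v w => ?_⟩
    simpa using hΦd v w
  set v := ContractingWith.fixedPoint Φ hcontr with hv
  have hfix : Φ v = v := hcontr.fixedPoint_isFixedPt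
  have hexp : ∀ t, Real.exp (k * t) * Real.exp (-(k * t)) = 1 := fun t => by
    rw [← Real.exp_add]; simp
  refine ⟨Y v, hYc v, ⟨k, hk, b v, hbs v, fun j t ht => ?_⟩, fun t ht x hx => ?_⟩
  · have h1 := hZb v j t
    simp only [hZ] at h1
    rw [max_eq_left ht, abs_mul, Real.abs_exp] at h1
    calc |mildMode L f n K a (Y v) j t| = Real.exp (k * t) *
          (Real.exp (-(k * t)) * |mildMode L f n K a (Y v) j t|) := by
          rw [← mul_assoc, hexp, one_mul]
      _ ≤ _ := by gcongr
  · have h1 : v (t, x) = ∑' j, Z v j t * mode L (j + 1) x + ξ x * U v t := by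
      conv_lhs => rw [← hfix]
      rfl
    have h2 : ξ x = x / L := by
      simp only [hξ]; rw [min_eq_left hx.2, max_eq_right hx.1]
    have h3 : ∀ j, Real.exp (k * t) * (Z v j t * mode L (j + 1) x) =
        mildMode L f n K a (Y v) j t * mode L (j + 1) x := fun j => by
      simp only [hZ]
      rw [max_eq_left ht, ← mul_assoc, ← mul_assoc, hexp, one_mul]
    have h4 : Real.exp (k * t) * U v t = mildControl L n K u₀ (Y v) t := by
      simp only [hU]
      rw [max_eq_left ht, ← mul_assoc, hexp, one_mul]
    have h5 : Y v t x = Real.exp (k * t) * v (t, x) := rfl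
    rw [h5, h1, mul_add, ← tsum_mul_left, h2]
    simp_rw [h3]
    rw [mul_left_comm, h4]

end Mild

/-! ### Square integrable functions on a product -/

section Product

variable {α β ι κ : Type*} [MeasurableSpace α] [MeasurableSpace β] {μ : Measure α} {ν : Measure β}

/-- The Cauchy–Schwarz inequality. -/
lemma sq_integral_mul_le {g h : α → ℝ} (hg : MemLp g 2 μ) (hh : MemLp h 2 μ) :
    (∫ x, g x * h x ∂μ) ^ 2 ≤ (∫ x, g x ^ 2 ∂μ) * ∫ x, h x ^ 2 ∂μ := by
  have h1 := real_inner_mul_inner_self_le (hg.toLp g) (hh.toLp h)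
  rw [inner_toLp, inner_toLp, inner_toLp] at h1
  simpa only [← sq] using h1

lemma memLp_slice [SFinite ν] [SFinite μ] {G : α × β → ℝ} (hG : StronglyMeasurable G)
    (h : MemLp G 2 (μ.prod ν)) : ∀ᵐ t ∂μ, MemLp (fun x => G (t, x)) 2 ν := by
  have h1 := (memLp_two_iff_integrable_sq hG.aestronglyMeasurable).1 h
  filter_upwards [h1.prod_right_ae] with t ht
  exact (memLp_two_iff_integrable_sq
    (hG.comp_measurable measurable_prodMk_left).aestronglyMeasurable).2 ht

/-- Integrating out one variable against an `L²` function preserves square integrability. -/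
lemma memLp_integral_mul [SFinite ν] [SFinite μ] {G : α × β → ℝ} (hG : StronglyMeasurable G)
    (h : MemLp G 2 (μ.prod ν)) {e : β → ℝ} (he : StronglyMeasurable e) (hee : MemLp e 2 ν) :
    MemLp (fun t => ∫ x, G (t, x) * e x ∂ν) 2 μ := by
  have hm : StronglyMeasurable fun t => ∫ x, G (t, x) * e x ∂ν :=
    (hG.mul (he.comp_measurable measurable_snd)).integral_prod_right
  refine (memLp_two_iff_integrable_sq hm.aestronglyMeasurable).2 ?_
  have h1 := ((memLp_two_iff_integrable_sq hG.aestronglyMeasurable).1 h).integral_prod_left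
  refine (h1.mul_const (∫ x, e x ^ 2 ∂ν)).mono' (hm.pow 2).aestronglyMeasurable ?_
  filter_upwards [memLp_slice hG h] with t ht
  rw [Real.norm_eq_abs, abs_of_nonneg (sq_nonneg _)]
  exact sq_integral_mul_le ht hee

lemma memLp_mul_prod [SFinite ν] [SFinite μ] {e : α → ℝ} {g : β → ℝ} (he : MemLp e 2 μ)
    (hg : MemLp g 2 ν) : MemLp (fun p : α × β => e p.1 * g p.2) 2 (μ.prod ν) := by
  have hm : AEStronglyMeasurable (fun p : α × β => e p.1 * g p.2) (μ.prod ν) :=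
    he.1.comp_fst.mul hg.1.comp_snd
  refine (memLp_two_iff_integrable_sq hm).2 ?_
  simp_rw [mul_pow]
  exact he.integrable_sq.mul_prod hg.integrable_sq

/-- Products of the members of two orthonormal families form an orthonormal family. -/
lemma IsOrthonormalFamily.prod [SFinite ν] [SFinite μ] {e : ι → α → ℝ} {g : κ → β → ℝ}
    (he : IsOrthonormalFamily μ e) (hg : IsOrthonormalFamily ν g) :
    IsOrthonormalFamily (μ.prod ν) (fun (i : ι × κ) (p : α × β) => e i.1 p.1 * g i.2 p.2) := by
  have hint : ∀ i j : ι × κ, ∫ p : α × β, e i.1 p.1 * g i.2 p.2 * (e j.1 p.1 * g j.2 p.2)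
      ∂(μ.prod ν) = (∫ x, e i.1 x * e j.1 x ∂μ) * ∫ x, g i.2 x * g j.2 x ∂ν := by
    intro i j
    rw [← integral_prod_mul]
    exact integral_congr_ae (Eventually.of_forall fun p => by ring)
  refine ⟨fun i => memLp_mul_prod (he.memLp _) (hg.memLp _), fun i => ?_, fun i j hij => ?_⟩
  · rw [hint, he.integral_self, hg.integral_self, mul_one]
  · rw [hint]
    by_cases h1 : i.1 = j.1
    · have h2 : i.2 ≠ j.2 := fun h2 => hij (Prod.ext h1 h2)
      rw [hg.integral_ne _ _ h2, mul_zero]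
    · rw [he.integral_ne _ _ h1, zero_mul]

end Product

/-- A square summable family of functions of time is the family of sine coefficients of a
jointly measurable square integrable function. -/
theorem exists_coeff_slice_eq {L T : ℝ} (hL : 0 < L) (hT : 0 < T) {h : ℕ → ℝ → ℝ}
    (hc : ∀ j, Continuous (h j)) (hs : Summable fun j => ∫ t in (0 : ℝ)..T, h j t ^ 2) :
    ∃ G : ℝ × ℝ → ℝ, StronglyMeasurable G ∧
      MemLp G 2 ((intervalMeasure T).prod (intervalMeasure L)) ∧
      ∀ j, ∀ᵐ t ∂(intervalMeasure T), coeff L (j + 1) (fun x => G (t, x)) = h j t := by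
  have hmem : ∀ j, MemLp (h j) 2 (intervalMeasure T) :=
    fun j => memLp_of_continuousOn (hc j).continuousOn
  have hP := fun j => hasSum_coeff_sq hT (hmem j)
  have hsum : Summable fun i : ℕ × ℕ => coeff T (i.2 + 1) (h i.1) ^ 2 := by
    refine (summable_prod_of_nonneg fun i => sq_nonneg _).2 ⟨fun j => (hP j).summable, ?_⟩
    refine hs.congr fun j => ?_
    exact (hP j).tsum_eq.symm
  have hsum' : Summable fun i : ℕ × ℕ => coeff T (i.1 + 1) (h i.2) ^ 2 :=
    (Equiv.prodComm ℕ ℕ).summable_iff.1 hsum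
  obtain ⟨G, hGm, hG, hcoef⟩ := ((isOrthonormalFamily_mode hT).prod
    (isOrthonormalFamily_mode hL)).exists_coeff_eq hsum'
  refine ⟨G, hGm, hG, fun j => ?_⟩
  have hmode : ∀ j, MemLp (mode L j) 2 (intervalMeasure L) :=
    fun j => memLp_of_continuousOn (continuous_mode L j).continuousOn
  have hmodeT : ∀ j, MemLp (mode T j) 2 (intervalMeasure T) :=
    fun j => memLp_of_continuousOn (continuous_mode T j).continuousOn
  have hg := memLp_integral_mul hGm hG (continuous_mode L (j + 1)).stronglyMeasurable (hmode _)
  have hz := isCompleteFamily_mode hT _ (hg.sub (hmem j)) fun k => by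
    have h1 : ∫ t, (∫ x, G (t, x) * mode L (j + 1) x ∂(intervalMeasure L)) * mode T (k + 1) t
        ∂(intervalMeasure T) = coeff T (k + 1) (h j) := by
      rw [← hcoef (k, j), integral_prod _ (integrable_mul_of_memLp hG
        (memLp_mul_prod (hmodeT (k + 1)) (hmode (j + 1))))]
      refine integral_congr_ae (Eventually.of_forall fun t => ?_)
      simp only
      rw [← integral_mul_const]
      exact integral_congr_ae (Eventually.of_forall fun x => by ring)
    simp only [Pi.sub_apply, sub_mul]
    rw [integral_sub (integrable_mul_of_memLp hg (hmodeT _))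
      (integrable_mul_of_memLp (hmem j) (hmodeT _)), h1, coeff_eq hT, sub_self]
  filter_upwards [hz] with t ht
  rw [coeff_eq hL]
  exact sub_eq_zero.1 ht

/-! ### Sine series -/

lemma continuous_tsum_mode {L : ℝ} {c : ℕ → ℝ} (hc : Summable fun j => |c j|) :
    Continuous fun x => ∑' j, c j * mode L (j + 1) x := by
  refine continuous_tsum (fun j => continuous_const.mul (continuous_mode L _))
    (hc.mul_right (Real.sqrt (2 / L))) fun j x => ?_
  rw [norm_mul]
  exact mul_le_mul_of_nonneg_left (abs_mode_le _ _) (norm_nonneg _)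

/-- The coefficients of an absolutely convergent sine series. -/
lemma coeff_tsum_mode {L : ℝ} (hL : 0 < L) {c : ℕ → ℝ} (hc : Summable fun j => |c j|) (j : ℕ) :
    coeff L (j + 1) (fun x => ∑' i, c i * mode L (i + 1) x) = c j := by
  have hcont : ∀ i, Continuous fun x => c i * mode L (i + 1) x * mode L (j + 1) x := fun i =>
    (continuous_const.mul (continuous_mode L _)).mul (continuous_mode L _)
  have hb : ∀ i x, ‖c i * mode L (i + 1) x * mode L (j + 1) x‖ ≤ |c i| * (2 / L) := by
    intro i x
    have h0 : Real.sqrt (2 / L) * Real.sqrt (2 / L) = 2 / L := Real.mul_self_sqrt (by positivity)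
    rw [norm_mul, norm_mul, mul_assoc, ← h0]
    exact mul_le_mul_of_nonneg_left (mul_le_mul (abs_mode_le _ _) (abs_mode_le _ _)
      (abs_nonneg _) (Real.sqrt_nonneg _)) (norm_nonneg _)
  have h1 := hasSum_integral_of_summable_integral_norm (μ := intervalMeasure L)
    (F := fun i x => c i * mode L (i + 1) x * mode L (j + 1) x)
    (fun i => (memLp_of_continuousOn (hcont i).continuousOn).integrable one_le_two)
    ((hc.mul_right (2 / L * L)).of_nonneg_of_le (fun i => integral_nonneg fun x => norm_nonneg _)
      fun i => by
        have h2 := norm_integral_le_of_norm_le_const (μ := intervalMeasure L)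
          (f := fun x => ‖c i * mode L (i + 1) x * mode L (j + 1) x‖) (C := |c i| * (2 / L))
          (Eventually.of_forall fun x => by rw [norm_norm]; exact hb i x)
        have h3 : (intervalMeasure L).real univ = L := by
          simp [intervalMeasure, hL.le]
        rw [h3] at h2
        exact (le_abs_self _).trans (h2.trans (le_of_eq (by ring))))
  have h2 : ∀ i, ∫ x, c i * mode L (i + 1) x * mode L (j + 1) x ∂(intervalMeasure L) =
      if i = j then c j else 0 := by
    intro i
    simp_rw [mul_assoc]
    rw [integral_const_mul, ← intervalIntegral.integral_of_le hL.le, integral_mode_mul_mode hL]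
    split_ifs with h
    · rw [h, mul_one]
    · rw [mul_zero]
  simp_rw [h2] at h1
  rw [coeff_eq hL, (hasSum_ite_eq j (c j)).unique h1]
  exact integral_congr_ae (Eventually.of_forall fun x => by simp only; rw [tsum_mul_right])

lemma HasL2Deriv.congr {a b : ℝ} {w g w' g' : ℝ → ℝ} (h : HasL2Deriv a b w g)
    (hab : a ≤ b) (hw : EqOn w' w (Icc a b)) (hg : EqOn g' g (Icc a b)) :
    HasL2Deriv a b w' g' := by
  refine ⟨h.1.ae_eq ?_, fun x hx => ?_⟩
  · filter_upwards [ae_restrict_mem measurableSet_Ioc] with x hx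
    exact (hg (Ioc_subset_Icc_self hx)).symm
  · rw [hw hx, hw (left_mem_Icc.2 hab), h.2 x hx]
    congr 1
    refine intervalIntegral.integral_congr fun s hs => (hg ?_).symm
    rw [uIcc_of_le hx.1] at hs
    exact ⟨hs.1, hs.2.trans hx.2⟩

/-- A function with prescribed boundary values whose sine coefficients, after subtraction of the
affine interpolation of the boundary values, are those of the solution of `w'' = g`, is that
solution. -/
lemma hasL2Deriv_of_coeff_eq {L U : ℝ} (hL : 0 < L) {w g : ℝ → ℝ} (hw : ContinuousOn w (Icc 0 L))
    (hg : MemLp g 2 (intervalMeasure L))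
    (hc : ∀ j, coeff L (j + 1) g =
      -(freq L (j + 1) ^ 2 * coeff L (j + 1) (fun x => w x - x / L * U))) :
    ∃ q : ℝ → ℝ, (∀ x, q x = U / L + (∫ s in (0 : ℝ)..x, g s) -
      (∫ x in (0 : ℝ)..L, ∫ s in (0 : ℝ)..x, g s) / L) ∧
      HasL2Deriv 0 L w q ∧ HasL2Deriv 0 L q g := by
  have hgi := intervalIntegrable_of_memLp hL.le hg
  set p : ℝ → ℝ := fun x => ∫ s in (0 : ℝ)..x, g s with hp
  have hpc : ContinuousOn p (Icc 0 L) := by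
    have := intervalIntegral.continuousOn_primitive_interval' hgi left_mem_uIcc
    rwa [uIcc_of_le hL.le] at this
  set m := (∫ x in (0 : ℝ)..L, p x) / L with hm
  set q : ℝ → ℝ := fun x => p x - m with hq
  have hqc : ContinuousOn q (Icc 0 L) := hpc.sub continuousOn_const
  have hqg : HasL2Deriv 0 L q g := ⟨hg, fun x _ => by simp only [hq, hp]; simp; ring⟩
  set r : ℝ → ℝ := fun x => ∫ s in (0 : ℝ)..x, q s with hr
  have hrq : HasL2Deriv 0 L r q := ⟨memLp_of_continuousOn hqc, fun x _ => by simp [hr]⟩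
  have hr0 : r 0 = 0 := by simp [hr]
  have hrL : r L = 0 := by
    simp only [hr, hq]
    rw [intervalIntegral.integral_sub (by
      apply ContinuousOn.intervalIntegrable
      rwa [uIcc_of_le hL.le]) (by simp), intervalIntegral.integral_const, smul_eq_mul, hm, sub_zero]
    field_simp
    ring
  have hrc := hrq.continuousOn hL.le
  have heq : EqOn (fun x => w x - x / L * U) r (Icc 0 L) := by
    refine eqOn_of_coeff_eq hL (hw.sub (by fun_prop)) hrc fun j => ?_
    have h1 := coeff_second_deriv hL hr0 hrL hrq hqg j
    rw [hc j] at h1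
    have h2 : freq L (j + 1) ^ 2 ≠ 0 := (pow_pos (freq_pos hL j) 2).ne'
    exact mul_left_cancel₀ h2 (neg_injective h1)
  have hw' : ∀ x ∈ Icc 0 L, w x = r x + x / L * U := fun x hx => by
    rw [← heq hx]; ring
  refine ⟨fun x => U / L + p x - m, fun x => rfl, ⟨?_, fun x hx => ?_⟩, hg, fun x hx => ?_⟩
  · exact memLp_of_continuousOn ((continuousOn_const.add hpc).sub continuousOn_const)
  · have hqi : IntervalIntegrable q volume 0 x := by
      apply ContinuousOn.intervalIntegrable
      rw [uIcc_of_le hx.1]; exact hqc.mono (Icc_subset_Icc_right hx.2)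
    have e : (fun s => U / L + p s - m) = fun s => U / L + q s := by
      ext s; simp only [hq]; ring
    rw [e, intervalIntegral.integral_add (by simp) hqi, hw' x hx, hw' 0 ⟨le_rfl, hL.le⟩, hr0]
    simp only [hr, intervalIntegral.integral_const, smul_eq_mul]
    ring
  · simp [hp]; ring

/-! ### Regularity of mild solutions -/

/-- The energy estimate for `z' = -ν z + F`. -/
lemma mul_sq_integral_le {ν T : ℝ} (hν : 0 ≤ ν) (hT : 0 ≤ T) {z F : ℝ → ℝ} (hF : Continuous F)
    (hz : ∀ t, HasDerivAt z (-(ν * z t) + F t) t) :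
    ∫ t in (0 : ℝ)..T, (-(ν * z t)) ^ 2 ≤ ν * z 0 ^ 2 + ∫ t in (0 : ℝ)..T, F t ^ 2 := by
  have hzc : Continuous z := continuous_iff_continuousAt.2 fun t => (hz t).continuousAt
  have hD : Continuous fun t => -(ν * z t) + F t := by fun_prop
  have h1 := sq_eq_add_integral hD.continuousOn
    (fun t _ => eq_integral_of_hasDerivAt hz hD 0 t) (T := T) (t := T) ⟨hT, le_rfl⟩
  have hc1 : Continuous fun t => (-(ν * z t)) ^ 2 := by fun_prop
  have hc2 : Continuous fun t => 2 * (z t * (-(ν * z t) + F t)) := by fun_prop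
  have hc3 : Continuous fun t => F t ^ 2 := by fun_prop
  have h2 : ∫ t in (0 : ℝ)..T, ((-(ν * z t)) ^ 2 + ν * (2 * (z t * (-(ν * z t) + F t)))) ≤
      ∫ t in (0 : ℝ)..T, F t ^ 2 := by
    apply intervalIntegral.integral_mono_on hT
    · exact (hc1.add (continuous_const.mul hc2)).intervalIntegrable _ _
    · exact hc3.intervalIntegrable _ _
    · intro t _
      nlinarith [sq_nonneg (ν * z t - F t)]
  have hc4 : Continuous fun t => ν * (2 * (z t * (-(ν * z t) + F t))) := by fun_prop
  rw [intervalIntegral.integral_add (hc1.intervalIntegrable _ _)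
    (hc4.intervalIntegrable _ _), intervalIntegral.integral_const_mul] at h2
  have h3 : 0 ≤ ν * z T ^ 2 := by positivity
  rw [h1] at h3
  linarith

/-- The integrals of the squared coefficients of a continuous function are summable. -/
lemma summable_integral_coeff_sq {L T : ℝ} (hL : 0 < L) (hT : 0 ≤ T) {G : ℝ → ℝ → ℝ}
    (hG : Continuous fun p : ℝ × ℝ => G p.1 p.2) :
    Summable fun j => ∫ t in (0 : ℝ)..T, coeff L (j + 1) (G t) ^ 2 := by
  have hs : ∀ t, Continuous (G t) := fun t => hG.comp (by fun_prop : Continuous fun x : ℝ => (t, x))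
  refine summable_of_sum_le (c := ∫ t in (0 : ℝ)..T, ∫ x in (0 : ℝ)..L, G t x ^ 2)
    (fun j => intervalIntegral.integral_nonneg hT fun t _ => sq_nonneg _) fun S => ?_
  have hc : ∀ j, Continuous fun t => coeff L (j + 1) (G t) ^ 2 := fun j =>
    (continuous_coeff hG _).pow 2
  rw [← intervalIntegral.integral_finsetSum fun j _ => (hc j).intervalIntegrable _ _]
  apply intervalIntegral.integral_mono_on hT
  · exact (continuous_finsetSum _ fun j _ => hc j).intervalIntegrable _ _
  · refine (intervalIntegral.continuous_parametric_intervalIntegral_of_continuous' ?_ _ _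
      ).intervalIntegrable _ _
    exact hG.pow 2
  · intro t _
    exact sum_le_hasSum S (fun j _ => sq_nonneg _)
      (hasSum_coeff_sq hL (memLp_of_continuousOn (hs t).continuousOn))

/-- If the coefficients of `y(t,·)` are the primitives of the coefficients of `yt`, then `yt` is
the derivative of `y` in time, almost everywhere in space. -/
lemma ae_hasL2Deriv_of_coeff_eq {L T : ℝ} (hL : 0 < L) (hT : 0 < T) {y yt : ℝ → ℝ → ℝ}
    (hy : Continuous fun p : ℝ × ℝ => y p.1 p.2)
    (hm : StronglyMeasurable fun p : ℝ × ℝ => yt p.1 p.2)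
    (hyt : MemLp (fun p : ℝ × ℝ => yt p.1 p.2) 2 ((intervalMeasure T).prod (intervalMeasure L)))
    (hc : ∀ j, ∀ t ∈ Icc 0 T, coeff L (j + 1) (y t) = coeff L (j + 1) (y 0) +
      ∫ s in (0 : ℝ)..t, coeff L (j + 1) (yt s)) :
    ∀ᵐ x ∂(intervalMeasure L), HasL2Deriv 0 T (fun t => y t x) (fun t => yt t x) := by
  have hys : ∀ t, Continuous (y t) := fun t => hy.comp (by fun_prop : Continuous fun x : ℝ => (t, x))
  have hmode : ∀ j, MemLp (mode L j) 2 (intervalMeasure L) :=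
    fun j => memLp_of_continuousOn (continuous_mode L j).continuousOn
  -- the primitive of `yt` at a fixed time, as a function of `x`
  have hprim : ∀ t ∈ Icc 0 T, ∀ᵐ x ∂(intervalMeasure L),
      y t x = y 0 x + ∫ s in (0 : ℝ)..t, yt s x := by
    intro t ht
    have hle : (intervalMeasure t).prod (intervalMeasure L) ≤
        (intervalMeasure T).prod (intervalMeasure L) :=
      Measure.prod_mono (Measure.restrict_mono (Ioc_subset_Ioc_right ht.2) le_rfl) le_rfl
    have hytt := hyt.mono_measure hle
    have hsw : MemLp (fun p : ℝ × ℝ => yt p.2 p.1) 2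
        ((intervalMeasure L).prod (intervalMeasure t)) :=
      hytt.comp_measurePreserving Measure.measurePreserving_swap
    have hI : MemLp (fun x => ∫ s, yt s x * 1 ∂(intervalMeasure t)) 2 (intervalMeasure L) :=
      memLp_integral_mul (G := fun p : ℝ × ℝ => yt p.2 p.1)
        (hm.comp_measurable measurable_swap) hsw stronglyMeasurable_const (memLp_const 1)
    simp only [mul_one] at hI
    have hyc : ∀ t, MemLp (y t) 2 (intervalMeasure L) := fun t =>
      memLp_of_continuousOn (hys t).continuousOn
    have h0 := isCompleteFamily_mode hL (fun x => (y t x - y 0 x) -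
        ∫ s, yt s x ∂(intervalMeasure t)) (((hyc t).sub (hyc 0)).sub hI) fun j => by
      simp only [sub_mul]
      have hd : Integrable (fun x => y t x * mode L (j + 1) x - y 0 x * mode L (j + 1) x)
          (intervalMeasure L) := (integrable_mul_of_memLp (hyc t) (hmode _)).sub
        (integrable_mul_of_memLp (hyc 0) (hmode _))
      rw [integral_sub hd (integrable_mul_of_memLp hI (hmode _)),
        integral_sub (integrable_mul_of_memLp (hyc t) (hmode _))
          (integrable_mul_of_memLp (hyc 0) (hmode _)), ← coeff_eq hL, ← coeff_eq hL, hc j t ht]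
      have hint : Integrable (fun p : ℝ × ℝ => yt p.1 p.2 * mode L (j + 1) p.2)
          ((intervalMeasure t).prod (intervalMeasure L)) := by
        have := memLp_mul_prod (μ := intervalMeasure t) (ν := intervalMeasure L)
          (e := fun _ => (1 : ℝ)) (memLp_const 1) (hmode (j + 1))
        simp only [one_mul] at this
        exact integrable_mul_of_memLp hytt this
      have hswap := integral_integral_swap (f := fun s x => yt s x * mode L (j + 1) x) hint
      simp_rw [integral_mul_const] at hswap
      rw [← hswap, intervalIntegral.integral_of_le ht.1]
      simp_rw [coeff_eq hL]
      ring
    filter_upwards [h0] with x hx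
    rw [intervalIntegral.integral_of_le ht.1]
    have : y t x - y 0 x - ∫ s, yt s x ∂(intervalMeasure t) = 0 := hx
    linarith
  -- one null set serves all rational times, and then all times by continuity
  have hrat : ∀ᵐ x ∂(intervalMeasure L), ∀ q : ℚ, (q : ℝ) ∈ Icc 0 T →
      y q x = y 0 x + ∫ s in (0 : ℝ)..(q : ℝ), yt s x := by
    rw [ae_all_iff]
    intro q
    by_cases hq : (q : ℝ) ∈ Icc 0 T
    · filter_upwards [hprim q hq] with x hx _ using hx
    · exact Eventually.of_forall fun x h => absurd h hq
  have hsl := memLp_slice (G := fun p : ℝ × ℝ => yt p.2 p.1) (hm.comp_measurable measurable_swap)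
    (hyt.comp_measurePreserving Measure.measurePreserving_swap)
  filter_upwards [hrat, hsl] with x hx hmem
  refine ⟨hmem, ?_⟩
  have hi := intervalIntegrable_of_memLp hT.le hmem
  have hcont : ContinuousOn (fun t => y 0 x + ∫ s in (0 : ℝ)..t, yt s x) (Icc 0 T) := by
    have := intervalIntegral.continuousOn_primitive_interval' hi left_mem_uIcc
    rw [uIcc_of_le hT.le] at this
    exact continuousOn_const.add this
  have hyx : Continuous fun t => y t x := hy.comp (by fun_prop : Continuous fun t : ℝ => (t, x))
  have hsub : Ioo 0 T ∩ range ((↑) : ℚ → ℝ) ⊆ Icc 0 T :=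
    inter_subset_left.trans Ioo_subset_Icc_self
  refine Set.EqOn.of_subset_closure (s := Ioo 0 T ∩ range ((↑) : ℚ → ℝ)) ?_
    hyx.continuousOn hcont hsub ?_
  · rintro t ⟨ht, q, rfl⟩
    exact hx q (Ioo_subset_Icc_self ht)
  · rw [← closure_Ioo hT.ne]
    refine closure_minimal ?_ isClosed_closure
    exact Rat.denseRange_cast.open_subset_closure_inter isOpen_Ioo

/-- Reconstruction of the spatial derivatives of `y` from a square integrable function `G` with
the coefficients of `y_xx`. -/
lemma exists_ae_hasL2Deriv_of_coeff_eq {L T : ℝ} (hL : 0 < L) {y : ℝ → ℝ → ℝ} {u : ℝ → ℝ}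
    (hy : Continuous fun p : ℝ × ℝ => y p.1 p.2) (hu : Continuous u) {G : ℝ × ℝ → ℝ}
    (hGm : StronglyMeasurable G) (hG : MemLp G 2 ((intervalMeasure T).prod (intervalMeasure L)))
    (hc : ∀ j, ∀ᵐ t ∂(intervalMeasure T), coeff L (j + 1) (fun x => G (t, x)) =
      -(freq L (j + 1) ^ 2 * coeff L (j + 1) (shifted L u y t))) :
    ∃ yx : ℝ → ℝ → ℝ, MemLp (fun p : ℝ × ℝ => yx p.1 p.2) 2
        ((intervalMeasure T).prod (intervalMeasure L)) ∧
      ∀ᵐ t ∂(intervalMeasure T), HasL2Deriv 0 L (y t) (yx t) ∧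
        HasL2Deriv 0 L (yx t) (fun x => G (t, x)) := by
  have hys : ∀ t, Continuous (y t) := fun t => hy.comp (by fun_prop : Continuous fun x : ℝ => (t, x))
  -- the primitive in `x` as an integral over a fixed interval, to have joint measurability
  set I : ℝ × ℝ → ℝ := fun p => ∫ s, (if s ≤ p.2 then G (p.1, s) else 0) ∂(intervalMeasure L)
    with hI
  have hIm : StronglyMeasurable I := by
    have h1 : StronglyMeasurable fun q : (ℝ × ℝ) × ℝ =>
        if q.2 ≤ q.1.2 then G (q.1.1, q.2) else 0 :=
      StronglyMeasurable.ite (measurableSet_le measurable_snd (measurable_snd.comp measurable_fst))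
        (hGm.comp_measurable (by fun_prop)) stronglyMeasurable_const
    exact h1.integral_prod_right
  set J : ℝ → ℝ := fun t => ∫ x, I (t, x) ∂(intervalMeasure L) with hJ
  have hJm : StronglyMeasurable J := hIm.integral_prod_right
  set N : ℝ → ℝ := fun t => ∫ s, ‖G (t, s)‖ * 1 ∂(intervalMeasure L) with hN
  have hNmem : MemLp N 2 (intervalMeasure T) :=
    memLp_integral_mul (G := fun p => ‖G p‖) hGm.norm hG.norm stronglyMeasurable_const
      (memLp_const 1)
  have hIb : ∀ᵐ t ∂(intervalMeasure T), ∀ x, |I (t, x)| ≤ N t := by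
    filter_upwards [memLp_slice hGm hG] with t ht x
    simp only [hN, mul_one]
    have h1 := norm_integral_le_of_norm_le (ht.integrable one_le_two).norm
      (f := fun s => if s ≤ x then G (t, s) else 0) (Eventually.of_forall fun s => by
        split_ifs <;> simp)
    exact h1
  have hJb : ∀ᵐ t ∂(intervalMeasure T), |J t| / L ≤ N t := by
    filter_upwards [hIb] with t ht
    have h2 := norm_integral_le_of_norm_le_const (μ := intervalMeasure L)
      (f := fun x => I (t, x)) (C := N t) (Eventually.of_forall ht)
    have h3 : (intervalMeasure L).real univ = L := by simp [intervalMeasure, hL.le]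
    rw [h3] at h2
    rwa [div_le_iff₀ hL]
  refine ⟨fun t x => u t / L + I (t, x) - J t / L, ?_, ?_⟩
  · have hg : MemLp (fun t => |u t| / L + 2 * N t) 2 (intervalMeasure T) :=
      (memLp_of_continuousOn (hu.abs.div_const L).continuousOn).add (hNmem.const_mul 2)
    have hJL : StronglyMeasurable fun t => J t / L := by
      simpa only [div_eq_mul_inv] using hJm.mul_const L⁻¹
    refine (hg.comp_fst (intervalMeasure L)).mono' ?_ ?_
    · exact ((((hu.div_const L).stronglyMeasurable.comp_measurable measurable_fst).add hIm).sub
        (hJL.comp_measurable measurable_fst)).aestronglyMeasurable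
    · have h1 : ∀ᵐ t ∂(intervalMeasure T), (∀ x, |I (t, x)| ≤ N t) ∧ |J t| / L ≤ N t :=
        hIb.and hJb
      filter_upwards [Measure.quasiMeasurePreserving_fst.ae h1] with p hp
      simp only [Prod.mk.eta, Real.norm_eq_abs]
      have h2 := hp.1 p.2
      have h3 := hp.2
      have h4 : |u p.1 / L| = |u p.1| / L := by rw [abs_div, abs_of_pos hL]
      have h5 : |J p.1 / L| = |J p.1| / L := by rw [abs_div, abs_of_pos hL]
      calc |u p.1 / L + I p - J p.1 / L| ≤ |u p.1 / L| + |I p| + |J p.1 / L| :=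
            (abs_sub _ _).trans (add_le_add (abs_add_le _ _) le_rfl)
        _ ≤ _ := by rw [h4, h5]; simp only [Prod.mk.eta] at h2; linarith
  · filter_upwards [ae_all_iff.2 hc, memLp_slice hGm hG] with t ht hmem
    obtain ⟨q, hq, h1, h2⟩ := hasL2Deriv_of_coeff_eq (U := u t) hL (hys t).continuousOn hmem ht
    have hIeq : ∀ x ∈ Icc 0 L, I (t, x) = ∫ s in (0 : ℝ)..x, G (t, s) := by
      intro x hx
      simp only [hI]
      have e : (fun s => if s ≤ x then G (t, s) else 0) =
          (Iic x).indicator (fun s => G (t, s)) := by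
        ext s; simp [indicator]
      rw [e, integral_indicator measurableSet_Iic, Measure.restrict_restrict measurableSet_Iic,
        intervalIntegral.integral_of_le hx.1]
      congr 2
      ext s
      simp only [mem_inter_iff, mem_Iic, mem_Ioc]
      exact ⟨fun h => ⟨h.2.1, h.1⟩, fun h => ⟨h.2, h.1, h.2.trans hx.2⟩⟩
    have hJeq : J t = ∫ x in (0 : ℝ)..L, ∫ s in (0 : ℝ)..x, G (t, s) := by
      rw [intervalIntegral.integral_of_le hL.le]
      refine setIntegral_congr_fun measurableSet_Ioc fun x hx => hIeq x (Ioc_subset_Icc_self hx)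
    have heq : EqOn (fun x => u t / L + I (t, x) - J t / L) q (Icc 0 L) := fun x hx => by
      simp only
      rw [hq, hIeq x hx, hJeq]
    exact ⟨h1.congr hL.le (fun _ _ => rfl) heq, h2.congr hL.le heq (fun _ _ => rfl)⟩

section Existence

variable {L : ℝ} {f : ℝ → ℝ} {n : ℕ} {K : Fin (n + 1) → ℝ}

/-- The sine series of a function in `H¹₀` converges absolutely, as `2 |w_j|` is at most
`(jπ/L)² w_j² + (jπ/L)⁻²`. -/
lemma summable_abs_coeff (hL : 0 < L) {w : ℝ → ℝ} (hw : MemH10 L w) :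
    Summable fun j => |coeff L (j + 1) w| := by
  refine ((hasSum_h10Norm_sq hL hw).summable.add (summable_one_div_freq_sq hL)).of_nonneg_of_le
    (fun j => abs_nonneg _) fun j => ?_
  have h0 := freq_pos hL j
  set r := freq L (j + 1) with hr
  set a := |coeff L (j + 1) w| with ha
  rw [← sq_abs (coeff L (j + 1) w), ← ha]
  have h1 : 0 ≤ (r * a - 1 / r) ^ 2 := sq_nonneg _
  have h2 : (r * a - 1 / r) ^ 2 = r ^ 2 * a ^ 2 + 1 / r ^ 2 - 2 * a := by field_simp; ring
  have h3 : 0 ≤ a := abs_nonneg _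
  linarith

/-- For a globally Lipschitz nonlinearity every initial state in `ℝ × H¹₀` generates a global
solution. -/
theorem exists_isSolution_of_lipschitz (hL : 0 < L) (n : ℕ) (K : Fin (n + 1) → ℝ)
    (hf : Continuous f) (hf0 : f 0 = 0) {Λ : ℝ} (hΛ0 : 0 ≤ Λ)
    (hΛ : ∀ a b, |f a - f b| ≤ Λ * |a - b|) (u₀ : ℝ) {z₀ : ℝ → ℝ} (hz₀ : MemH10 L z₀) :
    ∃ (u : ℝ → ℝ) (y : ℝ → ℝ → ℝ), (∀ T > 0, IsSolution L f n K T u y) ∧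
      u 0 = u₀ ∧ ∀ x ∈ Icc 0 L, y 0 x = z₀ x + x / L * u₀ := by
  have ha := summable_abs_coeff hL hz₀
  obtain ⟨y, hy, ⟨k, hk, b, hb, hZb⟩, hyeq⟩ := exists_mild_solution hL n K hf hf0 hΛ0 hΛ u₀ ha
  set Z := mildMode L f n K (fun j => coeff L (j + 1) z₀) y with hZ
  set u := mildControl L n K u₀ y with hu
  have hPF := continuous_profileForcing_prod (L := L) (n := n) (K := K) hf hy
  set F : ℕ → ℝ → ℝ := fun j s => coeff L (j + 1) (profileForcing L f n K (y s)) with hF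
  have hFc : ∀ j, Continuous (F j) := fun j => continuous_coeff hPF _
  have hκc : Continuous fun s => profileControl L n K (y s) := continuous_profileControl hy
  have hZd : ∀ j t, HasDerivAt (Z j) (-(freq L (j + 1) ^ 2 * Z j t) + F j t) t := fun j t =>
    hasDerivAt_duhamel _ _ (hFc j) t
  have hud : ∀ t, HasDerivAt u (profileControl L n K (y t)) t := fun t =>
    (hasDerivAt_duhamel 0 u₀ hκc t).congr_deriv (by ring)
  have hZc : ∀ j, Continuous (Z j) := fun j =>
    continuous_iff_continuousAt.2 fun t => (hZd j t).continuousAt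
  have huc : Continuous u := continuous_iff_continuousAt.2 fun t => (hud t).continuousAt
  have hu0 : u 0 = u₀ := duhamel_zero_right _ _ _
  have hZ0 : ∀ j, Z j 0 = coeff L (j + 1) z₀ := fun j => duhamel_zero_right _ _ _
  have hZs : ∀ t ≥ 0, Summable fun j => |Z j t| := fun t ht =>
    (hb.mul_left (Real.exp (k * t))).of_nonneg_of_le (fun j => abs_nonneg _) fun j => hZb j t ht
  have hys : ∀ t, Continuous (y t) := fun t => hy.comp (by fun_prop : Continuous fun x : ℝ => (t, x))
  have hyL : ∀ t ≥ 0, y t L = u t := fun t ht => by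
    rw [hyeq t ht L ⟨hL.le, le_rfl⟩, div_self hL.ne']
    simp [mode_right hL]
  have hsh : ∀ t ≥ 0, EqOn (shifted L u y t) (fun x => ∑' j, Z j t * mode L (j + 1) x)
      (Icc 0 L) := fun t ht x hx => by
    simp only [shifted]; rw [hyeq t ht x hx]; ring
  have hcoef : ∀ t ≥ 0, ∀ j, coeff L (j + 1) (shifted L u y t) = Z j t := fun t ht j => by
    rw [coeff_congr hL (hsh t ht), coeff_tsum_mode hL (hZs t ht)]
  have hcoefy : ∀ t ≥ 0, ∀ j, coeff L (j + 1) (y t) =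
      Z j t + u t * coeff L (j + 1) (fun x => x / L) := fun t ht j => by
    have hsc : Continuous (shifted L u y t) := by unfold shifted; have := hys t; fun_prop
    rw [← hcoef t ht j, ← coeff_const_mul, ← coeff_add hL (memLp_of_continuousOn hsc.continuousOn)
      (memLp_of_continuousOn (by fun_prop))]
    refine coeff_congr hL (fun x _ => ?_) _
    simp only [shifted]; ring
  have hF_eq : ∀ t j, coeff L (j + 1) (fun x => f (y t x)) =
      F j t + profileControl L n K (y t) * coeff L (j + 1) (fun x => x / L) := fun t j => by
    simp only [hF]
    rw [← coeff_const_mul, ← coeff_add hL (memLp_of_continuousOn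
      (continuous_profileForcing hf (hys t)).continuousOn) (memLp_of_continuousOn (by fun_prop))]
    refine coeff_congr hL (fun x _ => ?_) _
    simp only [profileForcing]; ring
  refine ⟨u, y, fun T hT => ?_, hu0, ?_⟩
  · have hsum : Summable fun j => ∫ t in (0 : ℝ)..T, (-(freq L (j + 1) ^ 2 * Z j t)) ^ 2 := by
      refine ((hasSum_h10Norm_sq hL hz₀).summable.add
        (summable_integral_coeff_sq (G := fun t => profileForcing L f n K (y t)) hL hT.le
          hPF)).of_nonneg_of_le (fun j => intervalIntegral.integral_nonneg hT.le fun t _ => sq_nonneg _) fun j => ?_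
      have := mul_sq_integral_le (pow_pos (freq_pos hL j) 2).le hT.le (hFc j) (hZd j)
      rwa [hZ0] at this
    obtain ⟨G, hGm, hG, hGc⟩ := exists_coeff_slice_eq hL hT
      (h := fun j t => -(freq L (j + 1) ^ 2 * Z j t))
      (fun j => (continuous_const.mul (hZc j)).neg) hsum
    have hGc' : ∀ j, ∀ᵐ t ∂(intervalMeasure T), coeff L (j + 1) (fun x => G (t, x)) =
        -(freq L (j + 1) ^ 2 * coeff L (j + 1) (shifted L u y t)) := fun j => by
      filter_upwards [hGc j, ae_restrict_mem measurableSet_Ioc] with t ht hmt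
      rw [hcoef t hmt.1.le, ht]
    obtain ⟨yx, hyxm, hyx⟩ := exists_ae_hasL2Deriv_of_coeff_eq hL hy huc hGm hG hGc'
    have hfy : Continuous fun p : ℝ × ℝ => f (y p.1 p.2) := hf.comp hy
    have hfyb : MemLp (fun p : ℝ × ℝ => f (y p.1 p.2)) 2
        ((intervalMeasure T).prod (intervalMeasure L)) := by
      obtain ⟨C, hC⟩ := (isCompact_Icc.prod isCompact_Icc : IsCompact (Icc 0 T ×ˢ Icc 0 L)
        ).exists_bound_of_continuousOn hfy.continuousOn
      refine MemLp.of_bound hfy.aestronglyMeasurable C ?_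
      rw [← restrict_prod_eq]
      filter_upwards [ae_restrict_mem (measurableSet_Ioc.prod measurableSet_Ioc)] with p hp
      exact hC p ⟨Ioc_subset_Icc_self hp.1, Ioc_subset_Icc_self hp.2⟩
    have hytm : StronglyMeasurable fun p : ℝ × ℝ => G (p.1, p.2) + f (y p.1 p.2) :=
      hGm.add hfy.stronglyMeasurable
    have hyt : MemLp (fun p : ℝ × ℝ => G (p.1, p.2) + f (y p.1 p.2)) 2
        ((intervalMeasure T).prod (intervalMeasure L)) := hG.add hfyb
    have hytc : ∀ j, ∀ t ∈ Icc 0 T, coeff L (j + 1) (y t) = coeff L (j + 1) (y 0) +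
        ∫ s in (0 : ℝ)..t, coeff L (j + 1) (fun x => G (s, x) + f (y s x)) := by
      intro j t ht
      have h1 : ∫ s in (0 : ℝ)..t, coeff L (j + 1) (fun x => G (s, x) + f (y s x)) =
          ∫ s in (0 : ℝ)..t, ((-(freq L (j + 1) ^ 2 * Z j s) + F j s) +
            profileControl L n K (y s) * coeff L (j + 1) (fun x => x / L)) := by
        rw [intervalIntegral.integral_of_le ht.1, intervalIntegral.integral_of_le ht.1]
        refine integral_congr_ae (ae_mono (Measure.restrict_mono (Ioc_subset_Ioc_right ht.2)
          le_rfl) ?_)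
        filter_upwards [hGc j, memLp_slice hGm hG] with s hs hmem
        rw [coeff_add (v := fun x => G (s, x)) (w := fun x => f (y s x)) hL hmem
          (memLp_of_continuousOn (hf.comp (hys s)).continuousOn), hs, hF_eq]
        ring
      have hDc : Continuous fun s => -(freq L (j + 1) ^ 2 * Z j s) + F j s :=
        (continuous_const.mul (hZc j)).neg.add (hFc j)
      have hκξ : Continuous fun s =>
          profileControl L n K (y s) * coeff L (j + 1) (fun x => x / L) := hκc.mul continuous_const
      rw [h1, intervalIntegral.integral_add (hDc.intervalIntegrable _ _)
        (hκξ.intervalIntegrable _ _), intervalIntegral.integral_mul_const,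
        hcoefy t ht.1, hcoefy 0 le_rfl, eq_integral_of_hasDerivAt (hZd j) hDc 0 t,
        eq_integral_of_hasDerivAt hud hκc 0 t]
      ring
    refine ⟨⟨fun t x => G (t, x) + f (y t x), yx, fun t x => G (t, x), ⟨hy.continuousOn, ?_, ?_, ?_,
      ae_hasL2Deriv_of_coeff_eq hL hT hy hytm hyt hytc, hyx⟩, Eventually.of_forall fun p => rfl⟩,
      fun t ht => ?_, fun t ht => hyL t ht.1, fun t ht => ?_⟩
    · rwa [restrict_prod_eq]
    · rwa [restrict_prod_eq]
    · rwa [restrict_prod_eq]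
    · rw [hyeq t ht.1 0 ⟨le_rfl, hL.le⟩]
      simp [mode_zero_right]
    · have := (hud t).hasDerivWithinAt (s := Icc 0 T)
      unfold profileControl control at this
      rw [hyL t ht.1] at this
      exact this
  · intro x hx
    have h1 : EqOn z₀ (fun x => ∑' j, Z j 0 * mode L (j + 1) x) (Icc 0 L) :=
      eqOn_of_coeff_eq hL (continuousOn_of_memH10 hL hz₀)
        (continuous_tsum_mode (hZs 0 le_rfl)).continuousOn fun j => by
          rw [coeff_tsum_mode hL (hZs 0 le_rfl), hZ0]
    rw [hyeq 0 le_rfl x hx, hu0, h1 hx]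

end Existence

/-! ### Nonlinearities of class `C²` -/

lemma isLipschitzOnBounded_of_contDiff {f : ℝ → ℝ} (hf : ContDiff ℝ 1 f) :
    IsLipschitzOnBounded f := by
  intro B
  obtain ⟨Λ, hΛ⟩ := hf.contDiffOn.exists_lipschitzOnWith (n := 1) one_ne_zero
    (convex_Icc (-B) B) isCompact_Icc
  refine ⟨Λ, Λ.2, fun a b ha hb => ?_⟩
  exact hΛ.dist_le_mul a (abs_le.1 ha) b (abs_le.1 hb)

/-- The derivative of `f(y) - f'(0) y` is `O(y)`, because `f'` is Lipschitz on bounded sets. -/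
lemma hasQuadraticRemainder_of_contDiff {f : ℝ → ℝ} (hf : ContDiff ℝ 2 f) (hf0 : f 0 = 0) :
    HasQuadraticRemainder f (deriv f 0) := by
  intro B hB
  have hd : ContDiff ℝ 1 (deriv f) := hf.deriv' (n := 1)
  obtain ⟨M, hM, hlip⟩ := isLipschitzOnBounded_of_contDiff hd B
  refine ⟨M, hM, fun y hy => ?_⟩
  have hdiff : ∀ s, HasDerivAt (fun s => f s - deriv f 0 * s) (deriv f s - deriv f 0) s := fun s =>
    ((hf.differentiable two_ne_zero s).hasDerivAt.sub
      ((hasDerivAt_id s).const_mul (deriv f 0))).congr_deriv (by simp)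
  have h := (convex_Icc (-|y|) |y|).norm_image_sub_le_of_norm_hasDerivWithin_le
    (C := M * |y|) (fun s _ => (hdiff s).hasDerivWithinAt) (fun s hs => by
      have hs' : |s| ≤ |y| := abs_le.2 hs
      have h1 := hlip s 0 (hs'.trans hy) (by simpa using hB.le)
      rw [sub_zero] at h1
      exact h1.trans (by gcongr)) (x := 0) (y := y) (by simp) (abs_le.1 le_rfl)
  simp only [hf0, mul_zero, sub_zero, Real.norm_eq_abs] at h
  rwa [mul_assoc, ← sq, sq_abs] at h

/-- The truncation of `f` outside of `[-1,1]`. -/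
def truncate (f : ℝ → ℝ) (y : ℝ) : ℝ := f (max (-1) (min y 1))

lemma truncate_eq {f : ℝ → ℝ} {y : ℝ} (hy : |y| ≤ 1) : truncate f y = f y := by
  have h := abs_le.1 hy
  rw [truncate, min_eq_left h.2, max_eq_right h.1]

lemma exists_lipschitz_truncate {f : ℝ → ℝ} (hf : IsLipschitzOnBounded f) :
    ∃ Λ ≥ 0, ∀ a b, |truncate f a - truncate f b| ≤ Λ * |a - b| := by
  obtain ⟨Λ, hΛ0, hΛ⟩ := hf 1
  refine ⟨Λ, hΛ0, fun a b => ?_⟩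
  have hb : ∀ y : ℝ, |max (-1) (min y 1)| ≤ 1 := fun y =>
    abs_le.2 ⟨le_max_left _ _, max_le (by norm_num) (min_le_right _ _)⟩
  refine (hΛ _ _ (hb a) (hb b)).trans (mul_le_mul_of_nonneg_left ?_ hΛ0)
  have h1 : |max (-1) (min a 1) - max (-1) (min b 1)| ≤ |min a 1 - min b 1| := by
    simpa using abs_max_sub_max_le_max (-1) (min a 1) (-1) (min b 1)
  have h2 : |min a 1 - min b 1| ≤ |a - b| := by
    simpa using abs_min_sub_min_le_max a 1 b 1
  exact h1.trans h2

/-- For `|y| > 1` linear growth is enough, since `|y| ≤ y²` there. -/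
lemma hasQuadraticRemainder_truncate {f : ℝ → ℝ} {c Λ : ℝ} (hf : HasQuadraticRemainder f c)
    (hf0 : f 0 = 0) (hΛ0 : 0 ≤ Λ) (hΛ : ∀ a b, |truncate f a - truncate f b| ≤ Λ * |a - b|) :
    HasQuadraticRemainder (truncate f) c := by
  intro B _
  obtain ⟨M, hM0, hM⟩ := hf 1 one_pos
  refine ⟨M + (Λ + |c|), by positivity, fun y _ => ?_⟩
  by_cases hy : |y| ≤ 1
  · rw [truncate_eq hy]
    refine (hM y hy).trans ?_
    gcongr
    linarith [abs_nonneg c]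
  · push Not at hy
    have h0 : truncate f 0 = 0 := by rw [truncate_eq (by simp), hf0]
    have h1 := hΛ y 0
    rw [h0, sub_zero, sub_zero] at h1
    have h2 : |y| ≤ y ^ 2 := by rw [← sq_abs]; nlinarith
    calc |truncate f y - c * y| ≤ |truncate f y| + |c * y| := abs_sub _ _
      _ ≤ (Λ + |c|) * |y| := by rw [abs_mul]; linarith
      _ ≤ (Λ + |c|) * y ^ 2 := by gcongr
      _ ≤ (M + (Λ + |c|)) * y ^ 2 :=
        mul_le_mul_of_nonneg_right (le_add_of_nonneg_left hM0) (sq_nonneg y)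

/-- A solution of the truncated problem with values in `[-1,1]` solves the original one. -/
lemma IsSolution.of_truncate {L T : ℝ} {f : ℝ → ℝ} {n : ℕ} {K : Fin (n + 1) → ℝ} {u : ℝ → ℝ}
    {y : ℝ → ℝ → ℝ} (h : IsSolution L (truncate f) n K T u y)
    (hy : ∀ t ∈ Icc 0 T, ∀ x ∈ Icc 0 L, |y t x| ≤ 1) : IsSolution L f n K T u y where
  equation := by
    obtain ⟨yt, yx, yxx, hmem, heq⟩ := h.equation
    refine ⟨yt, yx, yxx, hmem, ?_⟩
    filter_upwards [heq, ae_restrict_mem (measurableSet_Ioc.prod measurableSet_Ioc)] with p hp hmp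
    rw [hp, truncate_eq (hy _ (Ioc_subset_Icc_self hmp.1) _ (Ioc_subset_Icc_self hmp.2))]
  boundary_zero := h.boundary_zero
  boundary_L := h.boundary_L
  feedback := h.feedback

/-! ### Local asymptotic stability -/

lemma MemH10.congr {L : ℝ} (hL : 0 < L) {v w : ℝ → ℝ} (hw : MemH10 L w)
    (h : EqOn v w (Icc 0 L)) : MemH10 L v := by
  obtain ⟨h0, h1, g, hg⟩ := hw
  exact ⟨(h ⟨le_rfl, hL.le⟩).trans h0, (h ⟨hL.le, le_rfl⟩).trans h1, g,
    hg.congr hL.le h fun _ _ => rfl⟩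

/-- The norm depends only on the values in `[0,L]`, although `h10Norm` is written with `deriv`, which
at the end points also sees values outside. -/
lemma stateNorm_congr {L : ℝ} (hL : 0 < L) (u : ℝ) {v w : ℝ → ℝ} (hw : MemH10 L w)
    (h : EqOn v w (Icc 0 L)) : stateNorm L u v = stateNorm L u w := by
  have h1 := hasSum_h10Norm_sq hL (hw.congr hL h)
  have h2 := hasSum_h10Norm_sq hL hw
  simp_rw [coeff_congr hL h] at h1
  unfold stateNorm
  rw [h1.unique h2]

/-- Stability, attractivity and uniqueness hold for any solution of the closed loop. Existence comes
from the closed loop with `f` truncated: it has global solutions and a Lyapunov function of its own,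
so its small solutions never reach the truncation. -/
theorem isLocallyAsymptoticallyStable {L c : ℝ} (hL : 0 < L) {f : ℝ → ℝ} (hf : Continuous f)
    (hf0 : f 0 = 0) (hfl : IsLipschitzOnBounded f) (hfc : HasQuadraticRemainder f c) {n : ℕ}
    (hn : eigenvalue L c (n + 1) < 0) {K : Fin (n + 1) → ℝ} (hK : PlacesPoles L c n K) :
    IsLocallyAsymptoticallyStable L f n K := by
  obtain ⟨P, hP⟩ := exists_solvesLyapunov hK
  obtain ⟨γ₀, -, hγ⟩ := exists_isLyapunovFunction hL hf hfc hn hP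
  have hV := hγ γ₀ le_rfl
  refine ⟨?_, fun T hT u₁ u₂ y₁ y₂ h₁ h₂ hu hy => h₁.unique hL hf hfl hT h₂ hu hy,
    hV.stable hL, hV.attractive hL⟩
  -- small solutions of the truncated problem stay small, hence solve the original one
  obtain ⟨Λ, hΛ0, hΛ⟩ := exists_lipschitz_truncate hfl
  have htc : Continuous (truncate f) := by unfold truncate; fun_prop
  obtain ⟨γ₁, -, hγ₁⟩ := exists_isLyapunovFunction hL htc
    (hasQuadraticRemainder_truncate hfc hf0 hΛ0 hΛ) hn hP
  -- norm less than `1 / (1 + √L)` gives `|y| ≤ 1`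
  obtain ⟨δ, hδ, hstab⟩ := (hγ₁ γ₁ le_rfl).stable hL (1 / (1 + Real.sqrt L)) (by positivity)
  refine ⟨δ, hδ, fun u₀ z₀ hz₀ hlt => ?_⟩
  obtain ⟨u, y, hsol, hu0, hy0⟩ := exists_isSolution_of_lipschitz hL n K htc
    (by rw [truncate_eq (by simp), hf0]) hΛ0 hΛ u₀ hz₀
  have hinit : EqOn (shifted L u y 0) z₀ (Icc 0 L) := fun x hx => by
    simp only [shifted]; rw [hy0 x hx, hu0]; ring
  refine ⟨u, y, fun T hT => (hsol T hT).of_truncate fun t ht x hx => ?_, hu0, hy0⟩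
  obtain ⟨hmem, hsmall⟩ := hstab T hT u y (hsol T hT) (hz₀.congr hL hinit)
    (by rw [stateNorm_congr hL _ hz₀ hinit, hu0]; exact hlt) t ht
  have h1 := abs_add_le_mul_stateNorm hL (u t) hmem hx
  rw [shifted_add] at h1
  refine h1.trans ?_
  rw [lt_div_iff₀ (by positivity), mul_comm] at hsmall
  exact hsmall.le

end HeatStab

end

theorem mainTheorem4 (L : ℝ) (hL : 0 < L) (f : ℝ → ℝ) (hf : ContDiff ℝ 2 f) (hf0 : f 0 = 0) :
    HeatStab.IsDirichletEigenbasis L (deriv f 0) (fun j => HeatStab.mode L (j + 1))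
      (fun j => HeatStab.eigenvalue L (deriv f 0) (j + 1)) ∧
    (∀ z : ℝ → ℝ, HeatStab.MemH10 L z →
      Summable (fun j : ℕ => HeatStab.eigenvalue L (deriv f 0) (j + 1) *
        HeatStab.coeff L (j + 1) z ^ 2) ∧
      ∀ g h : ℝ → ℝ, HeatStab.HasL2Deriv 0 L z g → HeatStab.HasL2Deriv 0 L g h →
        ∑' j : ℕ, HeatStab.eigenvalue L (deriv f 0) (j + 1) * HeatStab.coeff L (j + 1) z ^ 2 =
          ∫ x in (0 : ℝ)..L, z x * (h x + deriv f 0 * z x)) ∧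
    ∀ n : ℕ, 1 ≤ n →
      (∃ K : Fin (n + 1) → ℝ, HeatStab.PlacesPoles L (deriv f 0) n K) ∧
      ∀ K : Fin (n + 1) → ℝ, HeatStab.PlacesPoles L (deriv f 0) n K →
        (∃ P, HeatStab.SolvesLyapunov L (deriv f 0) n K P) ∧
        (HeatStab.eigenvalue L (deriv f 0) (n + 1) < 0 →
          HeatStab.IsLocallyAsymptoticallyStable L f n K ∧
          ∀ P, HeatStab.SolvesLyapunov L (deriv f 0) n K P →
            ∃ γ₀ > 0, ∀ γ ≥ γ₀, HeatStab.IsLyapunovFunction L f n K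
              (HeatStab.lyapV L (deriv f 0) n P γ)) := by
  have hrem := HeatStab.hasQuadraticRemainder_of_contDiff hf hf0
  have hlip := HeatStab.isLipschitzOnBounded_of_contDiff (hf.of_le one_le_two)
  refine ⟨HeatStab.isDirichletEigenbasis_mode hL _, fun z hz =>
    ⟨HeatStab.summable_eigenvalue_mul_coeff_sq hL _ hz, fun g h hg hh =>
      HeatStab.tsum_eigenvalue_mul_coeff_sq hL _ hz hg hh⟩, fun n _ =>
    ⟨HeatStab.exists_placesPoles hL _ n, fun K hK => ⟨HeatStab.exists_solvesLyapunov hK,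
      fun hn => ⟨HeatStab.isLocallyAsymptoticallyStable hL hf.continuous hf0 hlip hrem hn hK,
        fun P hP => HeatStab.exists_isLyapunovFunction hL hf.continuous hrem hn hP⟩⟩⟩⟩
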